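/- **Setting.** A consumer lives for $T$ periods, $1\le T\le\infty$. Her type $\theta_t\in\{l,h\}$ follows a Markov chain with $\mathbb P(\theta_1=i)=\mu_i>0$ and $\mathbb P(\theta_{t+1}=j\mid\theta_t=i)=\pi_{ij}$, where $\pi_{ll}>\pi_{hl}$ and $\pi_{hh}>\pi_{lh}$. Given $\theta_t=i$, income $y_t$ lies in a finite set $Y\subset\mathbb R_+$ and has law $p_i$, with $\sum_y p_l(y)y<\sum_y p_h(y)y$. The utility function $u:\mathbb R_+\to\mathbb R$ is $C^2$, strictly increasing and strictly concave; consumer and firms have the discount factor $\delta\in(0,1)$, and firms are risk neutral. Let $\phi:Y\to\Phi$ be a surjective signal function. A direct mechanism $M=\{z_t\}_{t=1}^T$ specifies consumption $z_t(y_t\mid\phi^{t-1},\hat\theta^{t})\ge 0$ as a function of the past signals $\phi(y_1),\dots,\phi(y_{t-1})$, the reports $\hat\theta_1,\dots,\hat\theta_t$ and current income $y_t$. A reporting strategy selects $\hat\theta_t$ as a function of past incomes, past reports, past types and the current type. $M$ is incentive compatible if truth-telling maximizes ex-ante expected discounted utility. Under truth-telling, let $V_1(M\mid i)$ and $\Pi_i(M)$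 be the expected discounted utility $\mathbb E[\sum_t\delta^{t-1}u(c_t)\mid\theta_1=i]$ and profit $\mathbb E[\sum_t\delta^{t-1}(y_t-c_t)\mid\theta_1=i]$, and let $\Pi(M)=\mu_l\Pi_l(M)+\mu_h\Pi_h(M)$. Let $\mathcal V$ be the set of pairs $(V_1(M\mid l),V_1(M\mid h))\in\mathbb R^2$ over incentive compatible $M$ with $\Pi(M)>-\infty$. For $V\in\mathcal V$ let $M^V$ maximize $\Pi(M)$ over incentive compatible $M$ with $V_1(M\mid i)=V_i$ for $i=l,h$; assume that a maximizer exists for every $V\in\mathcal V$. Write $\Pi_i(V)=\Pi_i(M^V)$. Let $$c^{FI}_i=\frac{\mathbb E[\sum_t\delta^{t-1}y_t\mid\theta_1=i]}{\sum_t\delta^{t-1}},\qquad V^{FI}_i=u(c^{FI}_i)\sum_{t=1}^T\delta^{t-1},$$ and assume $(V^{FI}_l,V^{FI}_h)\in\mathcal V$. **Game.** At least two (finitely many) firms simultaneously offer direct mechanisms (not necessarily incentive compatible) in which each initial type has an optimal reporting strategy; this is no restriction if $T<\infty$ or $u$ is bounded. The consumer observes $\theta_1$ and the offers, accepts at most one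 offer (possibly at random), and then reports in the accepted mechanism; if she accepts none, she consumes her income. A pure-strategy PBE is a profile in which firms' offers are deterministic, each firm's offer maximizes its expected profit given the other offers and the consumer's strategy, and after every profile of offers each initial type chooses an acceptance rule and a reporting strategy that maximize her expected utility. Moreover the consumer treats firms symmetrically, and she reports truthfully whenever this is optimal. The profile has outcome $M$ if, for each initial type, on-path consumption almost surely equals consumption in $M$ under truth-telling. **Proposition.** There is a unique pair $V^*\in\mathcal V$ with $V^*_l=V^{FI}_l$ and $\Pi_h(V^*)=0$, and $M^{V^*}$ is unique up to events of probability zero under truth-telling. Every pure-strategy PBE has outcome $M^{V^*}$. A pure-strategy PBE exists if and only if the right-derivative of $V_l\mapsto\Pi_h(V_l,V_h^*)$ at $V_l^*$ is finite and $$u'(c^{FI}_l)\,\frac{\partial_+\Pi_h(V^*)}{\partial V_l}\ \le\ \frac{\mu_l}{\mu_h}.$$ -/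

import Mathlib

open scoped NNReal ENNReal

noncomputable section

namespace Screening

/-- The two types of a consumer in a period. -/
inductive CType where
  | low
  | high
  deriving DecidableEq

instance : Fintype CType where
  elems := {CType.low, CType.high}
  complete := by intro x; cases x <;> decide

open CType

/-- The primitives of the insurance economy: horizon `T ≤ ∞`, a finite set `Y` of nonnegative
incomes, income distributions `p θ`, Markov transition probabilities `trans i j = ℙ(θ' = j ∣ θ = i)`,
distribution `prior` of the first type, discount factor `δ`, Bernoulli utility `u` on `[0, ∞)` and
the signal function `sig`, which says what a contract may recall of a past income. -/
structure Economy (Y Φ : Type*) [Fintype Y] where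
  T : ℕ∞
  one_le_T : 1 ≤ T
  income : Y → ℝ≥0
  income_injective : Function.Injective income
  p : CType → Y → ℝ
  p_nonneg : ∀ θ y, 0 ≤ p θ y
  p_sum : ∀ θ, ∑ y, p θ y = 1
  mean_lt : ∑ y, p low y * (income y : ℝ) < ∑ y, p high y * (income y : ℝ)
  trans : CType → CType → ℝ
  trans_nonneg : ∀ i j, 0 ≤ trans i j
  trans_sum : ∀ i, ∑ j, trans i j = 1
  persistent_low : trans high low < trans low low
  persistent_high : trans low high < trans high high
  prior : CType → ℝ
  prior_pos : ∀ θ, 0 < prior θ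
  prior_sum : ∑ θ, prior θ = 1
  δ : ℝ
  δ_pos : 0 < δ
  δ_lt_one : δ < 1
  u : ℝ → ℝ
  u_contDiff : ContDiffOn ℝ 2 u (Set.Ici 0)
  u_strictConcave : StrictConcaveOn ℝ (Set.Ici 0) u
  u_strictMono : StrictMonoOn u (Set.Ici 0)
  sig : Y → Φ
  sig_surjective : Function.Surjective sig

/-- A direct mechanism: after an observable history of past signals and reports (earliest first) and
a current report, the flow contract gives consumption as a function of current income.
The period is the length of the history plus one; periods after `T` play no role. -/
abbrev Mechanism (Y Φ : Type*) := List (Φ × CType) → CType → Y → ℝ≥0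

/-- A reporting strategy: the current report as a function of the private history of past incomes,
reports and types (earliest first) and of the current type. -/
abbrev Reporting (Y : Type*) := List (Y × CType × CType) → CType → CType

/-- What remains of a mechanism, or of a reporting strategy, after a first period `a`. -/
def after {A B : Type*} (f : List A → B) (a : A) : List A → B := fun h => f (a :: h)

/-- Truth-telling. -/
def truth {Y : Type*} : Reporting Y := fun _ θ => θ

namespace Economy

variable {Y Φ : Type*} [Fintype Y] (E : Economy Y Φ)

/-- The expectation of `g c`, where `c` is consumption `t` periods after the first one, when a
consumer whose first type is `θ` uses the reporting strategy `r` in the mechanism `z`. -/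
def expFlow (g : ℝ≥0 → ℝ) : ℕ → Mechanism Y Φ → Reporting Y → CType → ℝ
  | 0, z, r, θ => ∑ y, E.p θ y * g (z [] (r [] θ) y)
  | t + 1, z, r, θ => ∑ y, E.p θ y * ∑ θ', E.trans θ θ' *
      expFlow g t (after z (E.sig y, r [] θ)) (after r (y, r [] θ, θ)) θ'

open scoped Classical in
/-- `∑ δ^(t-1)` over the periods `t = 1, …, T`. -/
def annuity : ℝ := ∑' t : ℕ, if (t : ℕ∞) < E.T then E.δ ^ t else 0

open scoped Classical in
/-- The expected discounted sum of `g c_t` over the periods, for a nonnegative function `g`. -/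
def discounted (g : ℝ≥0 → ℝ) (z : Mechanism Y Φ) (r : Reporting Y) (θ : CType) : ℝ≥0∞ :=
  ∑' t : ℕ, if (t : ℕ∞) < E.T then ENNReal.ofReal (E.δ ^ t * E.expFlow g t z r θ) else 0

/-- Expected discounted utility conditional on the first type `θ`. Since `u ≥ u 0`, it is always
defined as an element of `(-∞, ∞]`; it is computed as `u 0 ∑ δ^(t-1)` plus the
expected discounted sum of the nonnegative terms `u c_t - u 0`. -/
def utility (z : Mechanism Y Φ) (r : Reporting Y) (θ : CType) : EReal :=
  ((E.u 0 * E.annuity : ℝ) : EReal) + (E.discounted (fun c => E.u c - E.u 0) z r θ : EReal)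

/-- Ex-ante expected utility, before the first type is drawn. -/
def exAnteUtility (z : Mechanism Y Φ) (r : Reporting Y) : EReal :=
  ∑ θ, (E.prior θ : EReal) * E.utility z r θ

/-- Incentive compatibility of a direct mechanism. -/
def IncentiveCompatible (z : Mechanism Y Φ) : Prop :=
  ∀ r, E.exAnteUtility z r ≤ E.exAnteUtility z truth

/-- No insurance: consumption equals income in every period. -/
def autarky : Mechanism Y Φ := fun _ _ y => E.income y

/-- Expected discounted income conditional on the first type. -/
def incomeValue (θ : CType) : ℝ := (E.discounted (fun c => (c : ℝ)) E.autarky truth θ).toReal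

/-- Expected discounted profit from a consumer with first type `θ` who uses the reporting strategy
`r` in the mechanism `z`: income minus consumption. It lies in `[-∞, ∞)`. -/
def typeProfit (z : Mechanism Y Φ) (r : Reporting Y) (θ : CType) : EReal :=
  (E.incomeValue θ : EReal) - (E.discounted (fun c => (c : ℝ)) z r θ : EReal)

/-- Expected discounted profit of a mechanism under truth-telling. -/
def profit (z : Mechanism Y Φ) : EReal :=
  ∑ θ, (E.prior θ : EReal) * E.typeProfit z truth θ

/-- The mechanism gives each first type `θ`, when reporting truthfully, the utility `V θ`. -/
def Delivers (z : Mechanism Y Φ) (V : CType → ℝ) : Prop :=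
  ∀ θ, E.utility z truth θ = (V θ : EReal)

/-- The set `𝒱` of utility pairs feasible with incentive compatibility and profit above `-∞`. -/
def feasible : Set (CType → ℝ) :=
  {V | ∃ z, E.IncentiveCompatible z ∧ ⊥ < E.profit z ∧ E.Delivers z V}

/-- `z` maximizes profit among the incentive compatible mechanisms that deliver `V`. -/
def Solves (V : CType → ℝ) (z : Mechanism Y Φ) : Prop :=
  E.IncentiveCompatible z ∧ E.Delivers z V ∧
    ∀ z', E.IncentiveCompatible z' → E.Delivers z' V → E.profit z' ≤ E.profit z

open scoped Classical in
/-- `Π_θ(V)`: the profit, conditional on the first type `θ`, in a profit-maximizing mechanism that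
delivers `V`. (Such a mechanism is unique up to events of probability zero. The value `0` is a
default for the case that there is none.) -/
def optTypeProfit (V : CType → ℝ) (θ : CType) : ℝ :=
  if h : ∃ z, E.Solves V z then (E.typeProfit h.choose truth θ).toReal else 0

/-- Discounted average expected lifetime income of a consumer with first type `θ`. -/
def cFI (θ : CType) : ℝ := E.incomeValue θ / E.annuity

/-- Full-information utility of a consumer with first type `θ`. -/
def VFI (θ : CType) : ℝ := E.u (E.cFI θ) * E.annuity

/-- The conditions on the pair `V*`: it is feasible, the low type gets her full-information utility
and profit on the high type is zero. -/
def IsCompetitivePair (V : CType → ℝ) : Prop :=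
  V ∈ E.feasible ∧ V low = E.VFI low ∧ E.optTypeProfit V high = 0

/-- With first type `θ`, strategy `r` in `z` and strategy `r'` in `z'` give the same consumption
in the first `n` periods, at all realizations of types and incomes of positive probability. -/
def SameConsumption : ℕ → Mechanism Y Φ → Reporting Y → Mechanism Y Φ → Reporting Y →
    CType → Prop
  | 0, _, _, _, _, _ => True
  | n + 1, z, r, z', r', θ => ∀ y, 0 < E.p θ y →
      z [] (r [] θ) y = z' [] (r' [] θ) y ∧
      ∀ θ', 0 < E.trans θ θ' →
        SameConsumption n (after z (E.sig y, r [] θ)) (after r (y, r [] θ, θ))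
          (after z' (E.sig y, r' [] θ)) (after r' (y, r' [] θ, θ)) θ'

/-- Same consumption in all periods, almost surely given the first type `θ`. -/
def SamePath (z : Mechanism Y Φ) (r : Reporting Y) (z' : Mechanism Y Φ) (r' : Reporting Y)
    (θ : CType) : Prop :=
  ∀ n : ℕ, (n : ℕ∞) ≤ E.T → E.SameConsumption n z r z' r' θ

/-- `r` is an optimal reporting strategy in `z` for a consumer with first type `θ`. -/
def OptimalReporting (z : Mechanism Y Φ) (θ : CType) (r : Reporting Y) : Prop :=
  ∀ r', E.utility z r' θ ≤ E.utility z r θ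

/-- The offers firms can make: direct mechanisms, incentive compatible or not, in which a
consumer has an optimal reporting strategy. (The latter is no restriction if `T < ∞` or `u` is
bounded; without it the consumer has no best response to some offers.) -/
def Offer : Type _ := {z : Mechanism Y Φ // ∀ θ, ∃ r, E.OptimalReporting z θ r}

/-- A strategy profile in the game between the firms `F` and the consumer, pure for the firms. -/
structure Profile (F : Type*) where
  /-- the mechanism offered by each firm -/
  offer : F → E.Offer
  /-- after the firms' offers, the probability that type `θ` accepts a given firm's offer, or none -/
  accept : (F → E.Offer) → CType → Option F → ℝ
  /-- after the firms' offers and acceptance of one of them, the reporting strategy of a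
  consumer with first type `θ` -/
  report : (F → E.Offer) → F → CType → Reporting Y

namespace Profile

variable {E} {F : Type*} (s : E.Profile F)

/-- The mechanism a consumer is in after accepting the offer of a firm, or no offer. -/
def mech (o : F → E.Offer) : Option F → Mechanism Y Φ
  | none => E.autarky
  | some j => (o j).1

/-- The reporting strategy she uses there (irrelevant if she accepts no offer). -/
def rep (o : F → E.Offer) (θ : CType) : Option F → Reporting Y
  | none => truth
  | some j => s.report o j θ

/-- Her expected utility there. -/
def value (o : F → E.Offer) (θ : CType) (a : Option F) : EReal :=
  E.utility (mech o a) (s.rep o θ a) θ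

/-- The expected profit of firm `j` when the offers are `o`. -/
def firmProfit (o : F → E.Offer) (j : F) : EReal :=
  ∑ θ, ((E.prior θ * s.accept o θ (some j) : ℝ) : EReal) *
    E.typeProfit (o j).1 (s.report o j θ) θ

/-- Perfect Bayesian equilibrium in which firms play pure strategies, the consumer treats firms
symmetrically and she reports truthfully whenever this is optimal. After every profile of offers,
on or off path, each type chooses an optimal acceptance rule and an optimal reporting plan. The
only uncertainty she faces is about future moves of nature, with known law, so no beliefs have to be
specified, and an optimal plan is optimal at each private history it reaches. -/
structure IsPBE [Fintype F] [DecidableEq F] : Prop where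
  accept_mem : ∀ o θ, s.accept o θ ∈ stdSimplex ℝ (Option F)
  report_optimal : ∀ o j θ, E.OptimalReporting (o j).1 θ (s.report o j θ)
  accept_optimal : ∀ o θ a, 0 < s.accept o θ a → ∀ a', s.value o θ a' ≤ s.value o θ a
  offer_optimal : ∀ j (m : E.Offer),
    s.firmProfit (Function.update s.offer j m) j ≤ s.firmProfit s.offer j
  symmetric : ∀ (σ : Equiv.Perm F) o θ j,
    s.accept (o ∘ σ) θ (some j) = s.accept o θ (some (σ j))
  truthful : ∀ o j θ, E.OptimalReporting (o j).1 θ truth → s.report o j θ = truth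

/-- On path, consumption is almost surely the one in the mechanism `z` under truth-telling. -/
def HasOutcome (z : Mechanism Y Φ) : Prop :=
  ∀ θ a, 0 < s.accept s.offer θ a →
    E.SamePath (mech s.offer a) (s.rep s.offer θ a) z truth θ

end Profile

end Economy

end Screening

end

/-! A mechanism may condition on the first report, so the problem of delivering `V` splits by first
type. The contract for `θ₀` has to give her `V θ₀` and to give any type `θ` who makes the same first
report at most `V θ`; `Attains θ₀ V κ` says that this can be done at cost `κ`. Contracts for the two
types can be glued freely (`mem_feasible_iff`), and a solution minimizes the two costs separately
(`Solves.exists_min`).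

Two tools carry the proof. One is convexity, `Attains.mix`: averaging two contracts in utility units
preserves the incentive constraints and, as `u` is concave, costs at most the average. Offers need
not be truthful, and a report may depend on past incomes of which the contract sees only signals. A
reporting strategy is therefore first turned into a truthful contract, by averaging utilities over
past incomes given signals and types (`IsPlan.blend`). Strict concavity makes cost minimizers unique
(`IsPlan.samePath`). The other tool is the tangent bound `le_tangent`: utility is at most that of a
constant `c` plus `u'(c)` times the spending beyond `c`.

With the low type at her full-information utility, the least cost for the high type is convex in her
own utility. It is below her expected income at the pooled full-insurance contract and not below it
at her full-information utility, so it crosses her income exactly once. This gives `V*`.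

In equilibrium, Bertrand competition leaves no profit and makes accepted contracts cost-minimizing
(`IsPBE.zero_profit`). If the low type got more than her full-information utility, she would be
subsidized by the high type. A firm could then skim the high type by a small move towards the
full-information pair, which raises the high type's utility and lowers the low type's. Hence
equilibrium utilities are `V*`.

At `V*` only deviations that attract both types can pay. Raising the low type's utility by `ε` loses
at least `ε / u'(c)` on her and gains at most `ε` times the right derivative on the high type, by
concavity. To first order both bounds are tight, and weighing them by the prior gives the stated
criterion. For sufficiency all firms offer the mechanism of `V*` and ties are broken in its favor.
-/

noncomputable section

namespace Screening

open CType

namespace Economy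

variable {Y Φ : Type*} [Fintype Y] (E : Economy Y Φ)

/-! ### Expected flows, discounting, and extended-real values as convergent series -/

section

/-- A real-valued payoff as a function of the public history, the current report and income. -/
abbrev _root_.Screening.Payoff (Y Φ : Type*) := List (Φ × CType) → CType → Y → ℝ

/-- The expected payoff `t` periods after the first one. -/
def flow : ℕ → Payoff Y Φ → Reporting Y → CType → ℝ
  | 0, w, r, θ => ∑ y, E.p θ y * w [] (r [] θ) y
  | t + 1, w, r, θ => ∑ y, E.p θ y * ∑ θ', E.trans θ θ' *
      flow t (after w (E.sig y, r [] θ)) (after r (y, r [] θ, θ)) θ'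

theorem expFlow_eq_flow (g : ℝ≥0 → ℝ) (t : ℕ) (z : Mechanism Y Φ) (r : Reporting Y) (θ : CType) :
    E.expFlow g t z r θ = E.flow t (fun h θ y => g (z h θ y)) r θ := by
  induction t generalizing z r θ with
  | zero => rfl
  | succ t ih => simp only [expFlow, flow, ih]; rfl

theorem flow_add (t : ℕ) (w w' : Payoff Y Φ) (r : Reporting Y) (θ : CType) :
    E.flow t (fun h θ y => w h θ y + w' h θ y) r θ = E.flow t w r θ + E.flow t w' r θ := by
  induction t generalizing w w' r θ with
  | zero => simp only [flow, mul_add, Finset.sum_add_distrib]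
  | succ t ih =>
    simp only [flow, ← Finset.sum_add_distrib, ← mul_add]
    exact Finset.sum_congr rfl fun y _ => congrArg _ <| Finset.sum_congr rfl fun θ' _ =>
      congrArg _ (ih _ _ _ _)

theorem flow_mul (t : ℕ) (c : ℝ) (w : Payoff Y Φ) (r : Reporting Y) (θ : CType) :
    E.flow t (fun h θ y => c * w h θ y) r θ = c * E.flow t w r θ := by
  induction t generalizing w r θ with
  | zero => simp only [flow, Finset.mul_sum, mul_left_comm]
  | succ t ih =>
    simp only [flow, Finset.mul_sum]
    refine Finset.sum_congr rfl fun y _ => Finset.sum_congr rfl fun θ' _ => ?_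
    have := ih (after w (E.sig y, r [] θ)) (after r (y, r [] θ, θ)) θ'
    rw [mul_left_comm c, mul_left_comm c, ← this]
    rfl

theorem flow_mono (t : ℕ) {w w' : Payoff Y Φ} (h : ∀ l θ y, w l θ y ≤ w' l θ y)
    (r : Reporting Y) (θ : CType) : E.flow t w r θ ≤ E.flow t w' r θ := by
  induction t generalizing w w' r θ with
  | zero => exact Finset.sum_le_sum fun y _ => mul_le_mul_of_nonneg_left (h _ _ _) (E.p_nonneg _ _)
  | succ t ih =>
    exact Finset.sum_le_sum fun y _ => mul_le_mul_of_nonneg_left (Finset.sum_le_sum fun θ' _ =>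
      mul_le_mul_of_nonneg_left (ih (fun l θ y => h _ _ _) _ _) (E.trans_nonneg _ _))
      (E.p_nonneg _ _)

theorem flow_const (t : ℕ) (c : ℝ) (r : Reporting Y) (θ : CType) :
    E.flow t (fun _ _ _ => c : Payoff Y Φ) r θ = c := by
  induction t generalizing r θ with
  | zero => simp only [flow, ← Finset.sum_mul, E.p_sum, one_mul]
  | succ t ih =>
    have : ∀ y, after (fun _ _ _ => c : Payoff Y Φ) y = fun _ _ _ => c := fun _ => rfl
    simp only [flow, this, ih, ← Finset.sum_mul, E.p_sum, E.trans_sum, one_mul]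

theorem flow_sum {ι : Type*} (s : Finset ι) (q : ι → ℝ) (t : ℕ) (w : ι → Payoff Y Φ)
    (r : Reporting Y) (θ : CType) :
    E.flow t (fun h θ y => ∑ i ∈ s, q i * w i h θ y) r θ = ∑ i ∈ s, q i * E.flow t (w i) r θ := by
  classical
  induction s using Finset.induction_on with
  | empty => simpa using E.flow_const t 0 r θ
  | insert i s hi ih =>
    simp only [Finset.sum_insert hi]
    rw [flow_add E t (fun h θ y => q i * w i h θ y), flow_mul, ih]

theorem flow_nonneg (t : ℕ) {w : Payoff Y Φ} (h : ∀ l θ y, 0 ≤ w l θ y)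
    (r : Reporting Y) (θ : CType) : 0 ≤ E.flow t w r θ := by
  simpa [E.flow_const] using E.flow_mono t (w := fun _ _ _ => 0) h r θ

theorem tendsto_flow (t : ℕ) {w : ℕ → Payoff Y Φ} {w' : Payoff Y Φ}
    (h : ∀ l θ y, Filter.Tendsto (fun k => w k l θ y) Filter.atTop (nhds (w' l θ y)))
    (r : Reporting Y) (θ : CType) :
    Filter.Tendsto (fun k => E.flow t (w k) r θ) Filter.atTop (nhds (E.flow t w' r θ)) := by
  induction t generalizing w w' r θ with
  | zero => exact tendsto_finsetSum _ fun y _ => (h _ _ _).const_mul _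
  | succ t ih =>
    exact tendsto_finsetSum _ fun y _ => (tendsto_finsetSum _ fun θ' _ =>
      (ih (fun l θ y => h _ _ _) _ _).const_mul _).const_mul _

/-- The reporting strategy that follows `R θ` when the first type is `θ`. -/
def _root_.Screening.byFirstType {Y : Type*} (R : CType → Reporting Y) : Reporting Y
  | [], θ => R θ [] θ
  | a :: h, θ => R a.2.2 (a :: h) θ

/-- Strategies chosen separately for each first type form a single strategy. This is used to deviate
for one type only and to assemble continuations. -/
theorem flow_byFirstType (t : ℕ) (w : Payoff Y Φ) (R : CType → Reporting Y) (θ : CType) :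
    E.flow t w (byFirstType R) θ = E.flow t w (R θ) θ := by
  cases t <;> rfl

/-- The mechanism that follows `z θ` when the first report is `θ`. -/
def _root_.Screening.byFirstReport {A : Type*} (z : CType → List (Φ × CType) → CType → A) :
    List (Φ × CType) → CType → A
  | [], θ => z θ [] θ
  | a :: h, θ => z a.2 (a :: h) θ

theorem flow_byFirstReport (t : ℕ) (w : CType → Payoff Y Φ) (r : Reporting Y) (θ : CType) :
    E.flow t (byFirstReport w) r θ = E.flow t (w (r [] θ)) r θ := by
  cases t <;> rfl

theorem sum_ctype {M : Type*} [AddCommMonoid M] (f : CType → M) : ∑ θ, f θ = f low + f high := by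
  have : (Finset.univ : Finset CType) = {low, high} := rfl
  rw [this, Finset.sum_pair (by decide)]

open scoped Classical in
/-- The weight of a period in discounted sums. -/
def weight (t : ℕ) : ℝ := if (t : ℕ∞) < E.T then E.δ ^ t else 0

theorem weight_nonneg (t : ℕ) : 0 ≤ E.weight t := by
  unfold weight; split_ifs
  · exact pow_nonneg E.δ_pos.le _
  · exact le_rfl

theorem weight_pos {t : ℕ} (h : (t : ℕ∞) < E.T) : 0 < E.weight t := by
  simpa [weight, h] using pow_pos E.δ_pos _

theorem weight_zero : E.weight 0 = 1 := by
  have : ((0 : ℕ) : ℕ∞) < E.T := lt_of_lt_of_le (by simp) E.one_le_T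
  simp only [weight, this, if_true, pow_zero]

theorem hasSum_weight : HasSum E.weight E.annuity := by
  have : Summable E.weight := by
    refine Summable.of_nonneg_of_le E.weight_nonneg (fun t => ?_)
      (summable_geometric_of_lt_one E.δ_pos.le E.δ_lt_one)
    unfold weight; split_ifs
    · exact le_rfl
    · exact pow_nonneg E.δ_pos.le _
  exact this.hasSum

theorem annuity_pos : 0 < E.annuity := by
  have := sum_le_hasSum {0} (fun t _ => E.weight_nonneg t) E.hasSum_weight
  simp [E.weight_zero] at this
  linarith

theorem _root_.Screening.tsum_ofReal_of_hasSum {b : ℕ → ℝ} (hb : ∀ t, 0 ≤ b t) {x : ℝ}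
    (h : HasSum b x) : ∑' t, ENNReal.ofReal (b t) = ENNReal.ofReal x := by
  rw [← h.tsum_eq, ENNReal.ofReal_tsum_of_nonneg hb h.summable]

theorem _root_.Screening.hasSum_of_tsum_ofReal {b : ℕ → ℝ} (hb : ∀ t, 0 ≤ b t)
    (h : ∑' t, ENNReal.ofReal (b t) ≠ ⊤) : HasSum b (∑' t, ENNReal.ofReal (b t)).toReal := by
  have h1 := ENNReal.hasSum_toReal h
  rw [ENNReal.tsum_toReal_eq (fun t => ENNReal.ofReal_ne_top)]
  simpa [ENNReal.toReal_ofReal, hb] using h1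

theorem _root_.Screening.tsum_ofReal_le_iff {b : ℕ → ℝ} (hb : ∀ t, 0 ≤ b t) {x : ℝ} (hx : 0 ≤ x) :
    ∑' t, ENNReal.ofReal (b t) ≤ ENNReal.ofReal x ↔ ∀ n, ∑ t ∈ Finset.range n, b t ≤ x := by
  rw [ENNReal.tsum_eq_iSup_nat, iSup_le_iff]
  refine forall_congr' fun n => ?_
  rw [← ENNReal.ofReal_sum_of_nonneg (fun t _ => hb t), ENNReal.ofReal_le_ofReal_iff hx]

/-- Utility gained over zero consumption. -/
def gain (z : Mechanism Y Φ) : Payoff Y Φ := fun h θ y => E.u (z h θ y) - E.u 0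

/-- Consumption as a payoff. -/
def _root_.Screening.cons (z : Mechanism Y Φ) : Payoff Y Φ := fun h θ y => (z h θ y : ℝ)

theorem u_zero_le (c : ℝ≥0) : 0 ≤ E.u c - E.u 0 :=
  sub_nonneg.2 (E.u_strictMono.monotoneOn (Set.mem_Ici.2 le_rfl) c.2 c.2)

theorem gain_nonneg (z : Mechanism Y Φ) (h θ y) : 0 ≤ E.gain z h θ y := E.u_zero_le _

omit [Fintype Y] in
theorem _root_.Screening.cons_nonneg (z : Mechanism Y Φ) (h θ y) : 0 ≤ cons z h θ y := (z h θ y).2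

theorem discounted_eq (g : ℝ≥0 → ℝ) (z : Mechanism Y Φ) (r : Reporting Y) (θ : CType) :
    E.discounted g z r θ =
      ∑' t, ENNReal.ofReal (E.weight t * E.flow t (fun h θ y => g (z h θ y)) r θ) := by
  unfold discounted
  congr 1; ext1 t
  rw [expFlow_eq_flow]
  unfold weight
  split_ifs <;> simp

/-- The utility level of zero consumption in every period. -/
def floor : ℝ := E.u 0 * E.annuity

theorem weight_gain_nonneg (z : Mechanism Y Φ) (r : Reporting Y) (θ : CType) (t : ℕ) :
    0 ≤ E.weight t * E.flow t (E.gain z) r θ :=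
  mul_nonneg (E.weight_nonneg t) (E.flow_nonneg t (E.gain_nonneg z) r θ)

theorem weight_cons_nonneg (z : Mechanism Y Φ) (r : Reporting Y) (θ : CType) (t : ℕ) :
    0 ≤ E.weight t * E.flow t (cons z) r θ :=
  mul_nonneg (E.weight_nonneg t) (E.flow_nonneg t (cons_nonneg z) r θ)

theorem utility_eq (z : Mechanism Y Φ) (r : Reporting Y) (θ : CType) :
    E.utility z r θ = (E.floor : EReal) +
      ((∑' t, ENNReal.ofReal (E.weight t * E.flow t (E.gain z) r θ) : ℝ≥0∞) : EReal) := by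
  unfold utility floor
  rw [discounted_eq]; rfl

theorem typeProfit_eq (z : Mechanism Y Φ) (r : Reporting Y) (θ : CType) :
    E.typeProfit z r θ = (E.incomeValue θ : EReal) -
      ((∑' t, ENNReal.ofReal (E.weight t * E.flow t (cons z) r θ) : ℝ≥0∞) : EReal) := by
  unfold typeProfit
  rw [discounted_eq]; rfl

theorem utility_eq_coe_iff {z : Mechanism Y Φ} {r : Reporting Y} {θ : CType} {x : ℝ} :
    E.utility z r θ = (x : EReal) ↔
      HasSum (fun t => E.weight t * E.flow t (E.gain z) r θ) (x - E.floor) := by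
  rw [utility_eq]
  constructor
  · intro h
    have hne : ∑' t, ENNReal.ofReal (E.weight t * E.flow t (E.gain z) r θ) ≠ ⊤ := by
      intro h'; rw [h'] at h; simp at h
    have := hasSum_of_tsum_ofReal (E.weight_gain_nonneg z r θ) hne
    convert this using 1
    have h2 := ENNReal.ofReal_toReal hne
    rw [← h2, EReal.coe_ennreal_ofReal, max_eq_left ENNReal.toReal_nonneg] at h
    rw [← EReal.coe_add, EReal.coe_eq_coe_iff] at h
    linarith
  · intro h
    have h0 := h.nonneg (E.weight_gain_nonneg z r θ)
    rw [tsum_ofReal_of_hasSum (E.weight_gain_nonneg z r θ) h, EReal.coe_ennreal_ofReal,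
      max_eq_left h0, ← EReal.coe_add]
    congr 1; ring

theorem typeProfit_eq_coe_iff {z : Mechanism Y Φ} {r : Reporting Y} {θ : CType} {x : ℝ} :
    E.typeProfit z r θ = (x : EReal) ↔
      HasSum (fun t => E.weight t * E.flow t (cons z) r θ) (E.incomeValue θ - x) := by
  rw [typeProfit_eq]
  constructor
  · intro h
    have hne : ∑' t, ENNReal.ofReal (E.weight t * E.flow t (cons z) r θ) ≠ ⊤ := by
      intro h'; rw [h'] at h; simp at h
    have := hasSum_of_tsum_ofReal (E.weight_cons_nonneg z r θ) hne
    convert this using 1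
    have h2 := ENNReal.ofReal_toReal hne
    rw [← h2, EReal.coe_ennreal_ofReal, max_eq_left ENNReal.toReal_nonneg] at h
    rw [← EReal.coe_sub, EReal.coe_eq_coe_iff] at h
    linarith
  · intro h
    have h0 := h.nonneg (E.weight_cons_nonneg z r θ)
    rw [tsum_ofReal_of_hasSum (E.weight_cons_nonneg z r θ) h, EReal.coe_ennreal_ofReal,
      max_eq_left h0, ← EReal.coe_sub]
    congr 1; ring

/-- Utility may be infinite for some strategies. Bounding all partial sums avoids infinite values
and reduces incentive constraints to finite horizons, where induction applies. -/
theorem utility_le_coe_iff {z : Mechanism Y Φ} {r : Reporting Y} {θ : CType} {x : ℝ} :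
    E.utility z r θ ≤ (x : EReal) ↔
      ∀ n, ∑ t ∈ Finset.range n, E.weight t * E.flow t (E.gain z) r θ ≤ x - E.floor := by
  rw [utility_eq]
  by_cases hx : 0 ≤ x - E.floor
  · rw [← tsum_ofReal_le_iff (E.weight_gain_nonneg z r θ) hx]
    have : (x : EReal) = (E.floor : EReal) + ((ENNReal.ofReal (x - E.floor) : ℝ≥0∞) : EReal) := by
      rw [EReal.coe_ennreal_ofReal, max_eq_left hx, ← EReal.coe_add]; congr 1; ring
    rw [this, ← EReal.coe_ennreal_le_coe_ennreal_iff]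
    refine ⟨fun h => ?_, fun h => by gcongr⟩
    by_contra hlt
    exact absurd h (not_le.2 (EReal.add_lt_add_left_coe (not_le.1 hlt) E.floor))
  · constructor
    · intro h
      exfalso
      have h1 : (E.floor : EReal) ≤ x := le_trans (by
        exact le_add_of_nonneg_right (EReal.coe_ennreal_nonneg _)) h
      have : E.floor ≤ x := by exact_mod_cast h1
      linarith
    · intro h
      have := h 0
      simp at this
      linarith

theorem typeProfit_ne_top (z : Mechanism Y Φ) (r : Reporting Y) (θ : CType) :
    E.typeProfit z r θ ≠ ⊤ := by
  unfold typeProfit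
  rw [sub_eq_add_neg]
  refine EReal.add_ne_top (by simp) ?_
  rw [Ne, EReal.neg_eq_top_iff]
  exact EReal.coe_ennreal_ne_bot _

theorem exists_typeProfit_eq {z : Mechanism Y Φ} {r : Reporting Y} {θ : CType}
    (h : E.typeProfit z r θ ≠ ⊥) : ∃ x : ℝ, E.typeProfit z r θ = x :=
  ⟨_, (EReal.coe_toReal (E.typeProfit_ne_top z r θ) h).symm⟩

end

/-! ### Turning a reporting strategy into a truthful contract by averaging over past incomes -/

section

theorem exists_disintegration : ∃ q : CType → Φ → Y → ℝ, (∀ θ φ y, 0 ≤ q θ φ y) ∧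
    (∀ θ φ, ∑ y, q θ φ y = 1) ∧ ∀ θ (X : Φ → Y → ℝ),
      ∑ y, E.p θ y * ∑ y', q θ (E.sig y) y' * X (E.sig y) y' = ∑ y, E.p θ y * X (E.sig y) y := by
  classical
  let P : CType → Φ → ℝ := fun θ φ => ∑ y, if E.sig y = φ then E.p θ y else 0
  have hP0 : ∀ θ φ y, 0 ≤ (if E.sig y = φ then E.p θ y else 0) := fun θ φ y => by
    split_ifs
    · exact E.p_nonneg _ _
    · exact le_rfl
  have hP : ∀ θ φ, 0 ≤ P θ φ := fun θ φ => Finset.sum_nonneg fun y _ => hP0 θ φ y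
  have hle : ∀ θ y, E.p θ y ≤ P θ (E.sig y) := fun θ y => by
    have := Finset.single_le_sum (f := fun y' => if E.sig y' = E.sig y then E.p θ y' else 0)
      (fun y' _ => hP0 θ _ y') (Finset.mem_univ y)
    simpa using this
  -- At a signal of probability zero the unconditional law is a default that keeps the weights a
  -- probability. Such signals get weight zero in the tower property.
  refine ⟨fun θ φ y => if P θ φ = 0 then E.p θ y else if E.sig y = φ then E.p θ y / P θ φ else 0,
    fun θ φ y => ?_, fun θ φ => ?_, fun θ X => ?_⟩
  · dsimp only
    split_ifs
    · exact E.p_nonneg _ _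
    · exact div_nonneg (E.p_nonneg _ _) (hP _ _)
    · exact le_rfl
  · by_cases h : P θ φ = 0
    · simp [h, E.p_sum]
    · simp only [h, if_false]
      have : ∀ y, (if E.sig y = φ then E.p θ y / P θ φ else 0) =
          (if E.sig y = φ then E.p θ y else 0) / P θ φ := fun y => by split_ifs <;> simp
      simp only [this, ← Finset.sum_div]
      exact div_self h
  · have h1 : ∀ y y', E.p θ y * ((if P θ (E.sig y) = 0 then E.p θ y' else
        if E.sig y' = E.sig y then E.p θ y' / P θ (E.sig y) else 0) * X (E.sig y) y') =
        (if E.sig y = E.sig y' then E.p θ y else 0) *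
          (E.p θ y' / P θ (E.sig y') * X (E.sig y') y') := fun y y' => by
      by_cases h : P θ (E.sig y) = 0
      · have h0 : E.p θ y = 0 := le_antisymm (h ▸ hle θ y) (E.p_nonneg _ _)
        simp [h0]
      · by_cases h' : E.sig y' = E.sig y
        · simp [h, h']
        · simp [h, h', Ne.symm h']
    simp only [Finset.mul_sum, h1]
    rw [Finset.sum_comm]
    refine Finset.sum_congr rfl fun y _ => ?_
    rw [← Finset.sum_mul]
    change P θ (E.sig y) * _ = _
    by_cases h : P θ (E.sig y) = 0
    · have h0 : E.p θ y = 0 := le_antisymm (h ▸ hle θ y) (E.p_nonneg _ _)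
      simp [h0]
    · field_simp

/-- The law of income given the type and the signal. -/
def incomeGiven : CType → Φ → Y → ℝ := E.exists_disintegration.choose

theorem incomeGiven_nonneg (θ φ y) : 0 ≤ E.incomeGiven θ φ y :=
  E.exists_disintegration.choose_spec.1 θ φ y

theorem incomeGiven_sum (θ φ) : ∑ y, E.incomeGiven θ φ y = 1 :=
  E.exists_disintegration.choose_spec.2.1 θ φ

theorem sum_incomeGiven (θ) (X : Φ → Y → ℝ) :
    ∑ y, E.p θ y * ∑ y', E.incomeGiven θ (E.sig y) y' * X (E.sig y) y' =
      ∑ y, E.p θ y * X (E.sig y) y :=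
  E.exists_disintegration.choose_spec.2.2 θ X

/-- The payoff from using the strategy `r` as a truthful payoff, averaged over past incomes
given the signals. -/
def avg : List (Φ × CType) → Payoff Y Φ → Reporting Y → CType → Y → ℝ
  | [], w, r, θ, y => w [] (r [] θ) y
  | (φ, θ₁) :: h, w, r, θ, y => ∑ y', E.incomeGiven θ₁ φ y' *
      avg h (after w (φ, r [] θ₁)) (after r (y', r [] θ₁, θ₁)) θ y

/-- The tower property, period by period. Given the current type, income does not affect the next
type, so a past income matters only through its signal and through the reports of `r`. -/
theorem flow_avg (t : ℕ) (w : Payoff Y Φ) (r : Reporting Y) (θ : CType) :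
    E.flow t (fun h => E.avg h w r) truth θ = E.flow t w r θ := by
  induction t generalizing w r θ with
  | zero => rfl
  | succ t ih =>
    rw [flow, flow]
    rw [← E.sum_incomeGiven θ (fun φ y => ∑ θ', E.trans θ θ' *
      E.flow t (after w (φ, r [] θ)) (after r (y, r [] θ, θ)) θ')]
    refine Finset.sum_congr rfl fun y _ => congrArg _ ?_
    simp only [Finset.mul_sum]
    rw [Finset.sum_comm]
    refine Finset.sum_congr rfl fun θ' _ => ?_
    have h1 : E.flow t (after (fun h => E.avg h w r) (E.sig y, (truth : Reporting Y) [] θ))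
        (after truth (y, (truth : Reporting Y) [] θ, θ)) θ' =
        ∑ y', E.incomeGiven θ (E.sig y) y' * E.flow t
          (fun h => E.avg h (after w (E.sig y, r [] θ)) (after r (y', r [] θ, θ))) truth θ' :=
      E.flow_sum Finset.univ _ t
        (fun y' h => E.avg h (after w (E.sig y, r [] θ)) (after r (y', r [] θ, θ))) truth θ'
    rw [h1, Finset.mul_sum]
    refine Finset.sum_congr rfl fun y' _ => ?_
    rw [ih]; ring

/-- Weighted sum of payoffs in the first `n` periods. -/
def partialSum (β : ℕ → ℝ) (n : ℕ) (w : Payoff Y Φ) (r : Reporting Y) (θ : CType) : ℝ :=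
  ∑ t ∈ Finset.range n, β t * E.flow t w r θ

theorem partialSum_succ (β : ℕ → ℝ) (n : ℕ) (w : Payoff Y Φ) (r : Reporting Y) (θ : CType) :
    E.partialSum β (n + 1) w r θ = β 0 * ∑ y, E.p θ y * w [] (r [] θ) y +
      ∑ y, E.p θ y * ∑ θ', E.trans θ θ' * E.partialSum (fun t => β (t + 1)) n
        (after w (E.sig y, r [] θ)) (after r (y, r [] θ, θ)) θ' := by
  unfold partialSum
  rw [Finset.sum_range_succ', add_comm]
  congr 1
  simp only [flow, Finset.mul_sum]
  rw [Finset.sum_comm]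
  refine Finset.sum_congr rfl fun y _ => ?_
  rw [Finset.sum_comm]
  refine Finset.sum_congr rfl fun θ' _ => Finset.sum_congr rfl fun t _ => by ring

theorem partialSum_sum {ι : Type*} (s : Finset ι) (q : ι → ℝ) (β : ℕ → ℝ) (n : ℕ)
    (w : ι → Payoff Y Φ) (r : Reporting Y) (θ : CType) :
    E.partialSum β n (fun h θ y => ∑ i ∈ s, q i * w i h θ y) r θ =
      ∑ i ∈ s, q i * E.partialSum β n (w i) r θ := by
  unfold partialSum
  simp only [flow_sum, Finset.mul_sum]
  rw [Finset.sum_comm]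
  refine Finset.sum_congr rfl fun i _ => Finset.sum_congr rfl fun t _ => by ring

theorem partialSum_byFirstType (β : ℕ → ℝ) (n : ℕ) (w : Payoff Y Φ) (R : CType → Reporting Y)
    (θ : CType) : E.partialSum β n w (byFirstType R) θ = E.partialSum β n w (R θ) θ := by
  simp only [partialSum, flow_byFirstType]

/-- A deviation `r'` in the averaged payoff is no better than some strategy in the payoff that is
averaged. -/
theorem exists_partialSum_avg_le (n : ℕ) (β : ℕ → ℝ) (hβ : ∀ t, 0 ≤ β t) (w : Payoff Y Φ)
    (r r' : Reporting Y) (θ : CType) : ∃ r'' : Reporting Y, r'' [] θ = r [] (r' [] θ) ∧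
      E.partialSum β n (fun h => E.avg h w r) r' θ ≤ E.partialSum β n w r'' θ := by
  induction n generalizing β w r r' θ with
  | zero => exact ⟨fun _ _ => r [] (r' [] θ), rfl, by simp [partialSum]⟩
  | succ n ih =>
    set θ₁ := r' [] θ with hθ₁
    have key : ∀ y θ', ∃ r'' : Reporting Y,
        ∑ y', E.incomeGiven θ₁ (E.sig y) y' * E.partialSum (fun t => β (t + 1)) n
          (fun h => E.avg h (after w (E.sig y, r [] θ₁)) (after r (y', r [] θ₁, θ₁)))
          (after r' (y, θ₁, θ)) θ' ≤
        E.partialSum (fun t => β (t + 1)) n (after w (E.sig y, r [] θ₁)) r'' θ' := by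
      intro y θ'
      choose R _ hR using fun y' : Y => ih (fun t => β (t + 1)) (fun t => hβ _)
        (after w (E.sig y, r [] θ₁)) (after r (y', r [] θ₁, θ₁)) (after r' (y, θ₁, θ)) θ'
      -- The best fictitious income replaces the average over `y'`.
      obtain ⟨y₀, -, hy₀⟩ := Finset.exists_max_image Finset.univ (fun y' =>
        E.partialSum (fun t => β (t + 1)) n (after w (E.sig y, r [] θ₁)) (R y') θ') ⟨y, by simp⟩
      refine ⟨R y₀, ?_⟩
      calc _ ≤ ∑ y', E.incomeGiven θ₁ (E.sig y) y' * E.partialSum (fun t => β (t + 1)) n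
            (after w (E.sig y, r [] θ₁)) (R y₀) θ' :=
            Finset.sum_le_sum fun y' _ => mul_le_mul_of_nonneg_left
              ((hR y').trans (hy₀ y' (by simp))) (E.incomeGiven_nonneg _ _ _)
        _ = _ := by rw [← Finset.sum_mul, incomeGiven_sum, one_mul]
    choose R hR using key
    -- The actual first income, `a.1`, only selects the continuation for its signal; `byFirstType`
    -- then picks the strategy for the next true type.
    refine ⟨fun h cur => match h with
      | [] => r [] θ₁
      | a :: h' => byFirstType (R a.1) h' cur, rfl, ?_⟩
    rw [partialSum_succ, partialSum_succ]
    refine add_le_add le_rfl (Finset.sum_le_sum fun y _ => mul_le_mul_of_nonneg_left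
      (Finset.sum_le_sum fun θ' _ => mul_le_mul_of_nonneg_left ?_ (E.trans_nonneg _ _))
      (E.p_nonneg _ _))
    refine le_trans (le_of_eq ?_) ((hR y θ').trans (le_of_eq
        (E.partialSum_byFirstType _ _ _ (R y) _).symm))
    rw [← partialSum_sum]
    rfl

end

/-! ### Inverse utility and the blending of contracts in utility units -/

section

/-- The set of utility gains over zero consumption. -/
def gainRange : Set ℝ := Set.range fun c : ℝ≥0 => E.u c - E.u 0

theorem u_continuousOn : ContinuousOn E.u (Set.Ici 0) := E.u_contDiff.continuousOn

theorem continuous_gain : Continuous fun c : ℝ≥0 => E.u c - E.u 0 := by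
  have : Continuous fun c : ℝ≥0 => E.u c :=
    E.u_continuousOn.comp_continuous NNReal.continuous_coe fun c => c.2
  exact this.sub continuous_const

theorem convex_gainRange : Convex ℝ E.gainRange :=
  (isPreconnected_range E.continuous_gain).ordConnected.convex

theorem u_injective {c c' : ℝ≥0} (h : E.u c = E.u c') : c = c' :=
  NNReal.coe_injective (E.u_strictMono.injOn c.2 c'.2 h)

open scoped Classical in
/-- The consumption with a given utility gain over zero consumption. -/
def invGain (x : ℝ) : ℝ≥0 := if h : ∃ c : ℝ≥0, E.u c - E.u 0 = x then h.choose else 0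

theorem gain_invGain {x : ℝ} (hx : x ∈ E.gainRange) : E.u (E.invGain x) - E.u 0 = x := by
  have hx' : ∃ c : ℝ≥0, E.u c - E.u 0 = x := hx
  rw [invGain, dif_pos hx']
  exact hx'.choose_spec

theorem invGain_gain (c : ℝ≥0) : E.invGain (E.u c - E.u 0) = c :=
  E.u_injective (sub_left_injective (E.gain_invGain (Set.mem_range_self c)))

theorem convexOn_invGain : ConvexOn ℝ E.gainRange fun x => (E.invGain x : ℝ) := by
  refine ⟨E.convex_gainRange, ?_⟩
  rintro x hx y hy a b ha hb hab
  have h := E.u_strictConcave.concaveOn.2 (E.invGain x).2 (E.invGain y).2 ha hb hab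
  have hxy := E.gain_invGain (E.convex_gainRange hx hy ha hb hab)
  have hx' := E.gain_invGain hx
  have hy' := E.gain_invGain hy
  have h0 : (0 : ℝ) ≤ a • (E.invGain x : ℝ) + b • (E.invGain y : ℝ) := by
    simp only [smul_eq_mul]; positivity
  refine (E.u_strictMono.le_iff_le (E.invGain _).2 h0).1 (le_trans (le_of_eq ?_) h)
  simp only [smul_eq_mul] at *
  change E.u (E.invGain (a * x + b * y) : ℝ≥0) =
    a * E.u (E.invGain x : ℝ≥0) + b * E.u (E.invGain y : ℝ≥0)
  linear_combination hxy - a * hx' - b * hy' - E.u 0 * hab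

/-- Strict concavity enters the uniqueness of optimal contracts only here. The weights have the form
`a` and `1 - a` of `blend`. -/
theorem invGain_midpoint_lt {c c' : ℝ≥0} (h : c ≠ c') :
    (E.invGain (2⁻¹ * (E.u c - E.u 0) + (1 - 2⁻¹) * (E.u c' - E.u 0)) : ℝ) <
      2⁻¹ * c + (1 - 2⁻¹) * c' := by
  have hs := E.u_strictConcave.2 c.2 c'.2 (fun h' => h (NNReal.coe_injective h'))
    (show (0 : ℝ) < 2⁻¹ by norm_num) (show (0 : ℝ) < 1 - 2⁻¹ by norm_num) (by norm_num)
  have hm := E.gain_invGain (E.convex_gainRange (Set.mem_range_self c) (Set.mem_range_self c')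
    (show (0 : ℝ) ≤ 2⁻¹ by norm_num) (show (0 : ℝ) ≤ 1 - 2⁻¹ by norm_num) (by norm_num))
  have h0 : (0 : ℝ) ≤ 2⁻¹ * c + (1 - 2⁻¹) * c' := by
    have := c.2; have := c'.2; norm_num; positivity
  refine (E.u_strictMono.lt_iff_lt (E.invGain _).2 h0).1 (lt_of_le_of_lt (le_of_eq ?_) hs)
  simp only [smul_eq_mul] at *
  change E.u (E.invGain _ : ℝ≥0) = 2⁻¹ * E.u c + (1 - 2⁻¹) * E.u c'
  linarith

theorem avg_mem_gainRange (h : List (Φ × CType)) (z : Mechanism Y Φ) (r : Reporting Y)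
    (θ : CType) (y : Y) : E.avg h (E.gain z) r θ y ∈ E.gainRange := by
  induction h generalizing z r with
  | nil => exact Set.mem_range_self _
  | cons a h ih =>
    exact E.convex_gainRange.sum_mem (fun y _ => E.incomeGiven_nonneg _ _ y)
      (E.incomeGiven_sum _ _) fun y' _ => ih (after z (a.1, r [] a.2)) _

/-- The expectation, `t` periods after the first one, of a function of the consumptions from
using `r` in `z` and `r'` in `z'` at the same realizations of types and incomes. -/
def pairFlow (g : ℝ≥0 → ℝ≥0 → ℝ) :
    ℕ → Mechanism Y Φ → Reporting Y → Mechanism Y Φ → Reporting Y → CType → ℝ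
  | 0, z, r, z', r', θ => ∑ y, E.p θ y * g (z [] (r [] θ) y) (z' [] (r' [] θ) y)
  | t + 1, z, r, z', r', θ => ∑ y, E.p θ y * ∑ θ', E.trans θ θ' *
      pairFlow g t (after z (E.sig y, r [] θ)) (after r (y, r [] θ, θ))
        (after z' (E.sig y, r' [] θ)) (after r' (y, r' [] θ, θ)) θ'

theorem pairFlow_nonneg {g : ℝ≥0 → ℝ≥0 → ℝ} (hg : ∀ c c', 0 ≤ g c c') (t : ℕ)
    (z : Mechanism Y Φ) (r : Reporting Y) (z' : Mechanism Y Φ) (r' : Reporting Y) (θ : CType) :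
    0 ≤ E.pairFlow g t z r z' r' θ := by
  induction t generalizing z r z' r' θ with
  | zero => exact Finset.sum_nonneg fun y _ => mul_nonneg (E.p_nonneg _ _) (hg _ _)
  | succ t ih =>
    exact Finset.sum_nonneg fun y _ => mul_nonneg (E.p_nonneg _ _) <|
      Finset.sum_nonneg fun θ' _ => mul_nonneg (E.trans_nonneg _ _) (ih _ _ _ _ _)

/-- A decomposition of the weighted sum of the two consumptions passes to expectations. -/
theorem pairFlow_add (a b : ℝ) {g k : ℝ≥0 → ℝ≥0 → ℝ} (hgk : ∀ c c', k c c' + g c c' = a * c + b * c')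
    (t : ℕ) (z : Mechanism Y Φ) (r : Reporting Y) (z' : Mechanism Y Φ) (r' : Reporting Y)
    (θ : CType) : E.pairFlow k t z r z' r' θ + E.pairFlow g t z r z' r' θ =
      a * E.flow t (cons z) r θ + b * E.flow t (cons z') r' θ := by
  induction t generalizing z r z' r' θ with
  | zero =>
    simp only [pairFlow, flow, Finset.mul_sum, ← Finset.sum_add_distrib]
    refine Finset.sum_congr rfl fun y _ => ?_
    rw [← mul_add, hgk]; simp only [cons]; ring
  | succ t ih =>
    simp only [pairFlow, flow, Finset.mul_sum, ← Finset.sum_add_distrib]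
    refine Finset.sum_congr rfl fun y _ => Finset.sum_congr rfl fun θ' _ => ?_
    rw [← mul_add, ← mul_add, ih]
    change _ = a * (_ * (_ * E.flow t (cons (after z _)) _ _)) +
      b * (_ * (_ * E.flow t (cons (after z' _)) _ _))
    ring

/-- A difference in consumption at one node of positive probability already makes the expected
convexity gain positive in that period. `pairFlow` keeps both consumptions at the same private
realization, which the averaged contract forgets. -/
theorem exists_pairFlow_pos {g : ℝ≥0 → ℝ≥0 → ℝ} (hg : ∀ c c', 0 ≤ g c c')
    (hg' : ∀ c c', c ≠ c' → 0 < g c c') (n : ℕ) {z : Mechanism Y Φ} {r : Reporting Y}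
    {z' : Mechanism Y Φ} {r' : Reporting Y} {θ : CType}
    (h : ¬ E.SameConsumption n z r z' r' θ) : ∃ t < n, 0 < E.pairFlow g t z r z' r' θ := by
  induction n generalizing z r z' r' θ with
  | zero => exact absurd trivial h
  | succ n ih =>
    simp only [SameConsumption, not_forall] at h
    obtain ⟨y, hy, h⟩ := h
    by_cases hc : z [] (r [] θ) y = z' [] (r' [] θ) y
    · simp only [hc, true_and, not_forall] at h
      obtain ⟨θ', hθ', h⟩ := h
      obtain ⟨t, ht, hpos⟩ := ih h
      refine ⟨t + 1, by omega, ?_⟩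
      refine Finset.sum_pos' (fun y _ => mul_nonneg (E.p_nonneg _ _) (Finset.sum_nonneg fun θ' _ =>
        mul_nonneg (E.trans_nonneg _ _) (E.pairFlow_nonneg hg _ _ _ _ _ _))) ⟨y, by simp, ?_⟩
      refine mul_pos hy (Finset.sum_pos' (fun θ' _ =>
        mul_nonneg (E.trans_nonneg _ _) (E.pairFlow_nonneg hg _ _ _ _ _ _)) ⟨θ', by simp, ?_⟩)
      exact mul_pos hθ' hpos
    · exact ⟨0, by omega, Finset.sum_pos' (fun y _ => mul_nonneg (E.p_nonneg _ _) (hg _ _))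
        ⟨y, by simp, mul_pos hy (hg' _ _ hc)⟩⟩

/-- Consumption whose utility is an average, with weights `a` and `1 - a`, of the averaged utility
from `r` in `z` and the utility in `z'`. -/
def blend (a : ℝ) (z : Mechanism Y Φ) (r : Reporting Y) (z' : Mechanism Y Φ) : Mechanism Y Φ :=
  fun h θ y => E.invGain (a * E.avg h (E.gain z) r θ y + (1 - a) * E.gain z' h θ y)

theorem gain_blend {a : ℝ} (h0 : 0 ≤ a) (h1 : a ≤ 1) (z : Mechanism Y Φ) (r : Reporting Y)
    (z' : Mechanism Y Φ) : E.gain (E.blend a z r z') =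
      fun h θ y => a * E.avg h (E.gain z) r θ y + (1 - a) * E.gain z' h θ y := by
  funext h θ y
  exact E.gain_invGain (E.convex_gainRange (E.avg_mem_gainRange h z r θ y)
    (Set.mem_range_self (z' h θ y)) h0 (sub_nonneg.2 h1) (by ring))

theorem flow_gain_blend {a : ℝ} (h0 : 0 ≤ a) (h1 : a ≤ 1) (t : ℕ) (z : Mechanism Y Φ)
    (r : Reporting Y) (z' : Mechanism Y Φ) (r' : Reporting Y) (θ : CType) :
    E.flow t (E.gain (E.blend a z r z')) r' θ =
      a * E.flow t (fun h => E.avg h (E.gain z) r) r' θ + (1 - a) * E.flow t (E.gain z') r' θ := by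
  rw [gain_blend E h0 h1, flow_add E t (fun h θ y => a * E.avg h (E.gain z) r θ y), flow_mul,
    flow_mul E t (1 - a) (E.gain z')]

/-- Jensen's inequality for the convex inverse utility, one past income at a time. After the first
income, the utility in the blend is the average over `y'` of the utilities in the blends of the
continuations. -/
theorem flow_cons_blend_le {a : ℝ} (h0 : 0 ≤ a) (h1 : a ≤ 1) (t : ℕ) (z : Mechanism Y Φ)
    (r : Reporting Y) (z' : Mechanism Y Φ) (θ : CType) :
    E.flow t (cons (E.blend a z r z')) truth θ ≤
      E.pairFlow (fun c c' => E.invGain (a * (E.u c - E.u 0) + (1 - a) * (E.u c' - E.u 0)))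
        t z r z' truth θ := by
  induction t generalizing z r z' θ with
  | zero => exact le_rfl
  | succ t ih =>
    let g : ℝ≥0 → ℝ≥0 → ℝ := fun c c' => E.invGain (a * (E.u c - E.u 0) + (1 - a) * (E.u c' - E.u 0))
    rw [flow, pairFlow]
    refine le_trans ?_ (le_of_eq (E.sum_incomeGiven θ (fun φ y => ∑ θ', E.trans θ θ' *
      E.pairFlow g t (after z (φ, r [] θ)) (after r (y, r [] θ, θ)) (after z' (φ, θ)) truth θ')))
    refine Finset.sum_le_sum fun y _ => mul_le_mul_of_nonneg_left ?_ (E.p_nonneg _ _)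
    simp only [Finset.mul_sum]
    rw [Finset.sum_comm]
    refine Finset.sum_le_sum fun θ' _ => ?_
    have hle : ∀ h θ'' y'', after (cons (E.blend a z r z')) (E.sig y, θ) h θ'' y'' ≤
        ∑ y', E.incomeGiven θ (E.sig y) y' * cons (E.blend a (after z (E.sig y, r [] θ))
          (after r (y', r [] θ, θ)) (after z' (E.sig y, θ))) h θ'' y'' := by
      intro h θ'' y''
      have := E.convexOn_invGain.map_sum_le (t := Finset.univ) (w := E.incomeGiven θ (E.sig y))
        (p := fun y' => a * E.avg h (E.gain (after z (E.sig y, r [] θ)))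
          (after r (y', r [] θ, θ)) θ'' y'' + (1 - a) * E.gain (after z' (E.sig y, θ)) h θ'' y'')
        (fun y' _ => E.incomeGiven_nonneg _ _ _) (E.incomeGiven_sum _ _)
        (fun y' _ => E.convex_gainRange (E.avg_mem_gainRange h _ _ θ'' y'')
          (Set.mem_range_self (after z' (E.sig y, θ) h θ'' y'')) h0 (sub_nonneg.2 h1) (by ring))
      refine le_trans (le_of_eq ?_) this
      simp only [smul_eq_mul, mul_add, Finset.sum_add_distrib, ← Finset.sum_mul,
        E.incomeGiven_sum, one_mul, mul_left_comm _ a, ← Finset.mul_sum]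
      rfl
    calc _ ≤ E.trans θ θ' * ∑ y', E.incomeGiven θ (E.sig y) y' * E.flow t
          (cons (E.blend a (after z (E.sig y, r [] θ))
          (after r (y', r [] θ, θ)) (after z' (E.sig y, θ)))) truth θ' := by
          refine mul_le_mul_of_nonneg_left ?_ (E.trans_nonneg _ _)
          rw [← flow_sum]
          exact E.flow_mono t hle _ _
      _ ≤ _ := by
          rw [Finset.mul_sum]
          refine Finset.sum_le_sum fun y' _ => ?_
          rw [mul_left_comm]
          exact mul_le_mul_of_nonneg_left (mul_le_mul_of_nonneg_left (ih _ _ _ _)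
            (E.trans_nonneg _ _)) (E.incomeGiven_nonneg _ _ _)

end

/-! ### Contracts for one first type: convexity, revelation and uniqueness -/

section

/-- Using `r` in `z`, the first type `θ₀` gets the utility `V θ₀` at the cost `κ`, and no type `θ`
who starts with the same report gets more than `V θ`. -/
structure IsPlan (z : Mechanism Y Φ) (r : Reporting Y) (θ₀ : CType) (V : CType → ℝ) (κ : ℝ) :
    Prop where
  util : HasSum (fun t => E.weight t * E.flow t (E.gain z) r θ₀) (V θ₀ - E.floor)
  cost : HasSum (fun t => E.weight t * E.flow t (cons z) r θ₀) κ
  cap : ∀ θ r', r' [] θ = r [] θ₀ → ∀ n, E.partialSum E.weight n (E.gain z) r' θ ≤ V θ - E.floor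

/-- A truthful contract for the first type `θ₀` delivers `V` at a cost of at most `κ`. -/
def Attains (θ₀ : CType) (V : CType → ℝ) (κ : ℝ) : Prop :=
  ∃ z, ∃ κ' ≤ κ, E.IsPlan z truth θ₀ V κ'

variable {E}

theorem IsPlan.attains {z : Mechanism Y Φ} {θ₀ : CType} {V : CType → ℝ} {κ : ℝ}
    (h : E.IsPlan z truth θ₀ V κ) : E.Attains θ₀ V κ := ⟨z, κ, le_rfl, h⟩

theorem Attains.mono {θ₀ : CType} {V : CType → ℝ} {κ κ' : ℝ} (h : E.Attains θ₀ V κ)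
    (hκ : κ ≤ κ') : E.Attains θ₀ V κ' := by
  obtain ⟨z, k, hk, hz⟩ := h
  exact ⟨z, k, hk.trans hκ, hz⟩

theorem Attains.relax {θ₀ : CType} {V V' : CType → ℝ} {κ : ℝ} (h : E.Attains θ₀ V κ)
    (h₀ : V' θ₀ = V θ₀) (hV : ∀ θ, V θ ≤ V' θ) : E.Attains θ₀ V' κ := by
  obtain ⟨z, k, hk, hz⟩ := h
  exact ⟨z, k, hk, by rw [h₀]; exact hz.util, hz.cost, fun θ r' hr n =>
    (hz.cap θ r' hr n).trans (sub_le_sub_right (hV θ) _)⟩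

/-- Utility in the blend is a weighted sum. A deviation earns in the averaged part at most what some
strategy earns in `z`, which the cap of `z` bounds, and in the other part at most the cap of `z'`.
Only `z` may be used untruthfully; this is enough to treat accepted offers. -/
theorem IsPlan.blend {z z' : Mechanism Y Φ} {r : Reporting Y} {θ₀ : CType} {V V' : CType → ℝ}
    {κ κ' : ℝ} (h : E.IsPlan z r θ₀ V κ) (h' : E.IsPlan z' truth θ₀ V' κ') {a : ℝ} (h0 : 0 ≤ a)
    (h1 : a ≤ 1) : ∃ k ≤ a * κ + (1 - a) * κ',
      E.IsPlan (E.blend a z r z') truth θ₀ (a • V + (1 - a) • V') k := by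
  have hle : ∀ t, E.weight t * E.flow t (cons (E.blend a z r z')) truth θ₀ ≤
      a * (E.weight t * E.flow t (cons z) r θ₀) +
        (1 - a) * (E.weight t * E.flow t (cons z') truth θ₀) := fun t => by
    let k : ℝ≥0 → ℝ≥0 → ℝ := fun c c' => E.invGain (a * (E.u c - E.u 0) + (1 - a) * (E.u c' - E.u 0))
    have hk : ∀ c c' : ℝ≥0, 0 ≤ a * c + (1 - a) * c' - k c c' := fun c c' => by
      have := E.convexOn_invGain.2 (Set.mem_range_self c) (Set.mem_range_self c') h0
        (sub_nonneg.2 h1) (by ring)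
      simp only [invGain_gain, smul_eq_mul] at this
      linarith
    have h2 := E.pairFlow_add a (1 - a) (k := k) (g := fun c c' => a * c + (1 - a) * c' - k c c')
      (fun c c' => by ring) t z r z' truth θ₀
    have h3 := E.pairFlow_nonneg hk t z r z' truth θ₀
    have h4 := E.flow_cons_blend_le h0 h1 t z r z' θ₀
    have h5 : E.flow t (cons (E.blend a z r z')) truth θ₀ ≤
      a * E.flow t (cons z) r θ₀ + (1 - a) * E.flow t (cons z') truth θ₀ := by linarith
    have := mul_le_mul_of_nonneg_left h5 (E.weight_nonneg t)
    linarith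
  have hsum := (h.cost.mul_left a).add (h'.cost.mul_left (1 - a))
  have hs := Summable.of_nonneg_of_le (E.weight_cons_nonneg _ _ _) hle hsum.summable
  refine ⟨_, hasSum_le hle hs.hasSum hsum, ?_, hs.hasSum, ?_⟩
  · have e₁ : (fun t => E.weight t * E.flow t (E.gain (E.blend a z r z')) truth θ₀) = fun t =>
        a * (E.weight t * E.flow t (E.gain z) r θ₀) +
          (1 - a) * (E.weight t * E.flow t (E.gain z') truth θ₀) := by
      funext t
      rw [flow_gain_blend E h0 h1, flow_avg]; ring
    have e₂ : (a • V + (1 - a) • V') θ₀ - E.floor =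
        a * (V θ₀ - E.floor) + (1 - a) * (V' θ₀ - E.floor) := by
      simp only [Pi.add_apply, Pi.smul_apply, smul_eq_mul]; ring
    rw [e₁, e₂]
    exact (h.util.mul_left a).add (h'.util.mul_left (1 - a))
  · intro θ r' hr' n
    obtain ⟨r'', hr'', hle⟩ := E.exists_partialSum_avg_le n E.weight E.weight_nonneg (E.gain z) r r' θ
    have e : E.partialSum E.weight n (E.gain (E.blend a z r z')) r' θ =
        a * E.partialSum E.weight n (fun h => E.avg h (E.gain z) r) r' θ +
          (1 - a) * E.partialSum E.weight n (E.gain z') r' θ := by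
      simp only [partialSum, Finset.mul_sum, ← Finset.sum_add_distrib]
      refine Finset.sum_congr rfl fun t _ => ?_
      rw [flow_gain_blend E h0 h1]; ring
    have c1 := h.cap θ r'' (by rw [hr'', hr']; rfl) n
    have c2 := h'.cap θ r' hr' n
    have := mul_le_mul_of_nonneg_left (hle.trans c1) h0
    have := mul_le_mul_of_nonneg_left c2 (sub_nonneg.2 h1)
    rw [e]
    simp only [Pi.add_apply, Pi.smul_apply, smul_eq_mul]
    linarith

variable (E) in
theorem isPlan_const (c : ℝ≥0) (r : Reporting Y) (θ₀ : CType) :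
    E.IsPlan (fun _ _ _ => c) r θ₀ (fun _ => E.u c * E.annuity) (c * E.annuity) := by
  have hg : ∀ t r θ, E.weight t * E.flow t (E.gain (fun _ _ _ => c)) r θ =
      (E.u c - E.u 0) * E.weight t := fun t r θ => by
    rw [show E.flow t (E.gain (fun _ _ _ => c)) r θ = E.u c - E.u 0 from E.flow_const t _ r θ,
      mul_comm]
  have hs : HasSum (fun t => (E.u c - E.u 0) * E.weight t) (E.u c * E.annuity - E.floor) := by
    rw [show E.u c * E.annuity - E.floor = (E.u c - E.u 0) * E.annuity by unfold floor; ring]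
    exact E.hasSum_weight.mul_left _
  refine ⟨by simpa only [hg] using hs, ?_, fun θ r' _ n => ?_⟩
  · have hc : ∀ t, E.weight t * E.flow t (cons (fun _ _ _ => c)) r θ₀ = c * E.weight t :=
      fun t => by
        rw [show E.flow t (cons (fun _ _ _ => c)) r θ₀ = c from E.flow_const t _ r θ₀, mul_comm]
    simpa only [hc] using E.hasSum_weight.mul_left (c : ℝ)
  · simp only [partialSum, hg]
    exact sum_le_hasSum _ (fun t _ => mul_nonneg (E.u_zero_le c) (E.weight_nonneg t)) hs

/-- The revelation principle, as a blend with all weight on `z`; the contract with zero consumption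
is a dummy. -/
theorem IsPlan.attains_of_reporting {z : Mechanism Y Φ} {r : Reporting Y} {θ₀ : CType}
    {V : CType → ℝ} {κ : ℝ} (h : E.IsPlan z r θ₀ V κ) : E.Attains θ₀ V κ := by
  obtain ⟨k, hk, hp⟩ := h.blend (E.isPlan_const 0 truth θ₀) zero_le_one le_rfl
  simp only [sub_self, zero_smul, one_smul, add_zero, zero_mul, one_mul] at hk hp
  exact hp.attains.mono hk

/-- If the two consumption paths differed with positive probability, their midpoint blend would
deliver the same `V` at a strictly lower cost. -/
theorem IsPlan.samePath {z z' : Mechanism Y Φ} {r : Reporting Y} {θ₀ : CType}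
    {V : CType → ℝ} {κ : ℝ} (h : E.IsPlan z r θ₀ V κ) (h' : E.IsPlan z' truth θ₀ V κ)
    (hmin : ∀ k, E.Attains θ₀ V k → κ ≤ k) : E.SamePath z r z' truth θ₀ := by
  intro n hn
  by_contra hne
  have h0 : (0 : ℝ) ≤ 2⁻¹ := by norm_num
  have h1 : (2⁻¹ : ℝ) ≤ 1 := by norm_num
  let k : ℝ≥0 → ℝ≥0 → ℝ := fun c c' =>
    E.invGain (2⁻¹ * (E.u c - E.u 0) + (1 - 2⁻¹) * (E.u c' - E.u 0))
  let g : ℝ≥0 → ℝ≥0 → ℝ := fun c c' => 2⁻¹ * c + (1 - 2⁻¹) * c' - k c c'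
  have hg' : ∀ c c', c ≠ c' → 0 < g c c' := fun c c' hc => sub_pos.2 (E.invGain_midpoint_lt hc)
  have hg : ∀ c c', 0 ≤ g c c' := fun c c' => by
    by_cases hc : c = c'
    · subst hc
      have : k c c = c := by
        simp only [k]
        rw [← add_mul, add_sub_cancel, one_mul, invGain_gain]
      simp only [g, this]; linarith
    · exact (hg' c c' hc).le
  obtain ⟨t₀, ht₀, hpos⟩ := E.exists_pairFlow_pos hg hg' n hne
  obtain ⟨κ', -, hp⟩ := h.blend h' h0 h1
  have hle : ∀ t, E.flow t (cons (E.blend 2⁻¹ z r z')) truth θ₀ + E.pairFlow g t z r z' truth θ₀ ≤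
      2⁻¹ * E.flow t (cons z) r θ₀ + (1 - 2⁻¹) * E.flow t (cons z') truth θ₀ := fun t => by
    rw [← E.pairFlow_add 2⁻¹ (1 - 2⁻¹) (k := k) (g := g) (fun c c' => by simp only [g]; ring)]
    exact add_le_add (E.flow_cons_blend_le h0 h1 t z r z' θ₀) le_rfl
  have hlt : κ' < 2⁻¹ * κ + (1 - 2⁻¹) * κ := by
    refine hasSum_lt (i := t₀) (fun t => ?_) ?_ hp.cost
      ((h.cost.mul_left 2⁻¹).add (h'.cost.mul_left (1 - 2⁻¹)))
    · have := mul_le_mul_of_nonneg_left (hle t) (E.weight_nonneg t)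
      have := mul_nonneg (E.weight_nonneg t) (E.pairFlow_nonneg hg t z r z' truth θ₀)
      linarith
    · have hw := E.weight_pos (lt_of_lt_of_le (Nat.cast_lt.2 ht₀) hn)
      have := mul_le_mul_of_nonneg_left (hle t₀) hw.le
      have := mul_pos hw hpos
      linarith
  rw [← add_smul, add_sub_cancel, one_smul] at hp
  have := hmin _ hp.attains
  linarith

theorem Attains.mix {θ₀ : CType} {V V' : CType → ℝ} {κ κ' : ℝ} (h : E.Attains θ₀ V κ)
    (h' : E.Attains θ₀ V' κ') {a : ℝ} (h0 : 0 ≤ a) (h1 : a ≤ 1) :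
    E.Attains θ₀ (a • V + (1 - a) • V') (a * κ + (1 - a) * κ') := by
  obtain ⟨z, k, hk, hz⟩ := h
  obtain ⟨z', k', hk', hz'⟩ := h'
  obtain ⟨c, hc, hp⟩ := hz.blend hz' h0 h1
  exact ⟨_, c, hc.trans (add_le_add (mul_le_mul_of_nonneg_left hk h0)
    (mul_le_mul_of_nonneg_left hk' (sub_nonneg.2 h1))), hp⟩

theorem IsPlan.utility_eq {z : Mechanism Y Φ} {r : Reporting Y} {θ₀ : CType} {V : CType → ℝ}
    {κ : ℝ} (h : E.IsPlan z r θ₀ V κ) : E.utility z r θ₀ = (V θ₀ : EReal) :=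
  E.utility_eq_coe_iff.2 h.util

theorem IsPlan.typeProfit_eq {z : Mechanism Y Φ} {r : Reporting Y} {θ₀ : CType} {V : CType → ℝ}
    {κ : ℝ} (h : E.IsPlan z r θ₀ V κ) :
    E.typeProfit z r θ₀ = ((E.incomeValue θ₀ - κ : ℝ) : EReal) :=
  E.typeProfit_eq_coe_iff.2 (by simpa using h.cost)

theorem isPlan_of_utility_le {z : Mechanism Y Φ} {r : Reporting Y} {θ₀ : CType} {V : CType → ℝ}
    {π : ℝ} (hu : E.utility z r θ₀ = (V θ₀ : EReal))
    (hle : ∀ θ r', E.utility z r' θ ≤ (V θ : EReal)) (hπ : E.typeProfit z r θ₀ = (π : EReal)) :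
    E.IsPlan z r θ₀ V (E.incomeValue θ₀ - π) :=
  ⟨E.utility_eq_coe_iff.1 hu, E.typeProfit_eq_coe_iff.1 hπ,
    fun θ r' _ n => E.utility_le_coe_iff.1 (hle θ r') n⟩

theorem exAnteUtility_eq (z : Mechanism Y Φ) (r : Reporting Y) :
    E.exAnteUtility z r = (E.prior low : EReal) * E.utility z r low +
      (E.prior high : EReal) * E.utility z r high := sum_ctype _

theorem profit_eq (z : Mechanism Y Φ) :
    E.profit z = (E.prior low : EReal) * E.typeProfit z truth low +
      (E.prior high : EReal) * E.typeProfit z truth high := sum_ctype _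

theorem incentiveCompatible_of_forall {z : Mechanism Y Φ}
    (h : ∀ θ r, E.utility z r θ ≤ E.utility z truth θ) : E.IncentiveCompatible z := fun r =>
  Finset.sum_le_sum fun θ _ => mul_le_mul_of_nonneg_left (h θ r)
    (EReal.coe_nonneg.2 (E.prior_pos θ).le)

theorem utility_byFirstType (z : Mechanism Y Φ) (R : CType → Reporting Y) (θ : CType) :
    E.utility z (byFirstType R) θ = E.utility z (R θ) θ := by
  simp only [Economy.utility_eq, flow_byFirstType]

theorem _root_.EReal.le_coe_of_mul_add_le {a b x y : ℝ} (ha : 0 < a) {U : EReal}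
    (h : (a : EReal) * U + (b : EReal) * y ≤ (a : EReal) * x + (b : EReal) * y) :
    U ≤ (x : EReal) := by
  induction U using EReal.rec with
  | bot => exact bot_le
  | top =>
    rw [EReal.coe_mul_top_of_pos ha, ← EReal.coe_mul, ← EReal.coe_mul, ← EReal.coe_add,
      EReal.top_add_coe] at h
    exact absurd h (not_le.2 (EReal.coe_lt_top _))
  | coe U =>
    rw [← EReal.coe_mul, ← EReal.coe_mul, ← EReal.coe_mul, ← EReal.coe_add, ← EReal.coe_add,
      EReal.coe_le_coe_iff] at h
    rw [EReal.coe_le_coe_iff]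
    exact le_of_mul_le_mul_left (by linarith) ha

/-- Incentive compatibility holds ex ante. Since each prior is positive, a deviation by one type
alone tests that type's constraint, and the other type's term cancels because it is finite. -/
theorem IncentiveCompatible.utility_le {z : Mechanism Y Φ} (h : E.IncentiveCompatible z)
    {V : CType → ℝ} (hV : E.Delivers z V) (θ : CType) (r : Reporting Y) :
    E.utility z r θ ≤ (V θ : EReal) := by
  classical
  have h1 := h (byFirstType (Function.update (fun _ => truth) θ r))
  rw [exAnteUtility_eq, exAnteUtility_eq, utility_byFirstType, utility_byFirstType] at h1
  cases θ
  · simp only [Function.update_self, Function.update_of_ne (show high ≠ low by decide), hV low,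
      hV high] at h1
    exact EReal.le_coe_of_mul_add_le (E.prior_pos low) h1
  · simp only [Function.update_self, Function.update_of_ne (show low ≠ high by decide), hV low,
      hV high] at h1
    rw [add_comm, add_comm ((E.prior low : EReal) * _)] at h1
    exact EReal.le_coe_of_mul_add_le (E.prior_pos high) h1

theorem profit_eq_coe {z : Mechanism Y Φ} {π : CType → ℝ}
    (h : ∀ θ, E.typeProfit z truth θ = (π θ : EReal)) :
    E.profit z = ((E.prior low * π low + E.prior high * π high : ℝ) : EReal) := by
  rw [profit_eq, h, h]; push_cast; rfl

theorem exists_typeProfit_of_profit {z : Mechanism Y Φ} (h : ⊥ < E.profit z) :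
    ∃ π : CType → ℝ, ∀ θ, E.typeProfit z truth θ = (π θ : EReal) := by
  have key : ∀ θ, E.typeProfit z truth θ ≠ ⊥ := by
    intro θ hb
    refine h.ne' ?_
    rw [profit_eq]
    cases θ
    · rw [hb, EReal.coe_mul_bot_of_pos (E.prior_pos low), EReal.bot_add]
    · rw [hb, EReal.coe_mul_bot_of_pos (E.prior_pos high), EReal.add_bot]
  choose π hπ using fun θ => E.exists_typeProfit_eq (key θ)
  exact ⟨π, hπ⟩

theorem IncentiveCompatible.isPlan {z : Mechanism Y Φ} (h : E.IncentiveCompatible z)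
    {V : CType → ℝ} (hV : E.Delivers z V) {θ : CType} {π : ℝ}
    (hπ : E.typeProfit z truth θ = (π : EReal)) :
    E.IsPlan z truth θ V (E.incomeValue θ - π) :=
  isPlan_of_utility_le (hV θ) (fun θ r => h.utility_le hV θ r) hπ

/-! ### Gluing the contracts of the two first types -/

section glue

variable {z : CType → Mechanism Y Φ} {V κ : CType → ℝ}

theorem gain_byFirstReport (z : CType → Mechanism Y Φ) :
    E.gain (byFirstReport z) = byFirstReport fun θ => E.gain (z θ) := by
  funext h; cases h <;> rfl

omit [Fintype Y] in
theorem cons_byFirstReport (z : CType → Mechanism Y Φ) :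
    cons (byFirstReport z) = byFirstReport fun θ => cons (z θ) := by
  funext h; cases h <;> rfl

theorem isPlan_byFirstReport (h : ∀ θ, E.IsPlan (z θ) truth θ V (κ θ)) (θ : CType) :
    E.IsPlan (byFirstReport z) truth θ V (κ θ) := by
  refine ⟨?_, ?_, fun θ' r' _ n => ?_⟩
  · simp only [gain_byFirstReport, flow_byFirstReport]
    exact (h θ).util
  · simp only [cons_byFirstReport, flow_byFirstReport]
    exact (h θ).cost
  · simp only [partialSum, gain_byFirstReport, flow_byFirstReport]
    exact (h (r' [] θ')).cap θ' r' rfl n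

theorem incentiveCompatible_of_isPlan {z : Mechanism Y Φ}
    (h : ∀ θ, E.IsPlan z truth θ V (κ θ)) (hcap : ∀ θ r, E.utility z r θ ≤ (V θ : EReal)) :
    E.IncentiveCompatible z ∧ E.Delivers z V :=
  ⟨incentiveCompatible_of_forall fun θ r => (hcap θ r).trans (h θ).utility_eq.ge,
    fun θ => (h θ).utility_eq⟩

theorem utility_byFirstReport_le (h : ∀ θ, E.IsPlan (z θ) truth θ V (κ θ)) (θ : CType)
    (r : Reporting Y) : E.utility (byFirstReport z) r θ ≤ (V θ : EReal) := by
  rw [utility_le_coe_iff]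
  intro n
  simp only [gain_byFirstReport, flow_byFirstReport]
  exact (h (r [] θ)).cap θ r rfl n

/-- The caps in `IsPlan` already contain the constraints across types, so the two contracts can be
chosen independently. -/
theorem mem_feasible_iff : V ∈ E.feasible ↔ ∀ θ, ∃ κ, E.Attains θ V κ := by
  constructor
  · rintro ⟨z, hz, hp, hV⟩ θ
    obtain ⟨π, hπ⟩ := exists_typeProfit_of_profit hp
    exact ⟨_, (hz.isPlan hV (hπ θ)).attains⟩
  · intro h
    choose k z κ _ hz using h
    obtain ⟨h1, h2⟩ := incentiveCompatible_of_isPlan (isPlan_byFirstReport hz)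
      (utility_byFirstReport_le hz)
    refine ⟨_, h1, ?_, h2⟩
    rw [profit_eq_coe fun θ => (isPlan_byFirstReport hz θ).typeProfit_eq]
    exact EReal.bot_lt_coe _

/-- A solution minimizes the cost of each type separately. -/
theorem Solves.exists_min {z : Mechanism Y Φ} (hz : E.Solves V z) (hV : V ∈ E.feasible) :
    ∃ π : CType → ℝ, ∀ θ, E.typeProfit z truth θ = (π θ : EReal) ∧
      E.IsPlan z truth θ V (E.incomeValue θ - π θ) ∧
      ∀ k, E.Attains θ V k → E.incomeValue θ - π θ ≤ k := by
  classical
  have hb : ⊥ < E.profit z := by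
    obtain ⟨z', hz', hp, hV'⟩ := hV
    exact hp.trans_le (hz.2.2 z' hz' hV')
  obtain ⟨π, hπ⟩ := exists_typeProfit_of_profit hb
  have hp : ∀ θ, E.IsPlan z truth θ V (E.incomeValue θ - π θ) := fun θ =>
    hz.1.isPlan hz.2.1 (hπ θ)
  refine ⟨π, fun θ => ⟨hπ θ, hp θ, ?_⟩⟩
  rintro k ⟨z', k', hk, hz'⟩
  refine le_trans ?_ hk
  -- Only the contract of type `θ` is exchanged, so optimality of `z` compares the costs of that
  -- type alone.
  have hall : ∀ θ', E.IsPlan (Function.update (fun _ => z) θ z' θ') truth θ' V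
      (Function.update (fun θ => E.incomeValue θ - π θ) θ k' θ') := by
    intro θ'
    by_cases hθ : θ' = θ
    · subst hθ; simpa using hz'
    · simpa [Function.update_of_ne hθ] using hp θ'
  obtain ⟨h1, h2⟩ := incentiveCompatible_of_isPlan (isPlan_byFirstReport hall)
    (utility_byFirstReport_le hall)
  have h3 := hz.2.2 _ h1 h2
  rw [profit_eq_coe fun θ' => (isPlan_byFirstReport hall θ').typeProfit_eq, profit_eq_coe hπ,
    EReal.coe_le_coe_iff] at h3
  cases θ
  · simp only [Function.update_self, Function.update_of_ne (show high ≠ low by decide)] at h3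
    have := le_of_mul_le_mul_left (show E.prior low * (E.incomeValue low - k') ≤
      E.prior low * π low by linarith) (E.prior_pos low)
    linarith
  · simp only [Function.update_self, Function.update_of_ne (show low ≠ high by decide)] at h3
    have := le_of_mul_le_mul_left (show E.prior high * (E.incomeValue high - k') ≤
      E.prior high * π high by linarith) (E.prior_pos high)
    linarith

/-- All solutions have the same least cost for each type, so the choice made in `optTypeProfit` is
immaterial. -/
theorem Solves.typeProfit_eq {z : Mechanism Y Φ} (hz : E.Solves V z) (hV : V ∈ E.feasible)
    (θ : CType) : E.typeProfit z truth θ = (E.optTypeProfit V θ : EReal) := by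
  have hex : ∃ z, E.Solves V z := ⟨z, hz⟩
  obtain ⟨π, h⟩ := hz.exists_min hV
  obtain ⟨π', h'⟩ := hex.choose_spec.exists_min hV
  have e : E.optTypeProfit V θ = π' θ := by
    rw [optTypeProfit, dif_pos hex, (h' θ).1, EReal.toReal_coe]
  have h1 := (h θ).2.2 _ (h' θ).2.1.attains
  have h2 := (h' θ).2.2 _ (h θ).2.1.attains
  rw [e, (h θ).1, EReal.coe_eq_coe_iff]
  linarith

theorem Solves.isPlan {z : Mechanism Y Φ} (hz : E.Solves V z) (hV : V ∈ E.feasible) (θ : CType) :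
    E.IsPlan z truth θ V (E.incomeValue θ - E.optTypeProfit V θ) :=
  hz.1.isPlan hz.2.1 (hz.typeProfit_eq hV θ)

theorem Solves.le {z : Mechanism Y Φ} (hz : E.Solves V z) (hV : V ∈ E.feasible) {θ : CType}
    {k : ℝ} (hk : E.Attains θ V k) : E.incomeValue θ - E.optTypeProfit V θ ≤ k := by
  obtain ⟨π, h⟩ := hz.exists_min hV
  have := (h θ).1.symm.trans (hz.typeProfit_eq hV θ)
  rw [EReal.coe_eq_coe_iff] at this
  rw [← this]
  exact (h θ).2.2 k hk

end glue

end

/-! ### Tangent bounds, constant consumption, expected income and autarky -/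

section

/-- Marginal utility. -/
def marginal (c : ℝ≥0) : ℝ := derivWithin E.u (Set.Ici 0) c

theorem hasDerivWithinAt_u (c : ℝ≥0) :
    HasDerivWithinAt E.u (E.marginal c) (Set.Ici 0) c :=
  ((E.u_contDiff.differentiableOn (by norm_num)) c c.2).hasDerivWithinAt

theorem _root_.NNReal.coe_mem_Ici (c : ℝ≥0) : (c : ℝ) ∈ Set.Ici (0 : ℝ) := c.coe_nonneg

theorem u_lt_tangent {c x : ℝ≥0} (h : x ≠ c) : E.u x < E.u c + E.marginal c * (x - c) := by
  rcases lt_or_gt_of_ne h with h | h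
  · have := E.u_strictConcave.lt_slope_of_hasDerivWithinAt x.coe_mem_Ici c.coe_mem_Ici (NNReal.coe_lt_coe.2 h)
      (E.hasDerivWithinAt_u c)
    have hpos : (0 : ℝ) < c - x := sub_pos.2 (NNReal.coe_lt_coe.2 h)
    rw [slope_def_field, lt_div_iff₀ hpos] at this
    linarith
  · have := E.u_strictConcave.slope_lt_of_hasDerivWithinAt c.coe_mem_Ici x.coe_mem_Ici (NNReal.coe_lt_coe.2 h)
      (E.hasDerivWithinAt_u c)
    have hpos : (0 : ℝ) < x - c := sub_pos.2 (NNReal.coe_lt_coe.2 h)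
    rw [slope_def_field, div_lt_iff₀ hpos] at this
    linarith

theorem u_le_tangent (c x : ℝ≥0) : E.u x ≤ E.u c + E.marginal c * (x - c) := by
  by_cases h : x = c
  · subst h; simp
  · exact (E.u_lt_tangent h).le

theorem u_lt_iff {c c' : ℝ≥0} : E.u c < E.u c' ↔ c < c' :=
  (E.u_strictMono.lt_iff_lt c.coe_mem_Ici c'.coe_mem_Ici).trans NNReal.coe_lt_coe

theorem u_le_iff {c c' : ℝ≥0} : E.u c ≤ E.u c' ↔ c ≤ c' :=
  (E.u_strictMono.le_iff_le c.coe_mem_Ici c'.coe_mem_Ici).trans NNReal.coe_le_coe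

theorem marginal_pos (c : ℝ≥0) : 0 < E.marginal c := by
  have h1 : c < c + 1 := lt_add_of_pos_right _ one_pos
  have h2 := E.u_lt_tangent h1.ne'
  have h3 := E.u_lt_iff.2 h1
  push_cast at h2 h3
  linarith

/-- How much a tangent to the utility function lies above it. -/
def gap (c x : ℝ≥0) : ℝ := E.u c + E.marginal c * (x - c) - E.u x

theorem gap_nonneg (c x : ℝ≥0) : 0 ≤ E.gap c x := sub_nonneg.2 (E.u_le_tangent c x)

/-- If the gap vanishes in the limit then utility does not fall short of the point of tangency. -/
theorem tendsto_min_of_gap {c : ℝ≥0} {x : ℕ → ℝ≥0}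
    (h : Filter.Tendsto (fun k => E.gap c (x k)) Filter.atTop (nhds 0)) :
    Filter.Tendsto (fun k => min (E.u (x k) - E.u 0) (E.u c - E.u 0)) Filter.atTop
      (nhds (E.u c - E.u 0)) := by
  rw [tendsto_order]
  refine ⟨fun a ha => ?_, fun a ha => Filter.Eventually.of_forall fun k =>
    (min_le_right _ _).trans_lt ha⟩
  suffices hs : ∀ᶠ k in Filter.atTop, a < E.u (x k) - E.u 0 from hs.mono fun k hk => lt_min hk ha
  by_cases hc : c = 0
  · exact Filter.Eventually.of_forall fun k => by
      subst hc; simpa using ha.trans_le (by simpa using E.u_zero_le (x k))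
  have hcpos : 0 < c := pos_iff_ne_zero.2 hc
  have hev : ∀ᶠ d : ℝ≥0 in nhdsWithin c (Set.Iio c), a < E.u d - E.u 0 :=
    Filter.Eventually.filter_mono nhdsWithin_le_nhds
      ((E.continuous_gain.tendsto c).eventually (lt_mem_nhds ha))
  have : (nhdsWithin c (Set.Iio c)).NeBot := nhdsLT_neBot_of_exists_lt ⟨0, hcpos⟩
  -- The gap is convex with minimum at `c`, so it decreases below `c`. Once it is under its value at
  -- `d`, consumption exceeds `d`.
  obtain ⟨d, hd, hdc⟩ := (hev.and self_mem_nhdsWithin).exists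
  have hgd : 0 < E.gap c d := sub_pos.2 (E.u_lt_tangent (ne_of_lt hdc))
  refine ((tendsto_order.1 h).2 _ hgd).mono fun k hk => ?_
  by_contra hle
  have hxd : x k ≤ d := by
    by_contra h'
    exact hle (hd.trans (sub_lt_sub_right (E.u_lt_iff.2 (not_le.1 h')) _))
  refine absurd hk (not_lt.2 ?_)
  rcases hxd.eq_or_lt with he | hlt
  · rw [he]
  · have hdc' : (d : ℝ) < c := NNReal.coe_lt_coe.2 hdc
    have hlt' : (x k : ℝ) < d := NNReal.coe_lt_coe.2 hlt
    have hp : (0 : ℝ) < c - x k := by linarith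
    have h2 := E.u_strictConcave.concaveOn.2 (x k).coe_mem_Ici c.coe_mem_Ici
      (show 0 ≤ ((c : ℝ) - d) / (c - x k) from div_nonneg (by linarith) hp.le)
      (show 0 ≤ ((d : ℝ) - x k) / (c - x k) from div_nonneg (by linarith) hp.le)
      (by field_simp; ring)
    simp only [smul_eq_mul] at h2
    rw [show ((c : ℝ) - d) / (c - x k) * (x k : ℝ) + (d - x k) / (c - x k) * c = d by
      field_simp; ring] at h2
    rw [div_mul_eq_mul_div, div_mul_eq_mul_div, ← add_div, div_le_iff₀ hp] at h2
    have hg := E.gap_nonneg c (x k)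
    have h3 : (c - x k : ℝ) * E.gap c d ≤ (c - d) * E.gap c (x k) := by
      unfold gap; nlinarith
    have h4 : (c - x k : ℝ) * E.gap c d ≤ (c - x k) * E.gap c (x k) :=
      h3.trans (mul_le_mul_of_nonneg_right (by linarith) hg)
    exact le_of_mul_le_mul_left h4 hp

theorem hasSum_gap {z : Mechanism Y Φ} {r : Reporting Y} {θ : CType} {x κ : ℝ}
    (hu : HasSum (fun t => E.weight t * E.flow t (E.gain z) r θ) (x - E.floor))
    (hk : HasSum (fun t => E.weight t * E.flow t (cons z) r θ) κ) (c : ℝ≥0) :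
    HasSum (fun t => E.weight t * E.flow t (fun h θ y => E.gap c (z h θ y)) r θ)
      (E.u c * E.annuity + E.marginal c * (κ - c * E.annuity) - x) := by
  have e : ∀ t, E.weight t * E.flow t (fun h θ y => E.gap c (z h θ y)) r θ =
      (E.u c - E.u 0 - E.marginal c * c) * E.weight t +
        E.marginal c * (E.weight t * E.flow t (cons z) r θ) +
          (-1) * (E.weight t * E.flow t (E.gain z) r θ) := by
    intro t
    have : (fun h θ y => E.gap c (z h θ y)) = fun h θ y =>
        ((E.u c - E.u 0 - E.marginal c * c) + E.marginal c * cons z h θ y) +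
          (-1) * E.gain z h θ y := by
      funext h θ y; simp only [gap, cons, gain]; ring
    rw [this, E.flow_add t (fun h θ y => (E.u c - E.u 0 - E.marginal c * c) +
      E.marginal c * cons z h θ y), E.flow_add t (fun _ _ _ => E.u c - E.u 0 - E.marginal c * c),
      flow_mul, flow_mul, flow_const]
    ring
  have hs := ((E.hasSum_weight.mul_left (E.u c - E.u 0 - E.marginal c * c)).add
    (hk.mul_left (E.marginal c))).add (hu.mul_left (-1))
  rw [funext e]
  have e' : E.u c * E.annuity + E.marginal c * (κ - c * E.annuity) - x =
      (E.u c - E.u 0 - E.marginal c * c) * E.annuity + E.marginal c * κ + -1 * (x - E.floor) := by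
    unfold floor; ring
  rw [e']
  exact hs

/-- The discounted gap between the tangent at `c` and utility is nonnegative. At mean income this
says that utility exceeds its full-information level only at a loss. -/
theorem le_tangent {z : Mechanism Y Φ} {r : Reporting Y} {θ : CType} {x π : ℝ}
    (hu : E.utility z r θ = (x : EReal)) (hk : E.typeProfit z r θ = (π : EReal)) (c : ℝ≥0) :
    x ≤ E.u c * E.annuity + E.marginal c * (E.incomeValue θ - π - c * E.annuity) := by
  have := (E.hasSum_gap (E.utility_eq_coe_iff.1 hu) (E.typeProfit_eq_coe_iff.1 hk) c).nonneg
    fun t => mul_nonneg (E.weight_nonneg t) (E.flow_nonneg t (fun _ _ _ => E.gap_nonneg _ _) r θ)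
  linarith

theorem Attains.le_tangent {E : Economy Y Φ} {θ₀ : CType} {V : CType → ℝ} {κ : ℝ}
    (h : E.Attains θ₀ V κ) (c : ℝ≥0) :
    V θ₀ ≤ E.u c * E.annuity + E.marginal c * (κ - c * E.annuity) := by
  obtain ⟨z, k, hk, hz⟩ := h
  have := E.le_tangent hz.utility_eq hz.typeProfit_eq c
  have := mul_le_mul_of_nonneg_left hk (E.marginal_pos c).le
  linarith

theorem Attains.floor_le {E : Economy Y Φ} {θ₀ : CType} {V : CType → ℝ} {κ : ℝ}
    (h : E.Attains θ₀ V κ) : E.floor ≤ V θ₀ := by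
  obtain ⟨z, k, hk, hz⟩ := h
  have := hz.util.nonneg (E.weight_gain_nonneg z truth θ₀)
  linarith

theorem attains_const {V : CType → ℝ} {θ₀ : CType} {c : ℝ≥0} (h₀ : V θ₀ = E.u c * E.annuity)
    (h : ∀ θ, E.u c * E.annuity ≤ V θ) : E.Attains θ₀ V (c * E.annuity) :=
  (E.isPlan_const c truth θ₀).attains.relax h₀ h

/-- Finite profit makes utility finite. -/
theorem exists_utility_eq {z : Mechanism Y Φ} {r : Reporting Y} {θ : CType} {π : ℝ}
    (h : E.typeProfit z r θ = (π : EReal)) : ∃ x : ℝ, E.utility z r θ = x := by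
  have hk := E.typeProfit_eq_coe_iff.1 h
  have hle : ∀ t, E.weight t * E.flow t (E.gain z) r θ ≤
      E.marginal 0 * (E.weight t * E.flow t (cons z) r θ) := fun t => by
    have : E.flow t (E.gain z) r θ ≤ E.marginal 0 * E.flow t (cons z) r θ := by
      rw [← flow_mul]
      refine E.flow_mono t (fun h θ y => ?_) r θ
      have := E.u_le_tangent 0 (z h θ y)
      simp only [gain, cons]
      push_cast at this
      linarith
    have := mul_le_mul_of_nonneg_left this (E.weight_nonneg t)
    linarith
  have hs := Summable.of_nonneg_of_le (E.weight_gain_nonneg z r θ) hle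
    (hk.summable.mul_left _)
  exact ⟨_ + E.floor, E.utility_eq_coe_iff.2 (by simpa using hs.hasSum)⟩

/-- A utility level above that of zero consumption and below one that is attained is that of
a constant consumption. -/
theorem exists_const {v : ℝ} {c : ℝ≥0} (h0 : E.floor ≤ v) (h1 : v ≤ E.u c * E.annuity) :
    ∃ c' : ℝ≥0, v = E.u c' * E.annuity := by
  have hA := E.annuity_pos
  have hord := (isPreconnected_range E.continuous_gain).ordConnected
  have : v / E.annuity - E.u 0 ∈ E.gainRange := by
    refine hord.out (Set.mem_range_self 0) (Set.mem_range_self c) ⟨?_, ?_⟩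
    · have : E.u 0 ≤ v / E.annuity := by rw [le_div_iff₀ hA]; exact h0
      push_cast; linarith
    · have : v / E.annuity ≤ E.u c := by rw [div_le_iff₀ hA]; exact h1
      linarith
  obtain ⟨c', hc'⟩ := this
  refine ⟨c', ?_⟩
  have : E.u c' = v / E.annuity := by linarith [show E.u c' - E.u 0 = v / E.annuity - E.u 0 from hc']
  rw [this]; field_simp

theorem flow_autarky (g : Y → ℝ) (t : ℕ) (r r' : Reporting Y) (θ : CType) :
    E.flow t (fun _ _ y => g y) r θ = E.flow t (fun _ _ y => g y) r' θ := by
  induction t generalizing r r' θ with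
  | zero => rfl
  | succ t ih =>
    refine Finset.sum_congr rfl fun y _ => congrArg _ <| Finset.sum_congr rfl fun θ' _ =>
      congrArg _ (ih _ _ _)

theorem flow_income_succ (t : ℕ) (θ : CType) :
    E.flow (t + 1) (cons E.autarky) truth θ =
      ∑ θ', E.trans θ θ' * E.flow t (cons E.autarky) truth θ' := by
  have : ∀ y, ∑ θ', E.trans θ θ' * E.flow t (after (cons E.autarky) (E.sig y, (truth : Reporting Y) [] θ))
      (after truth (y, (truth : Reporting Y) [] θ, θ)) θ' =
      ∑ θ', E.trans θ θ' * E.flow t (cons E.autarky) truth θ' := fun y => rfl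
  rw [flow]
  simp only [this, ← Finset.sum_mul, E.p_sum, one_mul]

/-- By persistence the high type is more likely to be high in the next period, so the ordering of
expected incomes propagates. -/
theorem flow_income_mono (t : ℕ) : E.flow t (cons E.autarky) truth low ≤
    E.flow t (cons E.autarky) truth high := by
  induction t with
  | zero => exact E.mean_lt.le
  | succ t ih =>
    rw [flow_income_succ, flow_income_succ, sum_ctype, sum_ctype]
    have h1 := E.trans_sum low
    have h2 := E.trans_sum high
    rw [sum_ctype] at h1 h2
    have := mul_nonneg (sub_nonneg.2 E.persistent_high.le) (sub_nonneg.2 ih)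
    have e1 : E.trans low low = 1 - E.trans low high := by linarith
    have e2 : E.trans high low = 1 - E.trans high high := by linarith
    rw [e1, e2]; nlinarith

theorem hasSum_income (θ : CType) :
    HasSum (fun t => E.weight t * E.flow t (cons E.autarky) truth θ) (E.incomeValue θ) := by
  have hs : Summable fun t => E.weight t * E.flow t (cons E.autarky) truth θ := by
    refine Summable.of_nonneg_of_le (E.weight_cons_nonneg _ _ _) (fun t => ?_)
      (E.hasSum_weight.summable.mul_right (∑ y, (E.income y : ℝ)))
    refine mul_le_mul_of_nonneg_left ?_ (E.weight_nonneg t)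
    rw [← E.flow_const t (∑ y, (E.income y : ℝ)) truth θ]
    exact E.flow_mono t (fun h θ y => Finset.single_le_sum (f := fun y => (E.income y : ℝ))
      (fun y _ => (E.income y).2) (Finset.mem_univ y)) _ _
  have e : E.discounted (fun c => (c : ℝ)) E.autarky truth θ =
      ENNReal.ofReal (∑' t, E.weight t * E.flow t (cons E.autarky) truth θ) := by
    rw [discounted_eq]
    exact tsum_ofReal_of_hasSum (E.weight_cons_nonneg _ _ _) hs.hasSum
  rw [incomeValue, e, ENNReal.toReal_ofReal (tsum_nonneg (E.weight_cons_nonneg _ _ _))]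
  exact hs.hasSum

theorem incomeValue_lt : E.incomeValue low < E.incomeValue high := by
  refine hasSum_lt (i := 0) (fun t => mul_le_mul_of_nonneg_left (E.flow_income_mono t)
    (E.weight_nonneg t)) ?_ (E.hasSum_income low) (E.hasSum_income high)
  dsimp only
  rw [E.weight_zero, one_mul, one_mul]
  exact E.mean_lt

theorem incomeValue_nonneg (θ : CType) : 0 ≤ E.incomeValue θ := ENNReal.toReal_nonneg

/-- Discounted average expected lifetime income. -/
def meanIncome (θ : CType) : ℝ≥0 :=
  ⟨E.cFI θ, div_nonneg (E.incomeValue_nonneg θ) E.annuity_pos.le⟩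

theorem meanIncome_mul (θ : CType) : E.meanIncome θ * E.annuity = E.incomeValue θ :=
  div_mul_cancel₀ _ E.annuity_pos.ne'

theorem VFI_eq (θ : CType) : E.VFI θ = E.u (E.meanIncome θ) * E.annuity := rfl

theorem typeProfit_autarky (r : Reporting Y) (θ : CType) : E.typeProfit E.autarky r θ = 0 := by
  have : E.typeProfit E.autarky r θ = ((0 : ℝ) : EReal) := by
    rw [typeProfit_eq_coe_iff, sub_zero]
    convert E.hasSum_income θ using 3 with t
    exact E.flow_autarky (fun y => (E.income y : ℝ)) t r truth θ
  exact this

theorem utility_autarky (r : Reporting Y) (θ : CType) :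
    E.utility E.autarky r θ = E.utility E.autarky truth θ := by
  simp only [utility_eq]
  congr 2
  refine congrArg tsum (funext fun t => ?_)
  rw [show E.flow t (E.gain E.autarky) r θ = E.flow t (E.gain E.autarky) truth θ from
    E.flow_autarky (fun y => E.u (E.income y) - E.u 0) t r truth θ]

end

/-! ### A limit argument at full insurance -/

section

open scoped Classical in
/-- The probability of a public history, a current type and a current income under truth-telling,
given the first type. -/
def nodeProb : CType → List (Φ × CType) → CType → Y → ℝ
  | θ₀, [], θ, y => if θ = θ₀ then E.p θ y else 0
  | θ₀, (φ, θ₁) :: h, θ, y => if θ₁ = θ₀ then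
      ∑ y', (if E.sig y' = φ then E.p θ₀ y' else 0) * ∑ θ', E.trans θ₀ θ' * nodeProb θ' h θ y
    else 0

theorem nodeProb_nonneg (θ₀ : CType) (h : List (Φ × CType)) (θ : CType) (y : Y) :
    0 ≤ E.nodeProb θ₀ h θ y := by
  induction h generalizing θ₀ with
  | nil => rw [nodeProb]; split_ifs; exacts [E.p_nonneg _ _, le_rfl]
  | cons a h ih =>
    rw [nodeProb]
    split_ifs
    · refine Finset.sum_nonneg fun y' _ => mul_nonneg ?_ (Finset.sum_nonneg fun θ' _ =>
        mul_nonneg (E.trans_nonneg _ _) (ih _))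
      split_ifs; exacts [E.p_nonneg _ _, le_rfl]
    · exact le_rfl

theorem nodeProb_mul_le_flow {w : Payoff Y Φ} (hw : ∀ h θ y, 0 ≤ w h θ y) (θ₀ : CType)
    (h : List (Φ × CType)) (θ : CType) (y : Y) :
    E.nodeProb θ₀ h θ y * w h θ y ≤ E.flow h.length w truth θ₀ := by
  induction h generalizing θ₀ w with
  | nil =>
    rw [nodeProb]
    split_ifs with hθ
    · subst hθ
      exact Finset.single_le_sum (f := fun y => E.p θ y * w [] θ y)
        (fun y _ => mul_nonneg (E.p_nonneg _ _) (hw _ _ _)) (Finset.mem_univ y)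
    · rw [zero_mul]; exact E.flow_nonneg _ hw _ _
  | cons a h ih =>
    obtain ⟨φ, θ₁⟩ := a
    rw [nodeProb]
    split_ifs with hθ
    · subst hθ
      rw [List.length_cons, flow, Finset.sum_mul]
      refine Finset.sum_le_sum fun y' _ => ?_
      split_ifs with hs
      · rw [mul_assoc]
        refine mul_le_mul_of_nonneg_left ?_ (E.p_nonneg _ _)
        rw [Finset.sum_mul]
        refine Finset.sum_le_sum fun θ' _ => ?_
        rw [mul_assoc]
        refine mul_le_mul_of_nonneg_left ?_ (E.trans_nonneg _ _)
        subst hs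
        exact ih (w := after w (E.sig y', θ₁)) (fun _ _ _ => hw _ _ _) θ'
      · rw [zero_mul, zero_mul]
        exact mul_nonneg (E.p_nonneg _ _) (Finset.sum_nonneg fun θ' _ =>
          mul_nonneg (E.trans_nonneg _ _) (E.flow_nonneg _ (fun _ _ _ => hw _ _ _) _ _))
    · rw [zero_mul]; exact E.flow_nonneg _ hw _ _

theorem flow_congr_of_nodeProb (t : ℕ) {w w' : Payoff Y Φ} (θ₀ : CType)
    (h : ∀ h θ y, h.length = t → E.nodeProb θ₀ h θ y ≠ 0 → w h θ y = w' h θ y) :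
    E.flow t w truth θ₀ = E.flow t w' truth θ₀ := by
  induction t generalizing w w' θ₀ with
  | zero =>
    refine Finset.sum_congr rfl fun y _ => ?_
    by_cases hy : E.p θ₀ y = 0
    · rw [hy, zero_mul, zero_mul]
    · exact congrArg _ (h [] θ₀ y rfl (by simpa [nodeProb] using hy))
  | succ t ih =>
    refine Finset.sum_congr rfl fun y _ => ?_
    by_cases hy : E.p θ₀ y = 0
    · rw [hy, zero_mul, zero_mul]
    refine congrArg _ (Finset.sum_congr rfl fun θ' _ => ?_)
    by_cases hθ : E.trans θ₀ θ' = 0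
    · rw [hθ, zero_mul, zero_mul]
    refine congrArg _ (ih (w := after w (E.sig y, θ₀)) (w' := after w' (E.sig y, θ₀)) θ'
      fun l θ y' hl hn => h ((E.sig y, θ₀) :: l) θ y' (by simpa using hl) (ne_of_gt ?_))
    rw [nodeProb, if_pos rfl]
    refine Finset.sum_pos' (fun y' _ => mul_nonneg ?_ (Finset.sum_nonneg fun θ' _ =>
      mul_nonneg (E.trans_nonneg _ _) (E.nodeProb_nonneg _ _ _ _))) ⟨y, Finset.mem_univ _, ?_⟩
    · split_ifs; exacts [E.p_nonneg _ _, le_rfl]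
    · rw [if_pos rfl]
      refine mul_pos (lt_of_le_of_ne (E.p_nonneg _ _) (Ne.symm hy)) (Finset.sum_pos'
        (fun θ' _ => mul_nonneg (E.trans_nonneg _ _) (E.nodeProb_nonneg _ _ _ _))
        ⟨θ', Finset.mem_univ _, ?_⟩)
      exact mul_pos (lt_of_le_of_ne (E.trans_nonneg _ _) (Ne.symm hθ))
        (lt_of_le_of_ne (E.nodeProb_nonneg _ _ _ _) (Ne.symm hn))

open scoped Classical in
/-- Consumption `c` at the histories that are possible under truth-telling, and none elsewhere. -/
def forcing (θ₀ : CType) (c : ℝ≥0) : Mechanism Y Φ := fun h θ y =>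
  if (h.length : ℕ∞) < E.T ∧ E.nodeProb θ₀ h θ y ≠ 0 then c else 0

theorem weight_flow_forcing (θ₀ : CType) (c : ℝ≥0) (g : ℝ≥0 → ℝ) (t : ℕ) :
    E.weight t * E.flow t (fun h θ y => g (E.forcing θ₀ c h θ y)) truth θ₀ = g c * E.weight t := by
  by_cases ht : (t : ℕ∞) < E.T
  · rw [E.flow_congr_of_nodeProb t (w' := fun _ _ _ => g c) θ₀ fun h θ y hl hn => by
      subst hl; rw [forcing, if_pos ⟨ht, hn⟩], flow_const, mul_comm]
  · simp [weight, ht]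

variable {E}

/-- If contracts whose cost is that of full insurance deliver utilities arbitrarily close to it,
then full insurance is possible at this cost. -/
theorem Attains.of_tendsto {θ₀ : CType} {c : ℝ≥0} {V : CType → ℝ} {W : ℕ → CType → ℝ}
    (hV : V θ₀ = E.u c * E.annuity)
    (hW : ∀ k, E.Attains θ₀ (W k) (c * E.annuity)) (hle : ∀ k θ, θ ≠ θ₀ → W k θ ≤ V θ)
    (hlim : Filter.Tendsto (fun k => W k θ₀) Filter.atTop (nhds (V θ₀))) :
    E.Attains θ₀ V (c * E.annuity) := by
  choose z κ hκ hz using hW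
  -- As the cost is at most `c * E.annuity`, the total expected gap is at most `V θ₀ - W k θ₀`,
  -- which vanishes. Hence the gap vanishes at each node of positive probability.
  have hgap : ∀ h θ y, (h.length : ℕ∞) < E.T → E.nodeProb θ₀ h θ y ≠ 0 →
      Filter.Tendsto (fun k => E.gap c (z k h θ y)) Filter.atTop (nhds 0) := by
    intro h θ y ht hn
    have hp : 0 < E.weight h.length * E.nodeProb θ₀ h θ y :=
      mul_pos (E.weight_pos ht) (lt_of_le_of_ne (E.nodeProb_nonneg _ _ _ _) (Ne.symm hn))
    have hb : ∀ k, E.gap c (z k h θ y) ≤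
        (V θ₀ - W k θ₀) / (E.weight h.length * E.nodeProb θ₀ h θ y) := by
      intro k
      rw [le_div_iff₀ hp]
      have h1 := E.nodeProb_mul_le_flow (w := fun h θ y => E.gap c (z k h θ y))
        (fun _ _ _ => E.gap_nonneg _ _) θ₀ h θ y
      have h2 := mul_le_mul_of_nonneg_left h1 (E.weight_nonneg h.length)
      have h3 := sum_le_hasSum {h.length} (fun t _ => mul_nonneg (E.weight_nonneg t)
        (E.flow_nonneg t (fun _ _ _ => E.gap_nonneg _ _) truth θ₀))
        (E.hasSum_gap (hz k).util (hz k).cost c)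
      rw [Finset.sum_singleton] at h3
      have h4 := mul_nonneg (E.marginal_pos c).le (sub_nonneg.2 (hκ k))
      rw [hV]
      linarith
    refine squeeze_zero (fun k => E.gap_nonneg _ _) hb ?_
    have := (tendsto_const_nhds (x := V θ₀)).sub hlim
    rw [sub_self] at this
    simpa using this.div_const (E.weight h.length * E.nodeProb θ₀ h θ y)
  have hcap₀ := (E.isPlan_const c truth θ₀).cap
  -- Zero consumption at histories that are impossible under truth-telling deters deviations as
  -- strongly as possible and costs nothing.
  refine ⟨E.forcing θ₀ c, _, le_rfl, ?_, ?_, ?_⟩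
  · have := E.hasSum_weight.mul_left (E.u c - E.u 0)
    rw [show V θ₀ - E.floor = (E.u c - E.u 0) * E.annuity by rw [hV]; unfold floor; ring]
    rwa [← funext (E.weight_flow_forcing θ₀ c fun c => E.u c - E.u 0)] at this
  · have := E.hasSum_weight.mul_left (c : ℝ)
    rwa [← funext (E.weight_flow_forcing θ₀ c fun c => (c : ℝ))] at this
  · intro θ r' hr' n
    by_cases hθ : θ = θ₀
    · subst hθ
      rw [hV]
      refine le_trans (Finset.sum_le_sum fun t _ => mul_le_mul_of_nonneg_left
        (E.flow_mono t (fun h θ y => ?_) r' θ) (E.weight_nonneg t)) (hcap₀ θ r' hr' n)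
      refine sub_le_sub_right (E.u_le_iff.2 ?_) _
      unfold forcing; split_ifs; exacts [le_rfl, bot_le]
    · have hlim : Filter.Tendsto (fun k => E.partialSum E.weight n
          (fun h θ y => min (E.gain (z k) h θ y) (E.gain (E.forcing θ₀ c) h θ y)) r' θ)
          Filter.atTop (nhds (E.partialSum E.weight n (E.gain (E.forcing θ₀ c)) r' θ)) := by
        refine tendsto_finsetSum _ fun t _ => (E.tendsto_flow t (fun h θ y => ?_) r' θ).const_mul _
        by_cases hn : (h.length : ℕ∞) < E.T ∧ E.nodeProb θ₀ h θ y ≠ 0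
        · simp only [gain, forcing, if_pos hn]
          exact E.tendsto_min_of_gap (hgap h θ y hn.1 hn.2)
        · simp only [gain, forcing, if_neg hn, NNReal.coe_zero, sub_self, min_eq_right (E.u_zero_le _)]
          exact tendsto_const_nhds
      refine le_of_tendsto' hlim fun k => ?_
      refine le_trans ?_ (((hz k).cap θ r' hr' n).trans (sub_le_sub_right (hle k θ hθ) _))
      exact Finset.sum_le_sum fun t _ => mul_le_mul_of_nonneg_left
        (E.flow_mono t (fun h θ y => min_le_left _ _) r' θ) (E.weight_nonneg t)

end

/-! ### Existence and uniqueness of the competitive pair -/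

section

variable {E}

/-- The assumption that the profit maximization problem has solutions. -/
abbrev Solvable (E : Economy Y Φ) : Prop := ∀ V ∈ E.feasible, ∃ z, E.Solves V z

theorem attains_optTypeProfit (hsol : E.Solvable) {V : CType → ℝ} (hV : V ∈ E.feasible)
    (θ : CType) : E.Attains θ V (E.incomeValue θ - E.optTypeProfit V θ) := by
  obtain ⟨z, hz⟩ := hsol V hV
  exact (hz.isPlan hV θ).attains

theorem Attains.le_optTypeProfit (hsol : E.Solvable) {V : CType → ℝ} (hV : V ∈ E.feasible)
    {θ : CType} {k : ℝ} (hk : E.Attains θ V k) : E.incomeValue θ - E.optTypeProfit V θ ≤ k := by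
  obtain ⟨z, hz⟩ := hsol V hV
  exact hz.le hV hk

/-- A pair of utilities. -/
def _root_.Screening.pair (a b : ℝ) : CType → ℝ
  | low => a
  | high => b

theorem _root_.Screening.eq_pair (V : CType → ℝ) : V = pair (V low) (V high) := by
  funext θ; cases θ <;> rfl

theorem _root_.Screening.smul_pair_add (s t a b c d : ℝ) :
    s • pair a b + t • pair c d = pair (s * a + t * c) (s * b + t * d) := by
  funext θ; cases θ <;> rfl

theorem meanIncome_lt : E.meanIncome low < E.meanIncome high := by
  rw [← NNReal.coe_lt_coe]
  have h := E.incomeValue_lt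
  rw [← meanIncome_mul, ← meanIncome_mul] at h
  exact lt_of_mul_lt_mul_right h E.annuity_pos.le

theorem VFI_lt : E.VFI low < E.VFI high :=
  mul_lt_mul_of_pos_right (E.u_lt_iff.2 meanIncome_lt) E.annuity_pos

/-- Full insurance of the low type. -/
theorem attains_low_VFI {v : ℝ} (h : E.VFI low ≤ v) :
    E.Attains low (pair (E.VFI low) v) (E.incomeValue low) := by
  rw [← meanIncome_mul]
  refine E.attains_const rfl fun θ => ?_
  cases θ
  exacts [le_rfl, h]

/-- Both types get the full insurance of the low type. -/
theorem attains_high_pooling {v : ℝ} (h : E.VFI low ≤ v) :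
    E.Attains high (pair v (E.VFI low)) (E.incomeValue low) := by
  rw [← meanIncome_mul]
  refine E.attains_const rfl fun θ => ?_
  cases θ
  exacts [h, le_rfl]

theorem pair_mem_feasible {v k : ℝ} (h : E.VFI low ≤ v)
    (hk : E.Attains high (pair (E.VFI low) v) k) : pair (E.VFI low) v ∈ E.feasible := by
  rw [mem_feasible_iff]
  intro θ
  cases θ
  exacts [⟨_, attains_low_VFI h⟩, ⟨_, hk⟩]

/-- Mixing with the pooled full insurance of the low type, which costs strictly less than the high
type's income, moves `v` down to `w`. -/
theorem Attains.exists_lt_of_gt {v w k : ℝ} (h : E.Attains high (pair (E.VFI low) v) k)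
    (hk : k ≤ E.incomeValue high) (hw : E.VFI low < w) (hwv : w < v) :
    ∃ k' < E.incomeValue high, E.Attains high (pair (E.VFI low) w) k' := by
  set a := E.VFI low
  have hp : 0 < v - a := by linarith
  have h1 := h.mix (attains_high_pooling le_rfl) (a := (w - a) / (v - a))
    (div_nonneg (by linarith) hp.le) ((div_le_one hp).2 (by linarith))
  rw [smul_pair_add] at h1
  refine ⟨_, ?_, by
    convert h1 using 2
    · ring
    · field_simp; ring⟩
  have hs : (w - a) / (v - a) < 1 := (div_lt_one hp).2 (by linarith)
  have hs0 : 0 ≤ (w - a) / (v - a) := div_nonneg (by linarith) hp.le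
  have := mul_le_mul_of_nonneg_left hk hs0
  have := mul_lt_mul_of_pos_left E.incomeValue_lt (sub_pos.2 hs)
  linarith

/-- A constant consumption delivers `v`, tempts no low type, and costs at most the low type's
income. -/
theorem Attains.exists_lt_of_le {v k : ℝ} (h : E.Attains high (pair (E.VFI low) v) k)
    (hv : v ≤ E.VFI low) :
    ∃ k' < E.incomeValue high, E.Attains high (pair (E.VFI low) v) k' := by
  obtain ⟨c, hc⟩ := E.exists_const h.floor_le (hv.trans_eq (E.VFI_eq low))
  change v = _ at hc
  refine ⟨c * E.annuity, ?_, E.attains_const hc fun θ => ?_⟩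
  · rw [VFI_eq, hc] at hv
    have : c ≤ E.meanIncome low := E.u_le_iff.1 (le_of_mul_le_mul_right hv E.annuity_pos)
    rw [← meanIncome_mul]
    exact mul_lt_mul_of_pos_right (NNReal.coe_lt_coe.2 (this.trans_lt meanIncome_lt)) E.annuity_pos
  · rw [← hc]; cases θ
    exacts [hv, le_rfl]

theorem IsCompetitivePair.eq_pair {V : CType → ℝ} (h : E.IsCompetitivePair V) :
    V = pair (E.VFI low) (V high) := by
  rw [← h.2.1]; exact Screening.eq_pair V

theorem IsCompetitivePair.attains (hsol : E.Solvable) {V : CType → ℝ}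
    (h : E.IsCompetitivePair V) : E.Attains high V (E.incomeValue high) := by
  have := attains_optTypeProfit hsol h.1 high
  rwa [h.2.2, sub_zero] at this

theorem IsCompetitivePair.le (hsol : E.Solvable) {V : CType → ℝ}
    (h : E.IsCompetitivePair V) {k : ℝ} (hk : E.Attains high V k) : E.incomeValue high ≤ k := by
  have := hk.le_optTypeProfit hsol h.1
  rwa [h.2.2, sub_zero] at this

theorem IsCompetitivePair.VFI_lt (hsol : E.Solvable) {V : CType → ℝ}
    (h : E.IsCompetitivePair V) : E.VFI low < V high := by
  by_contra hle
  have ha := h.attains hsol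
  rw [h.eq_pair] at ha
  obtain ⟨k, hk, hk'⟩ := ha.exists_lt_of_le (not_lt.1 hle)
  rw [← h.eq_pair] at hk'
  exact absurd hk (not_lt.2 (h.le hsol hk'))

/-- The high type is better off than in `V*` only at a loss, if the low type is kept at her
full-information utility. -/
theorem IsCompetitivePair.lt_of_gt (hsol : E.Solvable) {V : CType → ℝ}
    (h : E.IsCompetitivePair V) {v k : ℝ} (hv : V high < v)
    (hk : E.Attains high (pair (E.VFI low) v) k) : E.incomeValue high < k := by
  by_contra hle
  obtain ⟨k', hk', ha⟩ := hk.exists_lt_of_gt (not_lt.1 hle) (h.VFI_lt hsol) hv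
  rw [← h.eq_pair] at ha
  exact absurd hk' (not_lt.2 (h.le hsol ha))

theorem IsCompetitivePair.unique (hsol : E.Solvable) {V V' : CType → ℝ}
    (h : E.IsCompetitivePair V) (h' : E.IsCompetitivePair V') : V' = V := by
  rw [h.eq_pair, h'.eq_pair]
  congr 1
  have hV := h.attains hsol
  have hV' := h'.attains hsol
  rw [h.eq_pair] at hV
  rw [h'.eq_pair] at hV'
  rcases lt_trichotomy (V' high) (V high) with hlt | heq | hlt
  · exact absurd (h'.lt_of_gt hsol hlt hV) (lt_irrefl _)
  · exact heq
  · exact absurd (h.lt_of_gt hsol hlt hV') (lt_irrefl _)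

/-- The least cost `K` of the high type is convex on `[a, b]` and below income at `a`. Either it
reaches income in the interior, and the intermediate value theorem applies, or it stays below. Then
a possible jump at `b` is excluded by the limit argument, and full insurance costs exactly income
there. -/
theorem exists_isCompetitivePair (hsol : E.Solvable) (hFI : E.VFI ∈ E.feasible) :
    ∃ V, E.IsCompetitivePair V := by
  set a := E.VFI low with ha
  set b := E.VFI high with hb
  have hab : a < b := VFI_lt
  obtain ⟨kb, hkb⟩ := mem_feasible_iff.1 hFI high
  rw [Screening.eq_pair E.VFI] at hkb
  have hfeas : ∀ v ∈ Set.Icc a b, pair a v ∈ E.feasible := by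
    intro v hv
    have hp : 0 < b - a := by linarith
    have h1 := hkb.mix (attains_high_pooling le_rfl) (a := (v - a) / (b - a))
      (div_nonneg (by linarith [hv.1]) hp.le) ((div_le_one hp).2 (by linarith [hv.2]))
    rw [smul_pair_add] at h1
    refine pair_mem_feasible hv.1
      (k := (v - a) / (b - a) * kb + (1 - (v - a) / (b - a)) * E.incomeValue low) ?_
    convert h1 using 2
    · ring
    · simp only [← ha, ← hb]; field_simp; ring
  let K : ℝ → ℝ := fun v => E.incomeValue high - E.optTypeProfit (pair a v) high
  have hK : ∀ v ∈ Set.Icc a b, E.Attains high (pair a v) (K v) := fun v hv =>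
    attains_optTypeProfit hsol (hfeas v hv) high
  have hKle : ∀ v ∈ Set.Icc a b, ∀ k, E.Attains high (pair a v) k → K v ≤ k := fun v hv k hk =>
    hk.le_optTypeProfit hsol (hfeas v hv)
  have hconv : ConvexOn ℝ (Set.Icc a b) K := by
    refine ⟨convex_Icc a b, fun v hv w hw s t hs ht hst => hKle _ (convex_Icc a b hv hw hs ht hst) _ ?_⟩
    have h1 := (hK v hv).mix (hK w hw) hs (by linarith)
    obtain rfl : t = 1 - s := by linarith
    rw [smul_pair_add] at h1
    rw [show s * a + (1 - s) * a = a by ring] at h1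
    exact h1
  have hKa : K a < E.incomeValue high :=
    (hKle a ⟨le_rfl, hab.le⟩ _ (attains_high_pooling le_rfl)).trans_lt E.incomeValue_lt
  have hdone : ∀ v ∈ Set.Icc a b, K v = E.incomeValue high → E.IsCompetitivePair (pair a v) :=
    fun v hv h => ⟨hfeas v hv, rfl, by simp only [K] at h; linarith⟩
  by_cases hcase : ∀ v ∈ Set.Ioo a b, K v < E.incomeValue high
  · refine ⟨_, hdone b ⟨hab.le, le_rfl⟩ (le_antisymm (hKle b ⟨hab.le, le_rfl⟩ _ ?_) ?_)⟩
    · have hm : ∀ k : ℕ, b - (b - a) / (k + 2) ∈ Set.Ioo a b := fun k => by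
        have h2 : (0 : ℝ) < k + 2 := by positivity
        have h3 : 0 < (b - a) / (k + 2) := div_pos (by linarith) h2
        have h4 : (b - a) / (k + 2) < b - a :=
          div_lt_self (by linarith) (by linarith [(Nat.cast_nonneg k : (0 : ℝ) ≤ k)])
        constructor <;> linarith
      rw [← meanIncome_mul]
      refine Attains.of_tendsto (W := fun k : ℕ => pair a (b - (b - a) / (k + 2))) rfl
        (fun k => ?_) (fun k θ hθ => ?_) ?_
      · rw [meanIncome_mul]
        exact (hK _ (Set.Ioo_subset_Icc_self (hm k))).mono (hcase _ (hm k)).le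
      · cases θ
        exacts [le_rfl, absurd rfl hθ]
      · change Filter.Tendsto (fun k : ℕ => b - (b - a) / ((k : ℝ) + 2)) Filter.atTop (nhds b)
        have h5 : Filter.Tendsto (fun k : ℕ => (b - a) / ((k : ℝ) + 2)) Filter.atTop (nhds 0) :=
          tendsto_const_nhds.div_atTop
            (Filter.tendsto_atTop_add_const_right _ _ tendsto_natCast_atTop_atTop)
        simpa using tendsto_const_nhds.sub h5
    · have := (hK b ⟨hab.le, le_rfl⟩).le_tangent (E.meanIncome high)
      rw [meanIncome_mul, ← VFI_eq] at this
      change b ≤ b + _ at this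
      have := nonneg_of_mul_nonneg_right (show 0 ≤ E.marginal (E.meanIncome high) *
        (K b - E.incomeValue high) by linarith) (E.marginal_pos _)
      linarith
  · push Not at hcase
    obtain ⟨v₀, hv₀, hKv₀⟩ := hcase
    have hD : 0 < K v₀ - K a := by linarith
    -- Convexity bounds `K` at the point with weight `s` on `v₀` by the mean of `K a` and income.
    -- This interior point replaces `a`, where a convex function may be discontinuous.
    set s := (E.incomeValue high - K a) / (2 * (K v₀ - K a)) with hs
    have hs0 : 0 < s := div_pos (by linarith) (by linarith)
    have hs1 : s < 1 := (div_lt_one (by linarith)).2 (by linarith)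
    have hv₁ : (1 - s) * a + s * v₀ ∈ Set.Ioo a v₀ := by
      have := mul_pos hs0 (sub_pos.2 hv₀.1)
      have := mul_pos (sub_pos.2 hs1) (sub_pos.2 hv₀.1)
      constructor <;> linarith
    have hK₁ : K ((1 - s) * a + s * v₀) ≤ E.incomeValue high := by
      have := hconv.2 (x := a) ⟨le_rfl, hab.le⟩ (y := v₀) (Set.Ioo_subset_Icc_self hv₀)
        (sub_nonneg.2 hs1.le) hs0.le (by ring)
      simp only [smul_eq_mul] at this
      have e : s * (K v₀ - K a) = (E.incomeValue high - K a) / 2 := by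
        rw [hs]; field_simp
      linarith
    have hcont : ContinuousOn K (Set.Icc ((1 - s) * a + s * v₀) v₀) := by
      refine hconv.continuousOn_interior.mono ?_
      rw [interior_Icc]
      exact fun x hx => ⟨hv₁.1.trans_le hx.1, hx.2.trans_lt hv₀.2⟩
    obtain ⟨v, hv, hKv⟩ := intermediate_value_Icc hv₁.2.le hcont ⟨hK₁, hKv₀⟩
    exact ⟨_, hdone v ⟨hv₁.1.le.trans hv.1, hv.2.trans hv₀.2.le⟩ hKv⟩

end

/-! ### Deviations to truthful offers and equilibrium utilities -/

section

variable {E}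

/-- The offer of a mechanism in which truth-telling is optimal. -/
def truthfulOffer (z : Mechanism Y Φ) (h : ∀ θ, E.OptimalReporting z θ truth) : E.Offer :=
  ⟨z, fun θ => ⟨truth, h θ⟩⟩

namespace Profile

variable {F : Type*} {s : E.Profile F}

theorem value_some (o : F → E.Offer) (θ : CType) (j : F) :
    s.value o θ (some j) = E.utility (o j).1 (s.report o j θ) θ := rfl

theorem firmProfit_eq (o : F → E.Offer) (j : F) : s.firmProfit o j =
    ((E.prior low * s.accept o low (some j) : ℝ) : EReal) *
      E.typeProfit (o j).1 (s.report o j low) low +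
    ((E.prior high * s.accept o high (some j) : ℝ) : EReal) *
      E.typeProfit (o j).1 (s.report o j high) high := sum_ctype _

variable [Fintype F] [DecidableEq F]

theorem IsPBE.accept_nonneg (hs : s.IsPBE) (o : F → E.Offer) (θ : CType) (a : Option F) :
    0 ≤ s.accept o θ a := (hs.accept_mem o θ).1 a

theorem IsPBE.sum_accept (hs : s.IsPBE) (o : F → E.Offer) (θ : CType) :
    ∑ a, s.accept o θ a = 1 := (hs.accept_mem o θ).2

theorem IsPBE.exists_accept_pos (hs : s.IsPBE) (o : F → E.Offer) (θ : CType) :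
    ∃ a, 0 < s.accept o θ a := by
  by_contra! h
  have := Finset.sum_nonpos fun a (_ : a ∈ Finset.univ) => h a
  rw [hs.sum_accept] at this
  linarith

theorem IsPBE.utility_le_value (hs : s.IsPBE) (o : F → E.Offer) (θ : CType) (a : Option F)
    (r : Reporting Y) : E.utility (mech o a) r θ ≤ s.value o θ a := by
  cases a with
  | none => exact (E.utility_autarky r θ).le
  | some j => exact hs.report_optimal o j θ r

/-- Reports in an unchanged offer may react to the other offers, but optimality pins down their
value. -/
theorem IsPBE.value_update_of_ne (hs : s.IsPBE) (o : F → E.Offer) (j : F) (m : E.Offer) (θ : CType)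
    {a : Option F} (ha : a ≠ some j) : s.value (Function.update o j m) θ a = s.value o θ a := by
  have hm : mech (Function.update o j m) a = mech o a := by
    cases a with
    | none => rfl
    | some i => simp only [mech, Function.update_of_ne (show i ≠ j from fun h => ha (by rw [h]))]
  refine le_antisymm ?_ ?_
  · rw [value, hm]; exact hs.utility_le_value o θ a _
  · rw [value, ← hm]; exact hs.utility_le_value _ θ a _

theorem IsPBE.report_update (hs : s.IsPBE) (o : F → E.Offer) (j : F) {z : Mechanism Y Φ}
    (h : ∀ θ, E.OptimalReporting z θ truth) (θ : CType) :
    s.report (Function.update o j (truthfulOffer z h)) j θ = truth :=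
  hs.truthful _ j θ (by rw [Function.update_self]; exact h θ)

theorem IsPBE.value_update_self (hs : s.IsPBE) (o : F → E.Offer) (j : F) {z : Mechanism Y Φ}
    (h : ∀ θ, E.OptimalReporting z θ truth) (θ : CType) :
    s.value (Function.update o j (truthfulOffer z h)) θ (some j) = E.utility z truth θ := by
  rw [value_some, hs.report_update o j h, Function.update_self]; rfl

theorem IsPBE.accept_update_eq_one (hs : s.IsPBE) {o : F → E.Offer} (j : F) {z : Mechanism Y Φ}
    (h : ∀ θ, E.OptimalReporting z θ truth) {θ : CType}
    (hlt : ∀ a, s.value o θ a < E.utility z truth θ) :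
    s.accept (Function.update o j (truthfulOffer z h)) θ (some j) = 1 := by
  rw [← hs.sum_accept (Function.update o j (truthfulOffer z h)) θ]
  refine (Finset.sum_eq_single (some j) (fun a _ ha => ?_) (fun h => absurd (Finset.mem_univ _) h)).symm
  by_contra hne
  have := hs.accept_optimal _ θ a (lt_of_le_of_ne (hs.accept_nonneg _ _ _) (Ne.symm hne)) (some j)
  rw [hs.value_update_self, hs.value_update_of_ne _ _ _ _ ha] at this
  exact absurd (hlt a) (not_lt.2 this)

theorem IsPBE.accept_update_eq_zero (hs : s.IsPBE) {o : F → E.Offer} (j : F) {z : Mechanism Y Φ}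
    (h : ∀ θ, E.OptimalReporting z θ truth) {θ : CType} {a : Option F} (ha : a ≠ some j)
    (hlt : E.utility z truth θ < s.value o θ a) :
    s.accept (Function.update o j (truthfulOffer z h)) θ (some j) = 0 := by
  by_contra hne
  have := hs.accept_optimal _ θ _ (lt_of_le_of_ne (hs.accept_nonneg _ _ _) (Ne.symm hne)) a
  rw [hs.value_update_self, hs.value_update_of_ne _ _ _ _ ha] at this
  exact absurd hlt (not_lt.2 this)

theorem IsPBE.firmProfit_update (hs : s.IsPBE) (o : F → E.Offer) (j : F) {z : Mechanism Y Φ}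
    (h : ∀ θ, E.OptimalReporting z θ truth) {π : CType → ℝ}
    (hπ : ∀ θ, E.typeProfit z truth θ = (π θ : EReal)) :
    s.firmProfit (Function.update o j (truthfulOffer z h)) j =
      ((E.prior low * s.accept (Function.update o j (truthfulOffer z h)) low (some j) * π low +
        E.prior high * s.accept (Function.update o j (truthfulOffer z h)) high (some j) * π high :
          ℝ) : EReal) := by
  rw [firmProfit_eq, hs.report_update, hs.report_update, Function.update_self]
  change _ * E.typeProfit z truth low + _ * E.typeProfit z truth high = _
  rw [hπ, hπ]; push_cast; rfl

/-- An offer of zero consumption earns the income of whoever accepts it. -/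
theorem IsPBE.firmProfit_nonneg (hs : s.IsPBE) (j : F) : 0 ≤ s.firmProfit s.offer j := by
  have hp : ∀ θ, E.IsPlan (fun _ _ _ => 0) truth θ (fun _ => E.u (0 : ℝ≥0) * E.annuity)
      ((0 : ℝ≥0) * E.annuity) := E.isPlan_const 0 truth
  have hz : ∀ θ, E.OptimalReporting (fun _ _ _ => 0) θ truth := fun θ r => by
    rw [(hp θ).utility_eq, (E.isPlan_const 0 r θ).utility_eq]
  refine le_trans ?_ (hs.offer_optimal j (truthfulOffer _ hz))
  rw [hs.firmProfit_update _ _ hz fun θ => (hp θ).typeProfit_eq]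
  have := E.incomeValue_nonneg
  have := fun θ => (E.prior_pos θ).le
  have := fun θ => hs.accept_nonneg (Function.update s.offer j (truthfulOffer _ hz)) θ (some j)
  refine EReal.coe_nonneg.2 ?_
  simp only [NNReal.coe_zero, zero_mul, sub_zero]
  exact add_nonneg (mul_nonneg (mul_nonneg (by simp [*]) (by simp [*])) (by simp [*]))
    (mul_nonneg (mul_nonneg (by simp [*]) (by simp [*])) (by simp [*]))

/-- Profit on the types that accept is finite in equilibrium. -/
theorem IsPBE.typeProfit_ne_bot (hs : s.IsPBE) {θ : CType} {a : Option F}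
    (ha : 0 < s.accept s.offer θ a) :
    E.typeProfit (mech s.offer a) (s.rep s.offer θ a) θ ≠ ⊥ := by
  cases a with
  | none => rw [mech, E.typeProfit_autarky]; simp
  | some j =>
    intro hb
    have h := hs.firmProfit_nonneg j
    change E.typeProfit (s.offer j).1 (s.report s.offer j θ) θ = ⊥ at hb
    rw [firmProfit_eq] at h
    cases θ
    · rw [hb, EReal.coe_mul_bot_of_pos (mul_pos (E.prior_pos _) ha), EReal.bot_add] at h
      exact absurd h (by simp)
    · rw [hb, EReal.coe_mul_bot_of_pos (mul_pos (E.prior_pos _) ha), EReal.add_bot] at h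
      exact absurd h (by simp)

/-- Equilibrium utilities. -/
theorem IsPBE.exists_utilities (hs : s.IsPBE) : ∃ U : CType → ℝ,
    (∀ θ a, s.value s.offer θ a ≤ (U θ : EReal)) ∧
    ∀ θ a, 0 < s.accept s.offer θ a → s.value s.offer θ a = (U θ : EReal) := by
  have key : ∀ θ, ∃ x : ℝ, (∀ a, s.value s.offer θ a ≤ (x : EReal)) ∧
      ∀ a, 0 < s.accept s.offer θ a → s.value s.offer θ a = (x : EReal) := by
    intro θ
    obtain ⟨a, ha⟩ := hs.exists_accept_pos s.offer θ
    obtain ⟨π, hπ⟩ := E.exists_typeProfit_eq (hs.typeProfit_ne_bot ha)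
    obtain ⟨x, hx⟩ := E.exists_utility_eq hπ
    have hx' : s.value s.offer θ a = x := hx
    refine ⟨x, fun b => hx' ▸ hs.accept_optimal _ θ a ha b, fun b hb => ?_⟩
    exact le_antisymm (hx' ▸ hs.accept_optimal _ θ a ha b) (hx' ▸ hs.accept_optimal _ θ b hb a)
  choose U h1 h2 using key
  exact ⟨U, h1, h2⟩

end Profile

end

/-! ### Competition: zero profit and the equilibrium outcome -/

section

variable {E}

/-- Truthful contracts for both types form an incentive compatible mechanism. -/
theorem exists_mechanism {V κ : CType → ℝ} (h : ∀ θ, E.Attains θ V (κ θ)) :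
    ∃ (z : Mechanism Y Φ) (π : CType → ℝ), (∀ θ, E.OptimalReporting z θ truth) ∧
      (∀ θ, E.utility z truth θ = (V θ : EReal)) ∧ (∀ θ, E.typeProfit z truth θ = (π θ : EReal)) ∧ ∀ θ, E.incomeValue θ - κ θ ≤ π θ := by
  choose z k hk hz using h
  have hp := isPlan_byFirstReport hz
  refine ⟨byFirstReport z, fun θ => E.incomeValue θ - k θ, fun θ r => ?_,
    fun θ => (hp θ).utility_eq, fun θ => (hp θ).typeProfit_eq, fun θ => sub_le_sub_left (hk θ) _⟩
  rw [(hp θ).utility_eq]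
  exact utility_byFirstReport_le hz θ r

/-- A constant consumption that beats any contract of a given cost. -/
theorem exists_rich {V κ : CType → ℝ} (h : ∀ θ, E.Attains θ V (κ θ)) :
    ∃ c : ℝ≥0, ∀ θ, V θ < E.u c * E.annuity := by
  -- The constant `c` costs at least as much as each contract, so by the tangent bound it is worth
  -- at least as much; adding 1 makes this strict.
  set c : ℝ≥0 := (max (κ low) (κ high) / E.annuity).toNNReal with hc
  refine ⟨c + 1, fun θ => ?_⟩
  have hA := E.annuity_pos
  have h1 : κ θ ≤ c * E.annuity := by
    have : max (κ low) (κ high) ≤ c * E.annuity := by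
      rw [← div_le_iff₀ hA]; exact Real.le_coe_toNNReal _
    cases θ
    exacts [(le_max_left _ _).trans this, (le_max_right _ _).trans this]
  have h2 := (h θ).le_tangent c
  have h3 := mul_nonneg (E.marginal_pos c).le (sub_nonneg.2 h1)
  have h4 := mul_lt_mul_of_pos_right (E.u_lt_iff.2 (lt_add_of_pos_right c one_pos)) hA
  linarith

theorem _root_.Screening.le_of_forall_mix_le {P Q R : ℝ}
    (h : ∀ a : ℝ, 0 < a → a < 1 → a * Q + (1 - a) * P ≤ R) : P ≤ R := by
  by_contra! hlt
  by_cases hQ : P ≤ Q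
  · have := h 2⁻¹ (by norm_num) (by norm_num)
    linarith
  · push Not at hQ
    have h1 : 0 < P - Q := by linarith
    have h2 := h (min 2⁻¹ ((P - R) / (2 * (P - Q)))) (lt_min (by norm_num)
      (div_pos (by linarith) (by linarith))) ((min_le_left _ _).trans_lt (by norm_num))
    have h3 : min 2⁻¹ ((P - R) / (2 * (P - Q))) * (P - Q) ≤ (P - R) / 2 := by
      refine (mul_le_mul_of_nonneg_right (min_le_right _ _) h1.le).trans (le_of_eq ?_)
      field_simp
    linarith

namespace Profile

variable {F : Type*} {s : E.Profile F} [Fintype F] [DecidableEq F]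

theorem IsPBE.isPlan (hs : s.IsPBE) {U : CType → ℝ}
    (hle : ∀ θ a, s.value s.offer θ a ≤ (U θ : EReal))
    (heq : ∀ θ a, 0 < s.accept s.offer θ a → s.value s.offer θ a = (U θ : EReal))
    {θ : CType} {a : Option F} (ha : 0 < s.accept s.offer θ a) :
    E.IsPlan (mech s.offer a) (s.rep s.offer θ a) θ U (E.incomeValue θ -
      (E.typeProfit (mech s.offer a) (s.rep s.offer θ a) θ).toReal) :=
  isPlan_of_utility_le (heq θ a ha)
    (fun θ' r' => (hs.utility_le_value s.offer θ' a r').trans (hle θ' a))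
    (EReal.coe_toReal (E.typeProfit_ne_top _ _ _) (hs.typeProfit_ne_bot ha)).symm

/-- An offer that both types strictly prefer wins the whole market. -/
theorem IsPBE.profit_le_firmProfit_of_lt (hs : s.IsPBE) {U : CType → ℝ}
    (hle : ∀ θ a, s.value s.offer θ a ≤ (U θ : EReal)) {V κ : CType → ℝ}
    (hUV : ∀ θ, U θ < V θ) (h : ∀ θ, E.Attains θ V (κ θ)) (j : F) :
    ((E.prior low * (E.incomeValue low - κ low) + E.prior high * (E.incomeValue high - κ high) : ℝ)
      : EReal) ≤ s.firmProfit s.offer j := by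
  obtain ⟨z, π, ho, hu, hπ, hge⟩ := exists_mechanism h
  refine le_trans ?_ (hs.offer_optimal j (truthfulOffer z ho))
  have hone : ∀ θ, s.accept (Function.update s.offer j (truthfulOffer z ho)) θ (some j) = 1 :=
    fun θ => hs.accept_update_eq_one j ho fun a => by
      rw [hu]; exact (hle θ a).trans_lt (EReal.coe_lt_coe_iff.2 (hUV θ))
  rw [hs.firmProfit_update _ _ ho hπ, hone, hone, EReal.coe_le_coe_iff, mul_one, mul_one]
  exact add_le_add (mul_le_mul_of_nonneg_left (hge _) (E.prior_pos _).le)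
    (mul_le_mul_of_nonneg_left (hge _) (E.prior_pos _).le)

/-- Ties are removed by mixing in a little of a generous constant contract, at a vanishing cost. -/
theorem IsPBE.profit_le_firmProfit (hs : s.IsPBE) {U : CType → ℝ}
    (hle : ∀ θ a, s.value s.offer θ a ≤ (U θ : EReal)) {V κ : CType → ℝ}
    (hUV : ∀ θ, U θ ≤ V θ) (h : ∀ θ, E.Attains θ V (κ θ)) {j : F} {x : ℝ}
    (hx : s.firmProfit s.offer j = (x : EReal)) :
    E.prior low * (E.incomeValue low - κ low) + E.prior high * (E.incomeValue high - κ high) ≤ x := by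
  obtain ⟨c, hc⟩ := exists_rich h
  refine Screening.le_of_forall_mix_le (Q := E.prior low * (E.incomeValue low - c * E.annuity) +
    E.prior high * (E.incomeValue high - c * E.annuity)) fun a ha0 ha1 => ?_
  have hmix := fun θ => (E.isPlan_const c truth θ).attains.mix (h θ) ha0.le ha1.le
  have := hs.profit_le_firmProfit_of_lt hle (fun θ => ?_) hmix j
  · rw [hx, EReal.coe_le_coe_iff] at this
    refine le_trans (le_of_eq ?_) this
    ring
  · simp only [Pi.add_apply, Pi.smul_apply, smul_eq_mul]
    have := mul_lt_mul_of_pos_left (hc θ) ha0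
    linarith [hUV θ]

theorem IsPBE.firmProfit_eq_coe (hs : s.IsPBE) (j : F) : s.firmProfit s.offer j =
    ((∑ θ, E.prior θ * (s.accept s.offer θ (some j) *
      (E.typeProfit (s.offer j).1 (s.report s.offer j θ) θ).toReal) : ℝ) : EReal) := by
  have key : ∀ θ, ((E.prior θ * s.accept s.offer θ (some j) : ℝ) : EReal) *
      E.typeProfit (s.offer j).1 (s.report s.offer j θ) θ = ((E.prior θ * (s.accept s.offer θ (some j) *
      (E.typeProfit (s.offer j).1 (s.report s.offer j θ) θ).toReal) : ℝ) : EReal) := by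
    intro θ
    rcases (hs.accept_nonneg s.offer θ (some j)).eq_or_lt with h0 | hpos
    · rw [← h0]; simp
    · have : E.typeProfit (s.offer j).1 (s.report s.offer j θ) θ =
          ((E.typeProfit (s.offer j).1 (s.report s.offer j θ) θ).toReal : EReal) :=
        (EReal.coe_toReal (E.typeProfit_ne_top _ _ _) (hs.typeProfit_ne_bot hpos)).symm
      rw [this, ← EReal.coe_mul, mul_assoc, EReal.toReal_coe]
  rw [firmProfit_eq, key, key, sum_ctype, EReal.coe_add]

/-- In equilibrium no firm makes a profit and each type's accepted contracts have the least cost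
given the equilibrium utilities. -/
theorem IsPBE.zero_profit (hs : s.IsPBE) (hsol : E.Solvable) (hF : 2 ≤ Fintype.card F)
    {U : CType → ℝ} (hle : ∀ θ a, s.value s.offer θ a ≤ (U θ : EReal))
    (heq : ∀ θ a, 0 < s.accept s.offer θ a → s.value s.offer θ a = (U θ : EReal)) :
    U ∈ E.feasible ∧ (∀ j, s.firmProfit s.offer j = 0) ∧
      E.prior low * E.optTypeProfit U low + E.prior high * E.optTypeProfit U high = 0 ∧
      ∀ θ a, 0 < s.accept s.offer θ a →
        (E.typeProfit (mech s.offer a) (s.rep s.offer θ a) θ).toReal = E.optTypeProfit U θ := by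
  set acc := s.accept s.offer
  set π : CType → Option F → ℝ := fun θ a =>
    (E.typeProfit (mech s.offer a) (s.rep s.offer θ a) θ).toReal with hπ
  have hfeas : U ∈ E.feasible := mem_feasible_iff.2 fun θ => by
    obtain ⟨a, ha⟩ := hs.exists_accept_pos s.offer θ
    exact ⟨_, (hs.isPlan hle heq ha).attains_of_reporting⟩
  have hmin : ∀ θ a, 0 < acc θ a → π θ a ≤ E.optTypeProfit U θ := fun θ a ha => by
    have := (hs.isPlan hle heq ha).attains_of_reporting.le_optTypeProfit hsol hfeas
    linarith
  set X : F → ℝ := fun j => ∑ θ, E.prior θ * (acc θ (some j) * π θ (some j))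
  have hX : ∀ j, s.firmProfit s.offer j = (X j : EReal) := hs.firmProfit_eq_coe
  have hX0 : ∀ j, 0 ≤ X j := fun j => by
    have := hs.firmProfit_nonneg j
    rw [hX] at this
    exact_mod_cast this
  set P := E.prior low * E.optTypeProfit U low + E.prior high * E.optTypeProfit U high with hP
  have hPX : ∀ j, P ≤ X j := fun j => by
    have := hs.profit_le_firmProfit hle (fun θ => le_rfl)
      (fun θ => attains_optTypeProfit hsol hfeas θ) (hX j)
    simpa using this
  have hnone : ∀ θ, π θ none = 0 := fun θ => by
    simp only [hπ, mech, typeProfit_autarky, EReal.toReal_zero]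
  have hloss : ∀ θ a, 0 ≤ acc θ a * (E.optTypeProfit U θ - π θ a) := fun θ a => by
    rcases (hs.accept_nonneg s.offer θ a).eq_or_lt with h0 | hpos
    · rw [show acc θ a = 0 from h0.symm, zero_mul]
    · exact mul_nonneg hpos.le (sub_nonneg.2 (hmin θ a hpos))
  -- Accepting no offer yields zero profit, so the sum over firms extends to all options. What is
  -- missing from the optimal profit is the loss from contracts that are too costly.
  have hsum : ∀ θ, ∑ j, acc θ (some j) * π θ (some j) =
      E.optTypeProfit U θ - ∑ a, acc θ a * (E.optTypeProfit U θ - π θ a) := fun θ => by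
    simp only [mul_sub, Finset.sum_sub_distrib, ← Finset.sum_mul]
    rw [hs.sum_accept s.offer θ, Fintype.sum_option, hnone]
    ring
  have htot : ∑ j, X j = P - (E.prior low * ∑ a, acc low a * (E.optTypeProfit U low - π low a) +
      E.prior high * ∑ a, acc high a * (E.optTypeProfit U high - π high a)) := by
    simp only [X]
    rw [Finset.sum_comm, sum_ctype, ← Finset.mul_sum, ← Finset.mul_sum, hsum, hsum]
    ring
  have hl := fun θ => Finset.sum_nonneg fun a (_ : a ∈ Finset.univ) => hloss θ a
  have hl' := fun θ => mul_nonneg (E.prior_pos θ).le (hl θ)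
  -- With two firms, `X i + X j ≤ ∑ X ≤ P ≤ X i`, so `X j ≤ 0`.
  have hXz : ∀ j, X j = 0 := fun j => by
    obtain ⟨i, hi⟩ := Fintype.exists_ne_of_one_lt_card hF j
    have h1 : X i + X j ≤ ∑ j, X j := by
      rw [← Finset.sum_pair hi]
      exact Finset.sum_le_sum_of_subset_of_nonneg (Finset.subset_univ _) fun j _ _ => hX0 j
    linarith [hPX i, hX0 j, hl' low, hl' high]
  have hP0 : P = 0 := by
    obtain ⟨j⟩ : Nonempty F := Fintype.card_pos_iff.1 (by omega)
    have h1 : ∑ j, X j = 0 := Finset.sum_eq_zero fun j _ => hXz j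
    linarith [hPX j, hXz j, hl' low, hl' high]
  refine ⟨hfeas, fun j => by rw [hX, hXz]; rfl, hP0, fun θ a ha => ?_⟩
  have h1 : ∑ j, X j = 0 := Finset.sum_eq_zero fun j _ => hXz j
  have h2 : E.prior θ * ∑ a, acc θ a * (E.optTypeProfit U θ - π θ a) ≤ 0 := by
    cases θ <;> linarith [hl' low, hl' high]
  have h3 : ∑ a, acc θ a * (E.optTypeProfit U θ - π θ a) ≤ 0 :=
    nonpos_of_mul_nonpos_right h2 (E.prior_pos θ)
  have h4 := (Finset.single_le_sum (fun a _ => hloss θ a) (Finset.mem_univ a)).trans h3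
  have h5 := nonpos_of_mul_nonpos_right h4 ha
  exact le_antisymm (hmin θ a ha) (by linarith)

/-- In equilibrium no type is worse off than under full insurance of the low type. -/
theorem IsPBE.VFI_le (hs : s.IsPBE) (h0 : ∀ j, s.firmProfit s.offer j = 0) (j : F)
    {U : CType → ℝ} (hU : U ∈ E.feasible) (hle : ∀ θ a, s.value s.offer θ a ≤ (U θ : EReal))
    (θ : CType) : E.VFI low ≤ U θ := by
  by_contra! hlt
  have hA := E.annuity_pos
  obtain ⟨k, hk⟩ := mem_feasible_iff.1 hU θ
  -- This constant attracts type `θ` and lies below the low type's mean income, so it is profitable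
  -- on either type.
  obtain ⟨c, hc⟩ := E.exists_const (v := (U θ + E.VFI low) / 2) (c := E.meanIncome low)
    (by linarith [hk.floor_le]) (by linarith [E.VFI_eq low])
  have hcl : c < E.meanIncome low := by
    have : E.u c * E.annuity < E.u (E.meanIncome low) * E.annuity := by
      rw [← hc, ← VFI_eq]; linarith
    exact E.u_lt_iff.1 (lt_of_mul_lt_mul_right this hA.le)
  have hcI : ∀ θ, c * E.annuity < E.incomeValue θ := fun θ => by
    have : c * E.annuity < E.incomeValue low := by
      rw [← meanIncome_mul]; exact mul_lt_mul_of_pos_right (NNReal.coe_lt_coe.2 hcl) hA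
    cases θ
    exacts [this, this.trans E.incomeValue_lt]
  have hp := E.isPlan_const c truth
  have hz : ∀ θ, E.OptimalReporting (fun _ _ _ => c) θ truth := fun θ r => by
    rw [(hp θ).utility_eq, (E.isPlan_const c r θ).utility_eq]
  have hone := hs.accept_update_eq_one (o := s.offer) j hz (θ := θ) fun a => by
    rw [(hp θ).utility_eq, ← hc]
    exact (hle θ a).trans_lt (EReal.coe_lt_coe_iff.2 (by linarith))
  have hdev := hs.offer_optimal j (truthfulOffer _ hz)
  rw [h0, hs.firmProfit_update _ _ hz fun θ => (hp θ).typeProfit_eq, EReal.coe_nonpos] at hdev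
  have hn : ∀ θ', 0 ≤ E.prior θ' * s.accept (Function.update s.offer j (truthfulOffer _ hz)) θ' (some j) *
      (E.incomeValue θ' - c * E.annuity) := fun θ' =>
    mul_nonneg (mul_nonneg (E.prior_pos _).le (hs.accept_nonneg _ _ _)) (sub_nonneg.2 (hcI θ').le)
  have hpos : 0 < E.prior θ * s.accept (Function.update s.offer j (truthfulOffer _ hz)) θ (some j) *
      (E.incomeValue θ - c * E.annuity) := by
    rw [hone, mul_one]; exact mul_pos (E.prior_pos _) (sub_pos.2 (hcI θ))
  cases θ
  · linarith [hn high]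
  · linarith [hn low]

/-- Equilibrium utilities are `V*`. -/
theorem IsPBE.isCompetitivePair (hs : s.IsPBE) (hsol : E.Solvable) (hFI : E.VFI ∈ E.feasible)
    (hF : 2 ≤ Fintype.card F) {U : CType → ℝ}
    (hle : ∀ θ a, s.value s.offer θ a ≤ (U θ : EReal))
    (heq : ∀ θ a, 0 < s.accept s.offer θ a → s.value s.offer θ a = (U θ : EReal)) :
    E.IsCompetitivePair U := by
  obtain ⟨hU, h0, hP, -⟩ := hs.zero_profit hsol hF hle heq
  obtain ⟨j₀⟩ : Nonempty F := Fintype.card_pos_iff.1 (by omega)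
  have hge := hs.VFI_le h0 j₀ hU hle
  have hatt := attains_optTypeProfit hsol hU
  have ht := (hatt low).le_tangent (E.meanIncome low)
  rw [meanIncome_mul, ← VFI_eq] at ht
  -- Otherwise the low type makes losses, the high type pays for them, and hence is below her
  -- full-information utility.
  have hlow : U low = E.VFI low := by
    by_contra hne
    have hgt : E.VFI low < U low := lt_of_le_of_ne (hge low) (Ne.symm hne)
    have hPl : E.optTypeProfit U low < 0 := by
      by_contra! h
      have := mul_nonneg (E.marginal_pos (E.meanIncome low)).le h
      linarith
    have hPh : 0 < E.optTypeProfit U high := by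
      have := mul_neg_of_pos_of_neg (E.prior_pos low) hPl
      exact pos_of_mul_pos_right (show 0 < E.prior high * E.optTypeProfit U high by linarith)
        (E.prior_pos high).le
    have hth := (hatt high).le_tangent (E.meanIncome high)
    rw [meanIncome_mul, ← VFI_eq] at hth
    have hlt : U high < E.VFI high := by
      have := mul_pos (E.marginal_pos (E.meanIncome high)) hPh
      linarith
    choose k hk using mem_feasible_iff.1 hFI
    obtain ⟨a₀, ha₀⟩ := hs.exists_accept_pos s.offer low
    -- The deviator must not be the one whose offer keeps the low type away: `a₀` stays available to
    -- her.
    obtain ⟨j, hj⟩ : ∃ j, a₀ ≠ some j := by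
      cases a₀ with
      | none => exact ⟨j₀, by simp⟩
      | some i =>
        obtain ⟨j, hj⟩ := Fintype.exists_ne_of_one_lt_card hF i
        exact ⟨j, fun h => hj (Option.some.inj h).symm⟩
    -- A weight `a` on a contract for the full-information pair raises the high type's utility and
    -- lowers the low type's. Only the high type switches, and the profit tends to the optimal one
    -- as `a` vanishes.
    have : E.optTypeProfit U high ≤ 0 := by
      refine Screening.le_of_forall_mix_le (Q := E.incomeValue high - k high) fun a ha0 ha1 => ?_
      obtain ⟨z, π, ho, hu, hπ, hπge⟩ :=
        exists_mechanism fun θ => (hk θ).mix (hatt θ) ha0.le ha1.le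
      have hdev := hs.offer_optimal j (truthfulOffer z ho)
      have hacc_high := hs.accept_update_eq_one (o := s.offer) j ho (θ := high) fun b => by
        rw [hu]
        refine (hle high b).trans_lt (EReal.coe_lt_coe_iff.2 ?_)
        simp only [Pi.add_apply, Pi.smul_apply, smul_eq_mul]
        linarith [mul_lt_mul_of_pos_left hlt ha0]
      have hacc_low := hs.accept_update_eq_zero (o := s.offer) j ho (θ := low) hj (by
        rw [hu, heq low a₀ ha₀, EReal.coe_lt_coe_iff]
        simp only [Pi.add_apply, Pi.smul_apply, smul_eq_mul]
        linarith [mul_lt_mul_of_pos_left hgt ha0])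
      rw [h0, hs.firmProfit_update _ _ ho hπ, hacc_high, hacc_low, EReal.coe_nonpos, mul_zero,
        zero_mul, zero_add, mul_one] at hdev
      have := nonpos_of_mul_nonpos_right hdev (E.prior_pos high)
      have := hπge high
      linarith
    linarith
  refine ⟨hU, hlow, ?_⟩
  have hl : E.Attains low U (E.incomeValue low) := by
    rw [Screening.eq_pair U, hlow]; exact attains_low_VFI (hge high)
  have h1 := hl.le_optTypeProfit hsol hU
  have h2 : E.optTypeProfit U low ≤ 0 := by
    by_contra! h
    have := mul_pos (E.marginal_pos (E.meanIncome low)) h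
    linarith
  have h3 : E.optTypeProfit U low = 0 := le_antisymm h2 (by linarith)
  rw [h3, mul_zero, zero_add] at hP
  exact (mul_eq_zero.1 hP).resolve_left (E.prior_pos high).ne'

theorem IsPBE.hasOutcome (hs : s.IsPBE) (hsol : E.Solvable) (hF : 2 ≤ Fintype.card F)
    {U : CType → ℝ} (hle : ∀ θ a, s.value s.offer θ a ≤ (U θ : EReal))
    (heq : ∀ θ a, 0 < s.accept s.offer θ a → s.value s.offer θ a = (U θ : EReal))
    {z : Mechanism Y Φ} (hz : E.Solves U z) : s.HasOutcome z := by
  obtain ⟨hU, -, -, hopt⟩ := hs.zero_profit hsol hF hle heq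
  intro θ a ha
  have h1 := hs.isPlan hle heq ha
  rw [hopt θ a ha] at h1
  exact h1.samePath (hz.isPlan hU θ) fun k hk => hz.le hU hk

end Profile

end

/-! ### The right derivative of the profit on the high type -/

section

variable {E}

theorem _root_.Screening.update_low (V : CType → ℝ) (v : ℝ) :
    Function.update V low v = pair v (V high) := by
  funext θ; cases θ <;> rfl

variable (E) in
/-- Optimal profit on the high type as a function of the utility of the low type. -/
def highProfit (V : CType → ℝ) (v : ℝ) : ℝ := E.optTypeProfit (Function.update V low v) high

section

variable {V : CType → ℝ} (hsol : E.Solvable) (hV : E.IsCompetitivePair V)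
include hsol hV

omit hsol in
theorem IsCompetitivePair.highProfit_self : E.highProfit V (V low) = 0 := by
  rw [highProfit, Function.update_eq_self]; exact hV.2.2

omit hsol in
theorem IsCompetitivePair.exists_const_low {v : ℝ} (h : v ∈ Set.Icc (V low) (V high)) :
    ∃ c : ℝ≥0, v = E.u c * E.annuity ∧ E.Attains low (pair v (V high)) (c * E.annuity) := by
  choose k hk using mem_feasible_iff.1 hV.1
  obtain ⟨C, hC⟩ := exists_rich hk
  obtain ⟨c, hc⟩ := E.exists_const ((hk low).floor_le.trans h.1) (h.2.trans (hC high).le)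
  refine ⟨c, hc, E.attains_const hc fun θ => ?_⟩
  rw [← hc]; cases θ
  exacts [le_rfl, h.2]

theorem IsCompetitivePair.update_mem {v : ℝ} (h : v ∈ Set.Icc (V low) (V high)) :
    pair v (V high) ∈ E.feasible := by
  rw [mem_feasible_iff]
  intro θ
  cases θ
  · obtain ⟨c, -, hc⟩ := hV.exists_const_low h
    exact ⟨_, hc⟩
  · refine ⟨_, (hV.attains hsol).relax rfl fun θ => ?_⟩
    cases θ
    exacts [h.1, le_rfl]

theorem IsCompetitivePair.attains_highProfit {v : ℝ} (h : v ∈ Set.Icc (V low) (V high)) :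
    E.Attains high (pair v (V high)) (E.incomeValue high - E.highProfit V v) := by
  rw [highProfit, update_low]
  exact attains_optTypeProfit hsol (hV.update_mem hsol h) high

theorem IsCompetitivePair.le_highProfit {v k : ℝ} (h : v ∈ Set.Icc (V low) (V high))
    (hk : E.Attains high (pair v (V high)) k) : E.incomeValue high - k ≤ E.highProfit V v := by
  have := hk.le_optTypeProfit hsol (hV.update_mem hsol h)
  rw [highProfit, update_low]
  linarith

theorem IsCompetitivePair.low_lt_high : V low < V high := by
  rw [hV.2.1]; exact hV.VFI_lt hsol

/-- The contracts at `w` and at `V` mix to one at `v`, so the profit is concave along this line and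
its chords from `V low` flatten. -/
theorem IsCompetitivePair.antitoneOn_slope :
    AntitoneOn (slope (E.highProfit V) (V low)) (Set.Ioo (V low) (V high)) := by
  intro v hv w hw hvw
  have hp : 0 < v - V low := sub_pos.2 hv.1
  have hq : 0 < w - V low := sub_pos.2 hw.1
  rw [slope_def_field, slope_def_field, hV.highProfit_self, sub_zero, sub_zero]
  have h1 := (hV.attains_highProfit hsol (Set.Ioo_subset_Icc_self hw)).mix (hV.attains hsol)
    (a := (v - V low) / (w - V low)) (div_nonneg hp.le hq.le)
    ((div_le_one hq).2 (by linarith))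
  rw [Screening.eq_pair V, smul_pair_add] at h1
  have h2 := hV.le_highProfit hsol (Set.Ioo_subset_Icc_self hv) (k := _) (by
    convert h1 using 2
    · simp only [pair]; field_simp; ring
    · simp only [pair]; ring)
  rw [← Screening.eq_pair V] at h2
  rw [le_div_iff₀ hp]
  refine le_trans (le_of_eq ?_) h2
  field_simp
  ring

/-- If no profit can be made on both types, the right derivative exists and satisfies the bound. -/
theorem IsCompetitivePair.exists_hasDerivWithinAt
    (hno : ∀ W κ : CType → ℝ, (∀ θ, V θ ≤ W θ) → (∀ θ, E.Attains θ W (κ θ)) →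
      E.prior low * (E.incomeValue low - κ low) +
        E.prior high * (E.incomeValue high - κ high) ≤ 0) :
    ∃ d : ℝ, HasDerivWithinAt (E.highProfit V) d (Set.Ici (V low)) (V low) ∧
      E.marginal (E.meanIncome low) * d ≤ E.prior low / E.prior high := by
  set a := V low with ha
  set b := V high with hb
  set G := E.highProfit V with hG
  have hab : a < b := hV.low_lt_high hsol
  have hA := E.annuity_pos
  have hVa : a = E.u (E.meanIncome low) * E.annuity := by rw [ha, hV.2.1, VFI_eq]
  set ρ := E.prior low / E.prior high with hρ
  have hρ0 : 0 < ρ := div_pos (E.prior_pos _) (E.prior_pos _)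
  -- The tested pair gives the low type full insurance `c` and the high type her optimal contract at
  -- `v`.
  have hcost : ∀ v ∈ Set.Ioo a b, ∀ c : ℝ≥0, v = E.u c * E.annuity →
      G v ≤ ρ * ((c - E.meanIncome low) * E.annuity) := by
    intro v hv c hc
    have hv' := Set.Ioo_subset_Icc_self hv
    have h1 := hno (pair v b) (pair (c * E.annuity) (E.incomeValue high - G v))
      (fun θ => by cases θ; exacts [hv.1.le, le_rfl]) fun θ => by
        cases θ
        · exact E.attains_const hc fun θ => by rw [← hc]; cases θ; exacts [le_rfl, hv.2.le]
        · exact hV.attains_highProfit hsol hv'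
    simp only [pair] at h1
    have h2 : E.prior high * G v ≤ E.prior low * ((c - E.meanIncome low) * E.annuity) := by
      rw [sub_mul, meanIncome_mul]; linarith
    rw [hρ, div_mul_eq_mul_div, le_div_iff₀ (E.prior_pos high)]
    linarith
  have hc_lt : ∀ v ∈ Set.Ioo a b, ∀ c : ℝ≥0, v = E.u c * E.annuity → E.meanIncome low < c := by
    intro v hv c hc
    have : E.u (E.meanIncome low) * E.annuity < E.u c * E.annuity := by
      rw [← hVa, ← hc]; exact hv.1
    exact E.u_lt_iff.1 (lt_of_mul_lt_mul_right this hA.le)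
  have hGa : G a = 0 := hV.highProfit_self
  obtain ⟨cb, hcb, -⟩ := hV.exists_const_low (v := b) ⟨hab.le, le_rfl⟩
  -- Marginal utility on the relevant range is at least that at `cb`, so the extra consumption in
  -- `hcost` is at most proportional to `v - a`.
  have hbdd : BddAbove (slope G a '' Set.Ioo a b) := by
    refine ⟨ρ / E.marginal cb, ?_⟩
    rintro _ ⟨v, hv, rfl⟩
    obtain ⟨c, hc, -⟩ := hV.exists_const_low (Set.Ioo_subset_Icc_self hv)
    have hlt := hc_lt v hv c hc
    have hccb : c ≤ cb := E.u_le_iff.1 (le_of_mul_le_mul_right (by rw [← hc, ← hcb]; exact hv.2.le) hA)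
    have hmarg : E.marginal cb ≤ E.marginal c :=
      (E.u_strictConcave.strictAntiOn_derivWithin
        (E.u_contDiff.differentiableOn (by norm_num))).antitoneOn c.coe_mem_Ici cb.coe_mem_Ici
        (NNReal.coe_le_coe.2 hccb)
    have hlt' : (0 : ℝ) < c - E.meanIncome low := sub_pos.2 (NNReal.coe_lt_coe.2 hlt)
    have h1 : E.marginal cb * ((c - E.meanIncome low) * E.annuity) ≤ v - a := by
      have h2 := E.u_le_tangent c (E.meanIncome low)
      have h3 := mul_le_mul_of_nonneg_right hmarg hlt'.le
      have h4 : E.marginal cb * (c - E.meanIncome low) ≤ E.u c - E.u (E.meanIncome low) := by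
        linarith
      have h5 := mul_le_mul_of_nonneg_right h4 hA.le
      rw [hVa, hc]; linarith
    rw [slope_def_field, hGa, sub_zero, div_le_div_iff₀ (sub_pos.2 hv.1) (E.marginal_pos cb)]
    have h6 := mul_le_mul_of_nonneg_right (hcost v hv c hc) (E.marginal_pos cb).le
    have h7 := mul_le_mul_of_nonneg_left h1 hρ0.le
    linarith
  have hlim : Filter.Tendsto (slope G a) (nhdsWithin a (Set.Ioi a))
      (nhds (sSup (slope G a '' Set.Ioo a b))) := (hV.antitoneOn_slope hsol).tendsto_nhdsWithin_Ioo_right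
    (Set.nonempty_Ioo.2 hab) hbdd
  set d := sSup (slope G a '' Set.Ioo a b)
  have hder : HasDerivWithinAt G d (Set.Ioi a) a :=
    (hasDerivWithinAt_iff_tendsto_slope' (by simp)).2 hlim
  refine ⟨d, hder.Ici_of_Ioi, ?_⟩
  set c₀ := E.meanIncome low
  have hu : HasDerivWithinAt E.u (E.marginal c₀) (Set.Ioi (c₀ : ℝ)) c₀ :=
    (E.hasDerivWithinAt_u c₀).mono fun x hx => c₀.coe_nonneg.trans (le_of_lt hx)
  have hlim₁ := (hasDerivWithinAt_iff_tendsto_slope' (by simp)).1 hu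
  have hcont : Filter.Tendsto (fun c => E.u c * E.annuity) (nhdsWithin (c₀ : ℝ) (Set.Ioi (c₀ : ℝ)))
      (nhdsWithin a (Set.Ioi a)) := by
    refine tendsto_nhdsWithin_iff.2 ⟨?_, ?_⟩
    · rw [hVa]
      exact hu.continuousWithinAt.tendsto.mul_const _
    · filter_upwards [self_mem_nhdsWithin] with c hc
      have hc' : (c₀ : ℝ) < c := hc
      have : c₀ < ⟨c, c₀.coe_nonneg.trans hc'.le⟩ := hc'
      have := mul_lt_mul_of_pos_right (E.u_lt_iff.2 this) hA
      rw [Set.mem_Ioi, hVa]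
      exact this
  -- Along `v = u(c) * annuity` the product of the chord slopes of `u` at `c₀` and of `G` at `a` is
  -- bounded by `ρ`, as the utility increments cancel.
  have hlim₂ := hlim₁.mul (hlim.comp hcont)
  refine le_of_tendsto hlim₂ ?_
  filter_upwards [self_mem_nhdsWithin, hcont (Ioo_mem_nhdsGT hab)] with c hc hv
  have hc' : (c₀ : ℝ) < c := hc
  have h1 := hcost _ hv ⟨c, c₀.coe_nonneg.trans hc'.le⟩ rfl
  have hpos : 0 < c - c₀ := sub_pos.2 hc'
  have hpos' : 0 < E.u c * E.annuity - a := sub_pos.2 hv.1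
  simp only [Function.comp_apply]
  rw [slope_def_field, slope_def_field, hGa, sub_zero, div_mul_div_comm,
    div_le_iff₀ (mul_pos hpos hpos')]
  have e : E.u c * E.annuity - a = (E.u c - E.u c₀) * E.annuity := by rw [hVa]; ring
  have hpos'' : 0 < E.u c - E.u c₀ := by
    rw [e] at hpos'; exact pos_of_mul_pos_left hpos' hA.le
  have h2 := mul_le_mul_of_nonneg_left h1 hpos''.le
  refine h2.trans (le_of_eq ?_)
  rw [e]
  change _ * (ρ * ((c - c₀) * E.annuity)) = _
  ring

/-- Attracting both types by utilities above `V*` leaves a profit on the high type that is at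
most proportional to the rise in the utility of the low type. -/
theorem IsCompetitivePair.profit_le_of_hasDerivWithinAt {d : ℝ}
    (hd : HasDerivWithinAt (E.highProfit V) d (Set.Ici (V low)) (V low)) {W : CType → ℝ} {k : ℝ}
    (hW : E.Attains high W k) (hl : V low < W low) (hh : V high < W high) :
    E.incomeValue high - k ≤ d * (W low - V low) := by
  have hab := hV.low_lt_high hsol
  have hI : E.incomeValue low < k := by
    have := hW.le_tangent (E.meanIncome low)
    rw [meanIncome_mul, ← VFI_eq, ← hV.2.1] at this
    exact sub_pos.1 (pos_of_mul_pos_right (show 0 < E.marginal (E.meanIncome low) *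
      (k - E.incomeValue low) by linarith) (E.marginal_pos _).le)
  -- Mixing with pooled full insurance brings the high type down to `V high`; by `hI` this does not
  -- raise the cost.
  have hW' : E.Attains high (pair (W low) (V high)) k := by
    have hp : 0 < W high - V low := by linarith
    have h1 := hW.mix (attains_high_pooling (v := W low) (by rw [← hV.2.1]; exact hl.le))
      (a := (V high - V low) / (W high - V low)) (div_nonneg (by linarith) hp.le)
      ((div_le_one hp).2 (by linarith))
    rw [Screening.eq_pair W, smul_pair_add, ← hV.2.1] at h1
    simp only [pair] at h1
    have hs : (V high - V low) / (W high - V low) ≤ 1 := (div_le_one hp).2 (by linarith)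
    refine Attains.mono (κ := (V high - V low) / (W high - V low) * k +
      (1 - (V high - V low) / (W high - V low)) * E.incomeValue low) ?_ ?_
    · convert h1 using 2
      · ring
      · field_simp; ring
    · have := mul_le_mul_of_nonneg_left hI.le (sub_nonneg.2 hs)
      linarith
  have hD : 0 < W low - V low := sub_pos.2 hl
  rw [← div_le_iff₀ hD]
  have hlim := (hasDerivWithinAt_iff_tendsto_slope' (by simp)).1 hd.Ioi_of_Ici
  refine ge_of_tendsto hlim ?_
  filter_upwards [Ioo_mem_nhdsGT hab, Ioo_mem_nhdsGT hl] with v hv hv'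
  have hp : 0 < v - V low := sub_pos.2 hv.1
  -- By concavity the chord to a point `v` close to `V low` is at least as steep as the chord to `W
  -- low`.
  have h1 := hW'.mix (hV.attains hsol) (a := (v - V low) / (W low - V low))
    (div_nonneg hp.le hD.le) ((div_le_one hD).2 (by linarith [hv'.2]))
  rw [Screening.eq_pair V, smul_pair_add] at h1
  have h2 := hV.le_highProfit hsol (Set.Ioo_subset_Icc_self hv) (k := _) (by
    convert h1 using 2
    · simp only [pair]; field_simp; ring
    · simp only [pair]; ring)
  rw [← Screening.eq_pair V] at h2
  rw [slope_def_field, hV.highProfit_self, sub_zero, le_div_iff₀ hp]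
  refine le_trans (le_of_eq ?_) h2
  field_simp
  ring

end

end

/-! ### The candidate equilibrium: a common offer with ties broken in its favor -/

section

variable {E} {F : Type*}

open scoped Classical in
/-- An optimal reporting strategy in an offer, truthful whenever this is optimal. -/
def bestReport (m : E.Offer) (θ : CType) : Reporting Y :=
  if E.OptimalReporting m.1 θ truth then truth else (m.2 θ).choose

theorem bestReport_optimal (m : E.Offer) (θ : CType) :
    E.OptimalReporting m.1 θ (bestReport m θ) := by
  unfold bestReport
  split_ifs with h
  exacts [h, (m.2 θ).choose_spec]

/-- The utility of a type from accepting an offer, or none. -/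
def bestValue (o : F → E.Offer) (θ : CType) : Option F → EReal
  | none => E.utility E.autarky truth θ
  | some j => E.utility (o j).1 (bestReport (o j) θ) θ

variable [Fintype F]

open scoped Classical in
/-- The best options of a type. -/
def bestOptions (o : F → E.Offer) (θ : CType) : Finset (Option F) :=
  Finset.univ.filter fun a => ∀ b, bestValue o θ b ≤ bestValue o θ a

theorem mem_bestOptions {o : F → E.Offer} {θ : CType} {a : Option F} :
    a ∈ bestOptions o θ ↔ ∀ b, bestValue o θ b ≤ bestValue o θ a := by
  simp [bestOptions]

theorem bestOptions_nonempty (o : F → E.Offer) (θ : CType) : (bestOptions o θ).Nonempty := by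
  obtain ⟨a, -, ha⟩ := Finset.exists_max_image Finset.univ (bestValue o θ) ⟨none, Finset.mem_univ _⟩
  exact ⟨a, mem_bestOptions.2 fun b => ha b (Finset.mem_univ b)⟩

open scoped Classical in
/-- The best options that are an offer of `m`. -/
def favored (m : E.Offer) (o : F → E.Offer) (θ : CType) : Finset (Option F) :=
  (bestOptions o θ).filter fun a => ∃ j, a = some j ∧ o j = m

theorem mem_favored {m : E.Offer} {o : F → E.Offer} {θ : CType} {a : Option F} :
    a ∈ favored m o θ ↔ a ∈ bestOptions o θ ∧ ∃ j, a = some j ∧ o j = m := by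
  simp [favored]

open scoped Classical in
/-- The options from which a type chooses at random if ties are broken in favor of `m`. -/
def selected (m : E.Offer) (o : F → E.Offer) (θ : CType) : Finset (Option F) :=
  if (favored m o θ).Nonempty then favored m o θ else bestOptions o θ

theorem selected_nonempty (m : E.Offer) (o : F → E.Offer) (θ : CType) :
    (selected m o θ).Nonempty := by
  unfold selected
  split_ifs with h
  exacts [h, bestOptions_nonempty o θ]

theorem selected_subset (m : E.Offer) (o : F → E.Offer) (θ : CType) :
    selected m o θ ⊆ bestOptions o θ := by
  unfold selected
  split_ifs with h
  · intro a ha; exact (mem_favored.1 ha).1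
  · exact subset_rfl

open scoped Classical in
/-- All firms offer `m` and ties are broken in favor of `m`. -/
def commonOffer (m : E.Offer) : E.Profile F where
  offer := fun _ => m
  accept o θ a := if a ∈ selected m o θ then ((selected m o θ).card : ℝ)⁻¹ else 0
  report o j θ := bestReport (o j) θ

omit [Fintype F] in
theorem bestValue_comp (σ : Equiv.Perm F) (o : F → E.Offer) (θ : CType) (a : Option F) :
    bestValue (o ∘ σ) θ a = bestValue o θ (Equiv.optionCongr σ a) := by
  cases a <;> rfl

theorem mem_bestOptions_comp (σ : Equiv.Perm F) (o : F → E.Offer) (θ : CType) (a : Option F) :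
    a ∈ bestOptions (o ∘ σ) θ ↔ Equiv.optionCongr σ a ∈ bestOptions o θ := by
  simp only [mem_bestOptions, bestValue_comp]
  exact (Equiv.optionCongr σ).forall_congr_left.trans (by simp)

theorem mem_favored_comp (m : E.Offer) (σ : Equiv.Perm F) (o : F → E.Offer) (θ : CType)
    (a : Option F) :
    a ∈ favored m (o ∘ σ) θ ↔ Equiv.optionCongr σ a ∈ favored m o θ := by
  rw [mem_favored, mem_favored, mem_bestOptions_comp]
  refine and_congr_right fun _ => ?_
  cases a <;> simp

theorem mem_selected_comp (m : E.Offer) (σ : Equiv.Perm F) (o : F → E.Offer) (θ : CType)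
    (a : Option F) :
    a ∈ selected m (o ∘ σ) θ ↔ Equiv.optionCongr σ a ∈ selected m o θ := by
  have hne : (favored m (o ∘ σ) θ).Nonempty ↔ (favored m o θ).Nonempty := by
    constructor
    · rintro ⟨a, ha⟩
      exact ⟨_, (mem_favored_comp m σ o θ a).1 ha⟩
    · rintro ⟨a, ha⟩
      exact ⟨(Equiv.optionCongr σ).symm a, (mem_favored_comp m σ o θ _).2 (by
        rwa [Equiv.apply_symm_apply])⟩
  unfold selected
  simp only [hne]
  split_ifs
  exacts [mem_favored_comp m σ o θ a, mem_bestOptions_comp σ o θ a]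

theorem card_selected_comp (m : E.Offer) (σ : Equiv.Perm F) (o : F → E.Offer) (θ : CType) :
    (selected m (o ∘ σ) θ).card = (selected m o θ).card :=
  Finset.card_bij (fun a _ => Equiv.optionCongr σ a)
    (fun a ha => (mem_selected_comp m σ o θ a).1 ha)
    (fun a _ b _ h => (Equiv.optionCongr σ).injective h)
    fun b hb => ⟨(Equiv.optionCongr σ).symm b, (mem_selected_comp m σ o θ _).2 (by
      rwa [Equiv.apply_symm_apply]), Equiv.apply_symm_apply _ _⟩

theorem value_commonOffer (m : E.Offer) (o : F → E.Offer) (θ : CType) (a : Option F) :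
    (commonOffer m).value o θ a = bestValue o θ a := by
  cases a <;> rfl

theorem commonOffer_isPBE [DecidableEq F] (m : E.Offer)
    (h : ∀ (j : F) (m' : E.Offer),
      (commonOffer m).firmProfit (Function.update (fun _ => m) j m') j ≤
        (commonOffer m).firmProfit (fun _ => m) j) : (commonOffer m : E.Profile F).IsPBE where
  accept_mem o θ := by
    classical
    refine ⟨fun a => ?_, ?_⟩
    · simp only [commonOffer]; split_ifs <;> positivity
    · have hc : ((selected m o θ).card : ℝ) ≠ 0 :=
        Nat.cast_ne_zero.2 (selected_nonempty m o θ).card_pos.ne'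
      simp only [commonOffer, Finset.sum_ite_mem, Finset.univ_inter, Finset.sum_const, nsmul_eq_mul]
      exact mul_inv_cancel₀ hc
  report_optimal o j θ := bestReport_optimal (o j) θ
  accept_optimal o θ a ha b := by
    rw [value_commonOffer, value_commonOffer]
    have : a ∈ selected m o θ := by
      by_contra hn
      simp [commonOffer, hn] at ha
    exact mem_bestOptions.1 (selected_subset m o θ this) b
  offer_optimal j m' := h j m'
  symmetric σ o θ j := by
    have hj : some j ∈ selected m (o ∘ σ) θ ↔ some (σ j) ∈ selected m o θ :=
      mem_selected_comp m σ o θ (some j)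
    by_cases hm : some (σ j) ∈ selected m o θ <;> simp [commonOffer, card_selected_comp, hj, hm]
  truthful o j θ ht := if_pos ht

theorem accept_commonOffer_eq_one {m : E.Offer} {o : F → E.Offer} {θ : CType} {j : F}
    (h : ∀ a, a ≠ some j → bestValue o θ a < bestValue o θ (some j)) :
    (commonOffer m).accept o θ (some j) = 1 := by
  have h1 : ∀ a ∈ selected m o θ, a = some j := fun a ha => by
    by_contra hne
    exact absurd (h a hne) (not_lt.2 (mem_bestOptions.1 (selected_subset m o θ ha) _))
  have h2 : selected m o θ = {some j} :=
    Finset.eq_singleton_iff_nonempty_unique_mem.2 ⟨selected_nonempty m o θ, h1⟩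
  simp [commonOffer, h2]

/-- Tie-breaking at work: a deviator is left by every type to whom some remaining `m` is a best
option. -/
theorem accept_commonOffer_eq_zero {m : E.Offer} {o : F → E.Offer} {θ : CType} {i j : F}
    (hi : o i = m) (hj : o j ≠ m) (h : ∀ a, bestValue o θ a ≤ bestValue o θ (some i)) :
    (commonOffer m).accept o θ (some j) = 0 := by
  have h1 : some i ∈ favored m o θ := mem_favored.2 ⟨mem_bestOptions.2 h, i, rfl, hi⟩
  have h2 : some j ∉ selected m o θ := by
    unfold selected
    rw [if_pos ⟨_, h1⟩, mem_favored]
    rintro ⟨-, j', hj', h⟩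
    rw [← Option.some.inj hj'] at h
    exact hj h
  simp [commonOffer, h2]

end

/-! ### Sufficiency of the derivative condition -/

section

variable {E}

section

variable {V : CType → ℝ} (hsol : E.Solvable) (hV : E.IsCompetitivePair V)
include hsol hV

theorem IsCompetitivePair.optTypeProfit_low : E.optTypeProfit V low = 0 := by
  have h1 : E.Attains low V (E.incomeValue low) := by
    rw [hV.eq_pair]; exact attains_low_VFI (hV.VFI_lt hsol).le
  have h2 := h1.le_optTypeProfit hsol hV.1
  have h3 := (attains_optTypeProfit hsol hV.1 low).le_tangent (E.meanIncome low)
  rw [meanIncome_mul, ← VFI_eq, hV.2.1] at h3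
  refine le_antisymm ?_ (by linarith)
  by_contra! h
  have := mul_pos (E.marginal_pos (E.meanIncome low)) h
  linarith

omit hsol in
/-- Accepting no offer is no better than `V*`. -/
theorem IsCompetitivePair.utility_autarky_low : E.utility E.autarky truth low ≤ (V low : EReal) := by
  have hp : E.typeProfit E.autarky truth low = ((0 : ℝ) : EReal) := E.typeProfit_autarky _ _
  obtain ⟨x, hx⟩ := E.exists_utility_eq hp
  have := E.le_tangent hx hp (E.meanIncome low)
  rw [meanIncome_mul, sub_zero, sub_self, mul_zero, add_zero, ← VFI_eq, ← hV.2.1] at this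
  rw [hx, EReal.coe_le_coe_iff]
  exact this

/-- Autarky is itself a contract with zero profit that gives the low type at most `V low`. If it
gave the high type more than `V high`, it would have to make a loss. -/
theorem IsCompetitivePair.utility_autarky_high :
    E.utility E.autarky truth high ≤ (V high : EReal) := by
  have hp : ∀ θ, E.typeProfit E.autarky truth θ = ((0 : ℝ) : EReal) :=
    fun θ => E.typeProfit_autarky _ _
  choose x hx using fun θ => E.exists_utility_eq (hp θ)
  rw [hx, EReal.coe_le_coe_iff]
  by_contra! hlt
  have hlow := hV.utility_autarky_low
  rw [hx, EReal.coe_le_coe_iff, hV.2.1] at hlow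
  have h1 := (isPlan_of_utility_le (V := x) (hx high)
    (fun θ r => ((E.utility_autarky r θ).trans (hx θ)).le) (hp high)).attains
  have h2 := h1.relax (V' := pair (E.VFI low) (x high)) rfl fun θ => by
    cases θ
    exacts [hlow, le_rfl]
  exact absurd (hV.lt_of_gt hsol hlt h2) (by simp)

omit hsol in
/-- Utility of the low type above `V*` costs at least what it is worth under full insurance. -/
theorem IsCompetitivePair.typeProfit_low_le {z : Mechanism Y Φ} {r : Reporting Y}
    {x π : ℝ} (hx : E.utility z r low = (x : EReal)) (hπ : E.typeProfit z r low = (π : EReal)) :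
    x - V low ≤ -(E.marginal (E.meanIncome low) * π) := by
  have := E.le_tangent hx hπ (E.meanIncome low)
  rw [meanIncome_mul, ← VFI_eq, ← hV.2.1] at this
  linarith

theorem exists_isPBE {F : Type*} [Fintype F] [DecidableEq F] (hF : 2 ≤ Fintype.card F) {d : ℝ}
    (hd : HasDerivWithinAt (E.highProfit V) d (Set.Ici (V low)) (V low))
    (hbound : E.marginal (E.meanIncome low) * d ≤ E.prior low / E.prior high) :
    ∃ s : E.Profile F, s.IsPBE := by
  obtain ⟨z, hz⟩ := hsol V hV.1
  have ho : ∀ θ, E.OptimalReporting z θ truth := fun θ r => by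
    rw [hz.2.1 θ]; exact hz.1.utility_le hz.2.1 θ r
  set m₀ := truthfulOffer z ho with hm₀
  have hrep : ∀ θ, bestReport m₀ θ = truth := fun θ => if_pos (ho θ)
  have hzero : ∀ θ, E.typeProfit z truth θ = 0 := fun θ => by
    rw [hz.typeProfit_eq hV.1]
    cases θ
    · rw [hV.optTypeProfit_low hsol]; rfl
    · rw [hV.2.2]; rfl
  refine ⟨commonOffer m₀, commonOffer_isPBE m₀ fun j m => ?_⟩
  have hpath : (commonOffer m₀ : E.Profile F).firmProfit (fun _ => m₀) j = 0 := by
    rw [Profile.firmProfit_eq]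
    change _ * E.typeProfit z (bestReport m₀ low) low +
      _ * E.typeProfit z (bestReport m₀ high) high = 0
    rw [hrep, hrep, hzero, hzero, mul_zero, mul_zero, add_zero]
  by_cases hm : m = m₀
  · rw [hm, Function.update_eq_self_iff.2 rfl]
  obtain ⟨i, hij⟩ := Fintype.exists_ne_of_one_lt_card hF j
  rw [hpath]
  set o : F → E.Offer := Function.update (fun _ => m₀) j m with hoeq
  have hoj : o j = m := Function.update_self _ _ _
  have hoi : ∀ k, k ≠ j → o k = m₀ := fun k hk => Function.update_of_ne hk _ _
  have hval : ∀ k, k ≠ j → ∀ θ, bestValue o θ (some k) = (V θ : EReal) := fun k hk θ => by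
    rw [bestValue, hoi k hk, hrep]; exact hz.2.1 θ
  have hnone : ∀ θ, bestValue o θ none ≤ (V θ : EReal) := fun θ => by
    cases θ
    exacts [hV.utility_autarky_low, hV.utility_autarky_high hsol]
  have hvj : ∀ θ, bestValue o θ (some j) = E.utility m.1 (bestReport m θ) θ := fun θ => by
    rw [bestValue, hoj]
  have hother : ∀ θ a, a ≠ some j → bestValue o θ a ≤ (V θ : EReal) := fun θ a ha => by
    cases a with
    | none => exact hnone θ
    | some k => exact (hval k (fun h => ha (by rw [h])) θ).le
  have hacc1 : ∀ θ, (V θ : EReal) < E.utility m.1 (bestReport m θ) θ →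
      (commonOffer m₀ : E.Profile F).accept o θ (some j) = 1 := fun θ h =>
    accept_commonOffer_eq_one fun a ha => by
      rw [hvj]; exact (hother θ a ha).trans_lt h
  have hacc0 : ∀ θ, E.utility m.1 (bestReport m θ) θ ≤ (V θ : EReal) →
      (commonOffer m₀ : E.Profile F).accept o θ (some j) = 0 := fun θ h =>
    accept_commonOffer_eq_zero (hoi i hij) (by rwa [hoj]) fun a => by
      rw [hval i hij]
      by_cases ha : a = some j
      · rw [ha, hvj]; exact h
      · exact hother θ a ha
  have hcap : ∀ θ r, E.utility m.1 r θ ≤ E.utility m.1 (bestReport m θ) θ :=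
    fun θ r => bestReport_optimal m θ r
  have hmarg := E.marginal_pos (E.meanIncome low)
  have hr : ∀ θ, (commonOffer m₀ : E.Profile F).report o j θ = bestReport m θ := fun θ =>
    congrArg (fun m' => bestReport m' θ) hoj
  rw [Profile.firmProfit_eq, hoj, hr, hr]
  -- Each type accepts the deviation exactly if it beats `V`. If only the high type does, `lt_of_gt`
  -- gives a loss; if only the low type does, the tangent bound gives one. The derivative matters
  -- only when both accept.
  by_cases hl : E.utility m.1 (bestReport m low) low ≤ (V low : EReal) <;>
    by_cases hh : E.utility m.1 (bestReport m high) high ≤ (V high : EReal)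
  · rw [hacc0 low hl, hacc0 high hh]; simp
  · rw [hacc0 low hl, hacc1 high (not_le.1 hh)]
    by_cases hb : E.typeProfit m.1 (bestReport m high) high = ⊥
    · rw [hb, mul_one, EReal.coe_mul_bot_of_pos (E.prior_pos _), EReal.add_bot]; exact bot_le
    obtain ⟨π, hπ⟩ := E.exists_typeProfit_eq hb
    obtain ⟨x, hx⟩ := E.exists_utility_eq hπ
    rw [hx, EReal.coe_le_coe_iff, not_le] at hh
    have hp := isPlan_of_utility_le (V := pair (E.VFI low) x) hx (fun θ r => by
      cases θ
      · exact (hcap low r).trans (hl.trans_eq (by rw [hV.2.1]; rfl))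
      · exact (hcap high r).trans hx.le) hπ
    have := hV.lt_of_gt hsol hh hp.attains_of_reporting
    rw [hπ, mul_zero, EReal.coe_zero, zero_mul, zero_add, mul_one, ← EReal.coe_mul,
      EReal.coe_nonpos]
    exact mul_nonpos_of_nonneg_of_nonpos (E.prior_pos _).le (by linarith)
  · rw [hacc1 low (not_le.1 hl), hacc0 high hh]
    by_cases hb : E.typeProfit m.1 (bestReport m low) low = ⊥
    · rw [hb, mul_one, EReal.coe_mul_bot_of_pos (E.prior_pos _), EReal.bot_add]; exact bot_le
    obtain ⟨π, hπ⟩ := E.exists_typeProfit_eq hb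
    obtain ⟨x, hx⟩ := E.exists_utility_eq hπ
    rw [hx, EReal.coe_le_coe_iff, not_le] at hl
    have h1 := hV.typeProfit_low_le hx hπ
    have h2 : π ≤ 0 := by
      by_contra! h
      have := mul_pos hmarg h
      linarith
    rw [hπ, mul_zero, EReal.coe_zero, zero_mul, add_zero, mul_one, ← EReal.coe_mul,
      EReal.coe_nonpos]
    exact mul_nonpos_of_nonneg_of_nonpos (E.prior_pos _).le h2
  · rw [hacc1 low (not_le.1 hl), hacc1 high (not_le.1 hh), mul_one, mul_one]
    by_cases hb : E.typeProfit m.1 (bestReport m low) low = ⊥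
    · rw [hb, EReal.coe_mul_bot_of_pos (E.prior_pos _), EReal.bot_add]; exact bot_le
    by_cases hb' : E.typeProfit m.1 (bestReport m high) high = ⊥
    · rw [hb', EReal.coe_mul_bot_of_pos (E.prior_pos _), EReal.add_bot]; exact bot_le
    obtain ⟨π, hπ⟩ := E.exists_typeProfit_eq hb
    obtain ⟨x, hx⟩ := E.exists_utility_eq hπ
    obtain ⟨π', hπ'⟩ := E.exists_typeProfit_eq hb'
    obtain ⟨x', hx'⟩ := E.exists_utility_eq hπ'
    rw [hx, EReal.coe_le_coe_iff, not_le] at hl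
    rw [hx', EReal.coe_le_coe_iff, not_le] at hh
    have hp := isPlan_of_utility_le (V := pair x x') hx' (fun θ r => by
      cases θ
      · exact (hcap low r).trans hx.le
      · exact (hcap high r).trans hx'.le) hπ'
    have h1 := hV.typeProfit_low_le hx hπ
    have h2 : π' ≤ d * (x - V low) := by
      have := hV.profit_le_of_hasDerivWithinAt hsol hd hp.attains_of_reporting hl hh
      rw [sub_sub_cancel] at this
      exact this
    have h3 : E.prior high * (E.marginal (E.meanIncome low) * d) ≤ E.prior low := by
      rw [le_div_iff₀ (E.prior_pos high)] at hbound
      linarith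
    -- After multiplication by marginal utility, the low type contributes at most `-prior low * (x -
    -- V low)` and the high type at most `prior low * (x - V low)`.
    have h4 : E.marginal (E.meanIncome low) * (E.prior low * π + E.prior high * π') ≤ 0 := by
      have h5 := mul_le_mul_of_nonneg_left h1 (E.prior_pos low).le
      have h6 := mul_le_mul_of_nonneg_left h2 (mul_pos hmarg (E.prior_pos high)).le
      have h7 := mul_le_mul_of_nonneg_right h3 (sub_pos.2 hl).le
      linarith
    rw [hπ, hπ', ← EReal.coe_mul, ← EReal.coe_mul, ← EReal.coe_add, EReal.coe_nonpos]
    exact nonpos_of_mul_nonpos_right h4 hmarg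

end

end

end Economy

end Screening

end

theorem mainTheorem4 {Y Φ F : Type*} [Fintype Y] [Fintype F] [DecidableEq F]
    (E : Screening.Economy Y Φ)
    -- there are at least two firms
    (hF : 2 ≤ Fintype.card F)
    -- the profit maximization problem has a solution for each feasible utility pair
    (hsol : ∀ V ∈ E.feasible, ∃ z, E.Solves V z)
    -- the full-information utility pair is feasible
    (hFI : E.VFI ∈ E.feasible) :
    -- the pair `V*` is well defined
    ∃ V, E.IsCompetitivePair V ∧ (∀ V', E.IsCompetitivePair V' → V' = V) ∧
      -- the mechanism `M^{V*}` is well defined, up to events of probability zero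
      ∃ z, E.Solves V z ∧
        (∀ z', E.Solves V z' → ∀ θ, E.SamePath z' Screening.truth z Screening.truth θ) ∧
        -- it is the outcome of each equilibrium
        (∀ s : E.Profile F, s.IsPBE → s.HasOutcome z) ∧
        -- equilibria exist if and only if the right-derivative of the profit on the high type
        -- with respect to the utility of the low type satisfies the bound
        ((∃ s : E.Profile F, s.IsPBE) ↔
          ∃ d : ℝ,
            HasDerivWithinAt
              (fun v => E.optTypeProfit (Function.update V Screening.CType.low v)
                Screening.CType.high)
              d (Set.Ici (V Screening.CType.low)) (V Screening.CType.low) ∧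
            derivWithin E.u (Set.Ici 0) (E.cFI Screening.CType.low) * d ≤
              E.prior Screening.CType.low / E.prior Screening.CType.high) := by
  obtain ⟨V, hV⟩ := Screening.Economy.exists_isCompetitivePair hsol hFI
  obtain ⟨z, hz⟩ := hsol V hV.1
  refine ⟨V, hV, fun V' hV' => hV.unique hsol hV', z, hz, fun z' hz' θ =>
    (hz'.isPlan hV.1 θ).samePath (hz.isPlan hV.1 θ) fun k hk => hz.le hV.1 hk, fun s hs => ?_,
    ?_, ?_⟩
  · obtain ⟨U, hle, heq⟩ := hs.exists_utilities
    obtain rfl := hV.unique hsol (hs.isCompetitivePair hsol hFI hF hle heq)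
    exact hs.hasOutcome hsol hF hle heq hz
  · rintro ⟨s, hs⟩
    obtain ⟨U, hle, heq⟩ := hs.exists_utilities
    obtain rfl := hV.unique hsol (hs.isCompetitivePair hsol hFI hF hle heq)
    obtain ⟨-, h0, -⟩ := hs.zero_profit hsol hF hle heq
    obtain ⟨j⟩ : Nonempty F := Fintype.card_pos_iff.1 (by omega)
    exact hV.exists_hasDerivWithinAt hsol fun W κ hW h =>
      hs.profit_le_firmProfit hle hW h (h0 j)
  · rintro ⟨d, hd, hbound⟩
    exact Screening.Economy.exists_isPBE hsol hV hF hd hbound
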